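/- **Setting.** Let $\{Z_k\}$ be a time-homogeneous, irreducible, aperiodic Markov chain on a finite set $\mathcal S$ with transition matrix $\Gamma$, stationary distribution $\pi$ and arbitrary initial law. In state $Z_k$ an instantaneous reward $C_k$ is received; given the past and $Z_k$ it has law $\nu(Z_k)$, and given the past and $(Z_k,C_k)$ the next state has law $\Gamma(Z_k,\cdot)$ (deterministic rewards $c(i)$ are the case $\nu(i)=\delta_{c(i)}$). Assume $|C_k|\le c_{\max}<\infty$ almost surely from every state, and put $\bar c(i)=\int c\,\nu(i)(dc)$. Let $\alpha\in[0,1)$, let $\phi(i)\in\mathbb R^d$ $(i\in\mathcal S)$ be feature vectors, $\phi_{\max}=\max_i\|\phi(i)\|$, let $\Phi$ be the $d\times|\mathcal S|$ matrix with columns $\phi(i)$, of full rank $d$, and $D=\mathrm{diag}(\pi)$. Let $\epsilon\in(0,1)$ and let $\Theta_0\in\mathbb R^d$ be deterministic. Norms are the 2-norm of vectors and the induced 2-norm of matrices. *TD(0):* $\Theta_{k+1}=\Theta_k-\epsilon\,\phi(Z_k)\big(\phi^\top(Z_k)\Theta_k-C_k-\alpha\phi^\top(Z_{k+1})\Theta_k\big)$.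 Put $X_k=(Z_k,C_k,Z_{k+1})$, $A(X_k)=-\phi(Z_k)\big(\phi(Z_k)-\alpha\phi(Z_{k+1})\big)^\top$, $b(X_k)=C_k\phi(Z_k)+A(X_k)\theta^*$, $\bar A=-\Phi D(\Phi^\top-\alpha\Gamma\Phi^\top)$, $\tilde b=\Phi D\bar c$. Normalization: $\phi_{\max}\le 1/\sqrt{1+\alpha}$. The state space of $X_k$ is the set of $(i,c,j)$ with $\Gamma_{ij}>0$ and $c$ in the support of $\nu(i)$. *TD($\lambda$), $\lambda\in[0,1]$:* with $\varphi_0=\phi(Z_0)$ and $\varphi_k=\alpha\lambda\varphi_{k-1}+\phi(Z_k)$, $\Theta_{k+1}=\Theta_k-\epsilon\big(\phi^\top(Z_k)\Theta_k-C_k-\alpha\phi^\top(Z_{k+1})\Theta_k\big)\varphi_k$. Put $X_k=(Z_k,C_k,Z_{k+1},\varphi_k)$, $A(X_k)=-\varphi_k\big(\phi(Z_k)-\alpha\phi(Z_{k+1})\big)^\top$, $b(X_k)=C_k\varphi_k+A(X_k)\theta^*$, $\bar A=\Phi D(U-I)\Phi^\top$ with $U=(1-\lambda)\sum_{j\ge0}\lambda^j(\alpha\Gamma)^{j+1}$,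 and $\tilde b=\Phi D\sum_{j\ge0}(\alpha\lambda\Gamma)^j\bar c$. Normalization: $\phi_{\max}\le\sqrt{(1-\alpha\lambda)/(1+\alpha)}$. The state space of $X_k$ is as for TD(0), with $\|\varphi\|\le\phi_{\max}/(1-\alpha\lambda)$. **Theorem.** For TD(0), and likewise for TD($\lambda$) with every $\lambda\in[0,1]$, under the corresponding normalization of the features, the following hold. (0) There is exactly one $\theta^*$ with $\bar A\theta^*+\tilde b=0$, and the centered iterates $\Theta'_k=\Theta_k-\theta^*$ satisfy $\Theta'_{k+1}=\Theta'_k+\epsilon\big(A(X_k)\Theta'_k+b(X_k)\big)$ for all $k\ge 0$. (1) (Assumption 1) $\{X_k\}$ is a Markov chain that stays almost surely in its state space, $\lim_kE[A(X_k)]=\bar A$ and $\lim_kE[b(X_k)]=0$ (all the expectations involved exist). Call an integer $\tau\ge1$ a mixing time at level $\delta$ if $\|E[b(X_k)\mid X_0=x]\|\le\delta$ and $\|\bar A-E[A(X_k)\mid X_0=x]\|\le\delta$ for all states $x$ and all $k\ge\tau$. There are mixing times $\tau_\delta$ at all levels $\delta>0$ such that for every $\delta_0<1$ there is $K\ge1$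 with $\tau_\delta\le K\log(1/\delta)$ for all $0<\delta\le\delta_0$. (2) (Assumption 2) $b_{\max}=\sup_x\|b(x)\|<\infty$ and $\|A(x)\|\le1$ for all states $x$. Moreover $b_{\max}\le c_{\max}\phi_{\max}+2\phi_{\max}^2\|\theta^*\|$ for TD(0), and $b_{\max}\le\big(c_{\max}+(1+\alpha)\phi_{\max}\|\theta^*\|\big)\frac{\phi_{\max}}{1-\alpha\lambda}$ for TD($\lambda$). (3) (Assumption 3) All complex eigenvalues of $\bar A$ have strictly negative real parts, and there is exactly one symmetric positive definite $P$ with $-I=\bar A^\top P+P\bar A$. (4) (Finite-time bound; no projection and no i.i.d. sampling) Let $\gamma_{\min},\gamma_{\max}$ be the smallest and the largest eigenvalue of $P$, and put $\kappa_1=62\gamma_{\max}(1+b_{\max})$, $\kappa_2=55\gamma_{\max}(1+b_{\max})^3$, $\tilde\kappa_2=2(\kappa_2+\gamma_{\max}b_{\max}^2)$. If $\tau$ is a mixing time at level $\epsilon$, $\epsilon\tau\le\frac14$ and $\kappa_1\epsilon\tau+\epsilon\gamma_{\max}\le0.05$, then for all $k\ge\tau$ $$E\big[\|\Theta_k-\theta^*\|^2\big]\le\frac{\gamma_{\max}}{\gamma_{\min}}\Big(1-\frac{0.9\,\epsilon}{\gamma_{\max}}\Big)^{k-\tau}\big(1.5\|\Theta_0-\theta^*\|+0.5\,b_{\max}\big)^2+\frac{\tilde\kappa_2\gamma_{\max}}{0.9\,\gamma_{\min}}\,\epsilon\tau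 .$$ -/

import Mathlib

open MeasureTheory ProbabilityTheory Filter Topology
open scoped Matrix Matrix.Norms.L2Operator

noncomputable section

namespace TDLearning

/-! ### Linear stochastic approximation driven by a Markov chain

Vectors live in `EuclideanSpace ℝ (Fin d)` (2-norm); with `Matrix.Norms.L2Operator` open, the norm
of a matrix is the induced 2-norm. A chain is described by its transition kernel `Q` on a measurable
space `𝓧` and by its state space `𝒮 : Set 𝓧`; the `k`-step kernel is `Q ^ k`, so that
`E[f(X_k) | X_0 = x]` is `∫ y, f y ∂(Q ^ k) x`. -/

/-- The vector `M v`. -/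
abbrev app {d : ℕ} (M : Matrix (Fin d) (Fin d) ℝ) (v : EuclideanSpace ℝ (Fin d)) :
    EuclideanSpace ℝ (Fin d) :=
  Matrix.toEuclideanLin M v

/-- `X` is a time-homogeneous Markov chain under `μ` with transition kernel `Q`:
`P(X_{n+1} ∈ B | X_0, …, X_n) = Q(X_n, B)`. -/
structure IsMarkovChain {Ω 𝓧 : Type*} [MeasurableSpace Ω] [MeasurableSpace 𝓧]
    (μ : Measure Ω) (X : ℕ → Ω → 𝓧) (Q : Kernel 𝓧 𝓧) : Prop where
  measurable : ∀ n, Measurable (X n)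
  markov : ∀ (n : ℕ) (F : Set Ω),
    MeasurableSet[⨆ i ∈ Set.Iic n, MeasurableSpace.comap (X i) inferInstance] F →
    ∀ B : Set 𝓧, MeasurableSet B → μ (F ∩ X (n + 1) ⁻¹' B) = ∫⁻ ω in F, Q (X n ω) B ∂μ

/-- `τ ≥ 1` is a mixing time at level `δ`: uniformly over the initial state, from time `τ` on
the conditional means of `b(X_k)` and `A(X_k)` are `δ`-close to `0` and to `Abar`. -/
def IsMixingTime {𝓧 : Type*} [MeasurableSpace 𝓧] {d : ℕ} (Q : Kernel 𝓧 𝓧) (𝒮 : Set 𝓧)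
    (A : 𝓧 → Matrix (Fin d) (Fin d) ℝ) (b : 𝓧 → EuclideanSpace ℝ (Fin d))
    (Abar : Matrix (Fin d) (Fin d) ℝ) (δ : ℝ) (τ : ℕ) : Prop :=
  1 ≤ τ ∧ ∀ x ∈ 𝒮, ∀ k ≥ τ,
    ‖∫ y, b y ∂((Q ^ k) x)‖ ≤ δ ∧ ‖Abar - ∫ y, A y ∂((Q ^ k) x)‖ ≤ δ

/-- Markov chain, existence of the limiting means, and geometric mixing. The mixing time is at
least `1`, whereas `K log (1/δ)` tends to `0` as `δ → 1`; so `δ` is kept away from `1`, by an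
arbitrary `δ₀ < 1`. -/
structure Assumption1 {Ω 𝓧 : Type*} [MeasurableSpace Ω] [MeasurableSpace 𝓧] {d : ℕ}
    (μ : Measure Ω) (X : ℕ → Ω → 𝓧) (Q : Kernel 𝓧 𝓧) (𝒮 : Set 𝓧)
    (A : 𝓧 → Matrix (Fin d) (Fin d) ℝ) (b : 𝓧 → EuclideanSpace ℝ (Fin d))
    (Abar : Matrix (Fin d) (Fin d) ℝ) : Prop where
  isMarkovChain : IsMarkovChain μ X Q
  mem_stateSpace : ∀ k, ∀ᵐ ω ∂μ, X k ω ∈ 𝒮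
  integrable_A : ∀ k, Integrable (fun ω => A (X k ω)) μ
  integrable_b : ∀ k, Integrable (fun ω => b (X k ω)) μ
  integrable_A_cond : ∀ x ∈ 𝒮, ∀ k : ℕ, Integrable A ((Q ^ k) x)
  integrable_b_cond : ∀ x ∈ 𝒮, ∀ k : ℕ, Integrable b ((Q ^ k) x)
  tendsto_A : Tendsto (fun k => ∫ ω, A (X k ω) ∂μ) atTop (𝓝 Abar)
  tendsto_b : Tendsto (fun k => ∫ ω, b (X k ω) ∂μ) atTop (𝓝 0)
  mixing : ∃ τ : ℝ → ℕ, (∀ δ > 0, IsMixingTime Q 𝒮 A b Abar δ (τ δ)) ∧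
    ∀ δ₀ ∈ Set.Ioo (0 : ℝ) 1, ∃ K : ℝ, 1 ≤ K ∧
      ∀ δ ∈ Set.Ioc 0 δ₀, (τ δ : ℝ) ≤ K * Real.log (1 / δ)

/-- `b_max = sup_{x ∈ 𝒮} ‖b(x)‖`. -/
def bMax {𝓧 : Type*} {d : ℕ} (𝒮 : Set 𝓧) (b : 𝓧 → EuclideanSpace ℝ (Fin d)) : ℝ :=
  sSup ((fun x => ‖b x‖) '' 𝒮)

/-- `b_max < ∞` and `A_max ≤ 1`. -/
structure Assumption2 {𝓧 : Type*} {d : ℕ} (𝒮 : Set 𝓧)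
    (A : 𝓧 → Matrix (Fin d) (Fin d) ℝ) (b : 𝓧 → EuclideanSpace ℝ (Fin d)) : Prop where
  bddAbove_b : BddAbove ((fun x => ‖b x‖) '' 𝒮)
  norm_A_le : ∀ x ∈ 𝒮, ‖A x‖ ≤ 1

/-- `Abar` is Hurwitz: all its complex eigenvalues have strictly negative real part. -/
def Assumption3 {d : ℕ} (Abar : Matrix (Fin d) (Fin d) ℝ) : Prop :=
  ∀ z ∈ spectrum ℂ (Abar.map (algebraMap ℝ ℂ)), z.re < 0

/-- `P` is symmetric positive definite and `-I = Abarᵀ P + P Abar`. -/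
def IsLyapunovSolution {d : ℕ} (Abar P : Matrix (Fin d) (Fin d) ℝ) : Prop :=
  P.PosDef ∧ -1 = Abarᵀ * P + P * Abar

def kappa1 (γmax bmax : ℝ) : ℝ := 62 * γmax * (1 + bmax)

def kappa2 (γmax bmax : ℝ) : ℝ := 55 * γmax * (1 + bmax) ^ 3

def kappa2Tilde (γmax bmax : ℝ) : ℝ := 2 * (kappa2 γmax bmax + γmax * bmax ^ 2)

/-- The finite-time mean-square bound for a process `Θ` started at the deterministic vector `θ₀`,
with step size `ε` and with `τ` a mixing time at level `ε`. -/
def FiniteTimeBound {Ω 𝓧 : Type*} [MeasurableSpace Ω] [MeasurableSpace 𝓧] {d : ℕ}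
    (μ : Measure Ω) (Q : Kernel 𝓧 𝓧) (𝒮 : Set 𝓧)
    (A : 𝓧 → Matrix (Fin d) (Fin d) ℝ) (b : 𝓧 → EuclideanSpace ℝ (Fin d))
    (Abar : Matrix (Fin d) (Fin d) ℝ) (ε : ℝ) (θ₀ : EuclideanSpace ℝ (Fin d))
    (Θ : ℕ → Ω → EuclideanSpace ℝ (Fin d)) : Prop :=
  ∀ (P : Matrix (Fin d) (Fin d) ℝ) (γmin γmax : ℝ), IsLyapunovSolution Abar P →
    IsLeast (spectrum ℝ P) γmin → IsGreatest (spectrum ℝ P) γmax →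
    ∀ τ : ℕ, IsMixingTime Q 𝒮 A b Abar ε τ → ε * τ ≤ 1 / 4 →
      kappa1 γmax (bMax 𝒮 b) * ε * τ + ε * γmax ≤ 0.05 →
      ∀ k ≥ τ, Integrable (fun ω => ‖Θ k ω‖ ^ 2) μ ∧
        ∫ ω, ‖Θ k ω‖ ^ 2 ∂μ ≤
          γmax / γmin * (1 - 0.9 * ε / γmax) ^ (k - τ) * (1.5 * ‖θ₀‖ + 0.5 * bMax 𝒮 b) ^ 2
            + kappa2Tilde γmax (bMax 𝒮 b) * γmax / (0.9 * γmin) * ε * τ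

/-! ### The Markov reward process -/

/-- The chain with transition matrix `Γ` is aperiodic: every state has period `1`. -/
def IsAperiodic {S : Type*} [Fintype S] [DecidableEq S] (Γ : Matrix S S ℝ) : Prop :=
  ∀ i, ∀ m : ℕ, (∀ n : ℕ, 0 < n → 0 < (Γ ^ n) i i → m ∣ n) → m = 1

/-- `π` is a stationary distribution of `Γ`. -/
structure IsStationaryDistribution {S : Type*} [Fintype S] (Γ : Matrix S S ℝ) (π : S → ℝ) : Prop where
  nonneg : ∀ i, 0 ≤ π i
  sum_eq_one : ∑ i, π i = 1
  invariant : π ᵥ* Γ = π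

/-- The transition kernel of the state: `j` has probability `Γ i j` given `i`. -/
def stateKernel {S : Type*} [Fintype S] [MeasurableSpace S] [MeasurableSingletonClass S]
    (Γ : Matrix S S ℝ) : Kernel S S :=
  Kernel.ofFunOfCountable fun i => ∑ j, ENNReal.ofReal (Γ i j) • Measure.dirac j

/-- `Z` is a Markov chain with transition matrix `Γ`, observed together with instantaneous rewards
`C`: given the past and the present state `Z_n`, the reward `C_n` has law `ν(Z_n)`; given the past
including `C_n`, the next state has law `Γ(Z_n, ·)`. The law of `Z_0` is arbitrary. Deterministic
rewards are the case of Dirac laws `ν(i)`. -/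
structure IsMarkovRewardProcess {Ω S : Type*} [MeasurableSpace Ω] [Fintype S] [MeasurableSpace S]
    [MeasurableSingletonClass S] (μ : Measure Ω) (Γ : Matrix S S ℝ) (ν : Kernel S ℝ)
    (Z : ℕ → Ω → S) (C : ℕ → Ω → ℝ) : Prop where
  measurable_Z : ∀ n, Measurable (Z n)
  measurable_C : ∀ n, Measurable (C n)
  reward : ∀ (n : ℕ) (F : Set Ω),
    MeasurableSet[(⨆ i ∈ Set.Iic n, MeasurableSpace.comap (Z i) inferInstance) ⊔
      (⨆ i ∈ Set.Iio n, MeasurableSpace.comap (C i) inferInstance)] F →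
    ∀ B : Set ℝ, MeasurableSet B → μ (F ∩ C n ⁻¹' B) = ∫⁻ ω in F, ν (Z n ω) B ∂μ
  transition : ∀ (n : ℕ) (F : Set Ω),
    MeasurableSet[(⨆ i ∈ Set.Iic n, MeasurableSpace.comap (Z i) inferInstance) ⊔
      (⨆ i ∈ Set.Iic n, MeasurableSpace.comap (C i) inferInstance)] F →
    ∀ j : S, μ (F ∩ Z (n + 1) ⁻¹' {j}) = ∫⁻ ω in F, ENNReal.ofReal (Γ (Z n ω) j) ∂μ

/-- The matrix `Φ` whose `i`-th column is the feature vector `φ(i)`. -/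
def featureMatrix {S : Type*} {d : ℕ} (φ : S → EuclideanSpace ℝ (Fin d)) :
    Matrix (Fin d) S ℝ :=
  Matrix.of fun a i => φ i a

/-- `φ_max = max_i ‖φ(i)‖`. -/
def phiMax {S : Type*} {d : ℕ} (φ : S → EuclideanSpace ℝ (Fin d)) : ℝ := ⨆ i, ‖φ i‖

/-- The mean reward `c̄(i) = E[c(i)]`. -/
def meanReward {S : Type*} [MeasurableSpace S] (ν : Kernel S ℝ) (i : S) : ℝ := ∫ c, c ∂(ν i)

/-- The matrix `- v (φ(i) - α φ(j))ᵀ`. -/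
def tdMatrix {S : Type*} {d : ℕ} (φ : S → EuclideanSpace ℝ (Fin d)) (α : ℝ)
    (v : EuclideanSpace ℝ (Fin d)) (i j : S) : Matrix (Fin d) (Fin d) ℝ :=
  -Matrix.vecMulVec (WithLp.ofLp v) (WithLp.ofLp (φ i - α • φ j))

/-- The temporal-difference update of `θ` along the direction `v` on observing the state `i`, the
reward `c` and the next state `j`. -/
def tdUpdate {S : Type*} {d : ℕ} (φ : S → EuclideanSpace ℝ (Fin d)) (α ε : ℝ)
    (v : EuclideanSpace ℝ (Fin d)) (i : S) (c : ℝ) (j : S) (θ : EuclideanSpace ℝ (Fin d)) :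
    EuclideanSpace ℝ (Fin d) :=
  θ - (ε * (inner ℝ (φ i) θ - c - α * inner ℝ (φ j) θ)) • v

/-! ### TD(0) -/

/-- The TD(0) iterates along a trajectory `z` with rewards `c`. -/
def td0 {S : Type*} {d : ℕ} (φ : S → EuclideanSpace ℝ (Fin d)) (α ε : ℝ)
    (θ₀ : EuclideanSpace ℝ (Fin d)) (z : ℕ → S) (c : ℕ → ℝ) : ℕ → EuclideanSpace ℝ (Fin d)
  | 0 => θ₀
  | k + 1 => tdUpdate φ α ε (φ (z k)) (z k) (c k) (z (k + 1)) (td0 φ α ε θ₀ z c k)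

/-- The centred TD(0) iterates `Θ_k - θ*`. -/
def td0Error {Ω S : Type*} {d : ℕ} (φ : S → EuclideanSpace ℝ (Fin d)) (α ε : ℝ)
    (θ₀ θs : EuclideanSpace ℝ (Fin d)) (Z : ℕ → Ω → S) (C : ℕ → Ω → ℝ) (k : ℕ) (ω : Ω) :
    EuclideanSpace ℝ (Fin d) :=
  td0 φ α ε θ₀ (fun n => Z n ω) (fun n => C n ω) k - θs

/-- `Ã = -Φ D (Φᵀ - α Γ Φᵀ)`. -/
def td0Abar {S : Type*} [Fintype S] [DecidableEq S] {d : ℕ} (Γ : Matrix S S ℝ) (π : S → ℝ)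
    (φ : S → EuclideanSpace ℝ (Fin d)) (α : ℝ) : Matrix (Fin d) (Fin d) ℝ :=
  -(featureMatrix φ * Matrix.diagonal π * ((featureMatrix φ)ᵀ - α • (Γ * (featureMatrix φ)ᵀ)))

/-- `b̃ = Φ D c̄`. -/
def td0Bbar {S : Type*} [Fintype S] [DecidableEq S] [MeasurableSpace S] {d : ℕ} (π : S → ℝ)
    (φ : S → EuclideanSpace ℝ (Fin d)) (ν : Kernel S ℝ) : EuclideanSpace ℝ (Fin d) :=
  WithLp.toLp 2 ((featureMatrix φ * Matrix.diagonal π) *ᵥ meanReward ν)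

/-- The state `X_k = (Z_k, C_k, Z_{k+1})` that drives TD(0). -/
def td0Chain {Ω S : Type*} (Z : ℕ → Ω → S) (C : ℕ → Ω → ℝ) (k : ℕ) (ω : Ω) : S × ℝ × S :=
  (Z k ω, C k ω, Z (k + 1) ω)

/-- Transition kernel of `X_k = (Z_k, C_k, Z_{k+1})`: from `(i, c, j)` to `(j, c', l)` with
independent `c' ∼ ν(j)` and `l ∼ Γ(j, ·)`. -/
def td0Kernel {S : Type*} [Fintype S] [MeasurableSpace S] [MeasurableSingletonClass S]
    (Γ : Matrix S S ℝ) (ν : Kernel S ℝ) : Kernel (S × ℝ × S) (S × ℝ × S) :=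
  Kernel.comap (Kernel.id ×ₖ (ν ×ₖ stateKernel Γ)) (fun x : S × ℝ × S => x.2.2)
    (measurable_snd.comp measurable_snd)

/-- State space of `X_k`: the possible transitions, with the possible rewards. -/
def td0States {S : Type*} [MeasurableSpace S] (Γ : Matrix S S ℝ) (ν : Kernel S ℝ) :
    Set (S × ℝ × S) :=
  {x | x.2.1 ∈ (ν x.1).support ∧ 0 < Γ x.1 x.2.2}

/-- `A(X_k) = -φ(Z_k) (φ(Z_k) - α φ(Z_{k+1}))ᵀ`. -/
def td0A {S : Type*} {d : ℕ} (φ : S → EuclideanSpace ℝ (Fin d)) (α : ℝ) (x : S × ℝ × S) :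
    Matrix (Fin d) (Fin d) ℝ :=
  tdMatrix φ α (φ x.1) x.1 x.2.2

/-- `b(X_k) = C_k φ(Z_k) + A(X_k) θ*`. -/
def td0b {S : Type*} {d : ℕ} (φ : S → EuclideanSpace ℝ (Fin d)) (α : ℝ)
    (θs : EuclideanSpace ℝ (Fin d)) (x : S × ℝ × S) : EuclideanSpace ℝ (Fin d) :=
  x.2.1 • φ x.1 + app (td0A φ α x) θs

/-! ### TD(λ); the trace-decay parameter is written `l` -/

/-- The eligibility trace `φ_k = αλ φ_{k-1} + φ(Z_k)`, with `φ_{-1} = 0`. -/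
def eligibilityTrace {S : Type*} {d : ℕ} (φ : S → EuclideanSpace ℝ (Fin d)) (α l : ℝ) (z : ℕ → S) :
    ℕ → EuclideanSpace ℝ (Fin d)
  | 0 => φ (z 0)
  | k + 1 => (α * l) • eligibilityTrace φ α l z k + φ (z (k + 1))

/-- The TD(λ) iterates along a trajectory `z` with rewards `c`. -/
def tdl {S : Type*} {d : ℕ} (φ : S → EuclideanSpace ℝ (Fin d)) (α l ε : ℝ)
    (θ₀ : EuclideanSpace ℝ (Fin d)) (z : ℕ → S) (c : ℕ → ℝ) : ℕ → EuclideanSpace ℝ (Fin d)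
  | 0 => θ₀
  | k + 1 => tdUpdate φ α ε (eligibilityTrace φ α l z k) (z k) (c k) (z (k + 1)) (tdl φ α l ε θ₀ z c k)

/-- The centred TD(λ) iterates `Θ_k - θ*`. -/
def tdlError {Ω S : Type*} {d : ℕ} (φ : S → EuclideanSpace ℝ (Fin d)) (α l ε : ℝ)
    (θ₀ θs : EuclideanSpace ℝ (Fin d)) (Z : ℕ → Ω → S) (C : ℕ → Ω → ℝ) (k : ℕ) (ω : Ω) :
    EuclideanSpace ℝ (Fin d) :=
  tdl φ α l ε θ₀ (fun n => Z n ω) (fun n => C n ω) k - θs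

/-- `U = (1 - λ) ∑_j λ^j (αΓ)^(j+1)`; the series converges for stochastic `Γ`, `0 ≤ α < 1` and
`0 ≤ λ ≤ 1`. -/
def tdlU {S : Type*} [Fintype S] [DecidableEq S] (Γ : Matrix S S ℝ) (α l : ℝ) : Matrix S S ℝ :=
  (1 - l) • ∑' j : ℕ, l ^ j • (α • Γ) ^ (j + 1)

/-- `Ã = Φ D (U - I) Φᵀ`. -/
def tdlAbar {S : Type*} [Fintype S] [DecidableEq S] {d : ℕ} (Γ : Matrix S S ℝ) (π : S → ℝ)
    (φ : S → EuclideanSpace ℝ (Fin d)) (α l : ℝ) : Matrix (Fin d) (Fin d) ℝ :=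
  featureMatrix φ * Matrix.diagonal π * (tdlU Γ α l - 1) * (featureMatrix φ)ᵀ

/-- `b̃ = Φ D ∑_j (αλΓ)^j c̄`. -/
def tdlBbar {S : Type*} [Fintype S] [DecidableEq S] [MeasurableSpace S] {d : ℕ}
    (Γ : Matrix S S ℝ) (π : S → ℝ) (φ : S → EuclideanSpace ℝ (Fin d)) (ν : Kernel S ℝ)
    (α l : ℝ) : EuclideanSpace ℝ (Fin d) :=
  WithLp.toLp 2 ((featureMatrix φ * Matrix.diagonal π *
    ∑' j : ℕ, ((α * l) • Γ) ^ j) *ᵥ meanReward ν)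

/-- The state `X_k = ((Z_k, C_k, Z_{k+1}), φ_k)` that drives TD(λ). -/
def tdlChain {Ω S : Type*} {d : ℕ} (φ : S → EuclideanSpace ℝ (Fin d)) (α l : ℝ)
    (Z : ℕ → Ω → S) (C : ℕ → Ω → ℝ) (k : ℕ) (ω : Ω) :
    (S × ℝ × S) × EuclideanSpace ℝ (Fin d) :=
  (td0Chain Z C k ω, eligibilityTrace φ α l (fun n => Z n ω) k)

/-- Transition kernel of `X_k = ((Z_k, C_k, Z_{k+1}), φ_k)`: the first component moves as for TD(0),
and the trace `e` at `(i, c, j)` becomes `αλ e + φ(j)`. -/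
def tdlKernel {S : Type*} [Fintype S] [MeasurableSpace S] [MeasurableSingletonClass S] {d : ℕ}
    (Γ : Matrix S S ℝ) (ν : Kernel S ℝ) (φ : S → EuclideanSpace ℝ (Fin d)) (α l : ℝ) :
    Kernel ((S × ℝ × S) × EuclideanSpace ℝ (Fin d)) ((S × ℝ × S) × EuclideanSpace ℝ (Fin d)) :=
  Kernel.comap (td0Kernel Γ ν) Prod.fst measurable_fst ×ₖ
    Kernel.deterministic
      (fun x : (S × ℝ × S) × EuclideanSpace ℝ (Fin d) => (α * l) • x.2 + φ x.1.2.2)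
      ((measurable_snd.const_smul (α * l)).add ((measurable_of_finite φ).comp
        (measurable_snd.comp (measurable_snd.comp measurable_fst))))

/-- State space of `X_k`: as for TD(0), with traces of norm at most `φ_max / (1 - αλ)`. -/
def tdlStates {S : Type*} [MeasurableSpace S] {d : ℕ} (Γ : Matrix S S ℝ) (ν : Kernel S ℝ)
    (φ : S → EuclideanSpace ℝ (Fin d)) (α l : ℝ) :
    Set ((S × ℝ × S) × EuclideanSpace ℝ (Fin d)) :=
  {x | x.1 ∈ td0States Γ ν ∧ ‖x.2‖ ≤ phiMax φ / (1 - α * l)}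

/-- `A(X_k) = -φ_k (φ(Z_k) - α φ(Z_{k+1}))ᵀ`. -/
def tdlA {S : Type*} {d : ℕ} (φ : S → EuclideanSpace ℝ (Fin d)) (α : ℝ)
    (x : (S × ℝ × S) × EuclideanSpace ℝ (Fin d)) : Matrix (Fin d) (Fin d) ℝ :=
  tdMatrix φ α x.2 x.1.1 x.1.2.2

/-- `b(X_k) = C_k φ_k + A(X_k) θ*`. -/
def tdlb {S : Type*} {d : ℕ} (φ : S → EuclideanSpace ℝ (Fin d)) (α : ℝ)
    (θs : EuclideanSpace ℝ (Fin d)) (x : (S × ℝ × S) × EuclideanSpace ℝ (Fin d)) :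
    EuclideanSpace ℝ (Fin d) :=
  x.1.2.1 • x.2 + app (tdlA φ α x) θs

end TDLearning

end

open TDLearning

namespace TDLearning

/-! ### Finite Markov chains -/

/-! Both algorithms, once centred at the fixed point, are linear recursions θ ↦ θ + ε(A(X)θ + b(X))
driven by a Markov chain. The proof is one general estimate for such recursions, `finiteTimeBound`,
together with a verification that temporal-difference learning satisfies its hypotheses.

The general estimate follows the Lyapunov function W(θ) = ⟨θ, Pθ⟩. One step gains -ε‖θ‖² from the
Lyapunov equation and loses an O(ε²) term and a cross term ⟨Pθ, (A(X) - Abar)θ + b(X)⟩. The cross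
term is not centred, because θ and X are correlated. So θ is replaced in it by the iterate τ steps
earlier. The replacement costs O(ετ), since over τ steps the iterate moves by at most (4/3)ετ(‖θ‖ +
b_max). Given the past at that earlier time, mixing makes the conditional mean of the frozen cross
term O(ε). This yields an affine recursion for E[W] with factor 1 - 0.9ε/γ_max, which is then
iterated. No projection is needed because the displacement bound is relative to the size of the
iterate.

Stability comes from `tdlU_sub_one_neg`: U strictly shrinks the norm of L²(π), by Jensen's
inequality and stationarity, so U - I is negative definite there. As Φ has full rank, Abar has a
negative definite quadratic form. That single property gives the unique fixed point, the location of
the eigenvalues, and existence, uniqueness and positivity of P.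

Mixing comes from a Doeblin contraction for the finite chain (`exists_geometric_ergodicity`). For
TD(0) the conditional means are powers of Γ applied to one-step means. For TD(λ) the trace remembers
the whole past; `exists_tracePart_geometric` handles the resulting convolution of the trace decay αλ
with the ergodic rate ρ > αλ. Its limit brings in the resolvent of αλΓ, which is exactly the factor
by which the TD(λ) mean matrix differs from that of TD(0). -/

theorem IsStationaryDistribution.dotProduct_mulVec {S : Type*} [Fintype S] {Γ : Matrix S S ℝ}
    {π : S → ℝ} (hπ : IsStationaryDistribution Γ π) (f : S → ℝ) :
    π ⬝ᵥ (Γ *ᵥ f) = π ⬝ᵥ f := by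
  rw [Matrix.dotProduct_mulVec, hπ.invariant]

section FiniteChain

variable {S : Type*} [Fintype S] [DecidableEq S] {Γ : Matrix S S ℝ} {π : S → ℝ}

theorem pow_add_apply_pos (hΓ : Γ ∈ Matrix.rowStochastic ℝ S) {i j k : S} {m n : ℕ}
    (h₁ : 0 < (Γ ^ m) i j) (h₂ : 0 < (Γ ^ n) j k) : 0 < (Γ ^ (m + n)) i k := by
  rw [pow_add, Matrix.mul_apply]
  refine (Finset.sum_pos_iff_of_nonneg fun x _ => ?_).2 ⟨j, Finset.mem_univ j, mul_pos h₁ h₂⟩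
  exact mul_nonneg ((pow_mem hΓ m).1 _ _) ((pow_mem hΓ n).1 _ _)

/-- The possible return times to i are closed under addition and have gcd 1, and an additive
submonoid of ℕ with gcd 1 contains every large integer. -/
theorem eventually_pow_diag_pos (hΓ : Γ ∈ Matrix.rowStochastic ℝ S) (haper : IsAperiodic Γ) (i : S) :
    ∃ n₀, ∀ n ≥ n₀, 0 < (Γ ^ n) i i := by
  set s : Set ℕ := {n | 0 < n ∧ 0 < (Γ ^ n) i i} with hs
  have hgcd : Nat.setGcd s = 1 :=
    haper i _ fun n hn hpos => Nat.setGcd_dvd_of_mem (s := s) ⟨hn, hpos⟩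
  obtain ⟨n₀, hn₀⟩ := Nat.exists_mem_closure_of_ge s
  refine ⟨n₀, fun n hn => ?_⟩
  refine AddSubmonoid.closure_induction (motive := fun m _ => 0 < (Γ ^ m) i i) (fun m hm => hm.2) (by simp)
    (fun a b _ _ ha hb => pow_add_apply_pos hΓ ha hb) (hn₀ n hn (by simp [hgcd]))

theorem exists_pow_pos (hΓ : Γ ∈ Matrix.rowStochastic ℝ S) (hirr : Γ.IsIrreducible)
    (haper : IsAperiodic Γ) : ∃ N, 0 < N ∧ ∀ i j, 0 < (Γ ^ N) i j := by
  choose n₀ hn₀ using eventually_pow_diag_pos hΓ haper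
  choose k _ hk using (Matrix.isIrreducible_iff_exists_pow_pos hΓ.1).1 hirr
  -- The sum dominates n₀ i + k i j for every pair at once. The surplus time m is spent on a loop at
  -- i, which is possible because n₀ i + m ≥ n₀ i.
  refine ⟨(∑ i, ∑ j, (n₀ i + k i j)) + 1, Nat.succ_pos _, fun i j => ?_⟩
  have hle : n₀ i + k i j ≤ ∑ i, ∑ j, (n₀ i + k i j) :=
    (Finset.single_le_sum (f := fun j => n₀ i + k i j) (fun _ _ => Nat.zero_le _)
      (Finset.mem_univ j)).trans
      (Finset.single_le_sum (f := fun i => ∑ j, (n₀ i + k i j)) (fun _ _ => Nat.zero_le _)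
        (Finset.mem_univ i))
  obtain ⟨m, hm⟩ := Nat.exists_eq_add_of_le (hle.trans (Nat.le_succ _))
  rw [Nat.succ_eq_add_one] at hm
  rw [hm, show n₀ i + k i j + m = (n₀ i + m) + k i j by ring]
  exact pow_add_apply_pos hΓ (hn₀ i _ (Nat.le_add_right _ _)) (hk i j)

theorem IsStationaryDistribution.vecMul_pow (hπ : IsStationaryDistribution Γ π) (n : ℕ) :
    π ᵥ* Γ ^ n = π := by
  induction n with
  | zero => simp
  | succ n ih => rw [pow_succ, ← Matrix.vecMul_vecMul, ih, hπ.invariant]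

/-- Some state carries mass, and N steps spread that mass to every state while leaving π unchanged.
-/
theorem IsStationaryDistribution.pos (hΓ : Γ ∈ Matrix.rowStochastic ℝ S) (hirr : Γ.IsIrreducible)
    (haper : IsAperiodic Γ) (hπ : IsStationaryDistribution Γ π) (j : S) : 0 < π j := by
  obtain ⟨N, -, hN⟩ := exists_pow_pos hΓ hirr haper
  obtain ⟨i, hi⟩ : ∃ i, 0 < π i := by
    by_contra! h
    have := Finset.sum_nonpos fun i (_ : i ∈ Finset.univ) => h i
    rw [hπ.sum_eq_one] at this
    linarith
  have h := congrFun (hπ.vecMul_pow N) j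
  rw [← h, Matrix.vecMul, dotProduct]
  exact (Finset.sum_pos_iff_of_nonneg fun x _ => mul_nonneg (hπ.nonneg x) (hN x j).le).2
    ⟨i, Finset.mem_univ i, mul_pos hi (hN i j)⟩

theorem abs_mulVec_le (hΓ : Γ ∈ Matrix.rowStochastic ℝ S) {f : S → ℝ} {M : ℝ}
    (hf : ∀ i, |f i| ≤ M) (i : S) : |(Γ *ᵥ f) i| ≤ M := by
  calc |(Γ *ᵥ f) i| ≤ ∑ j, |Γ i j * f j| := Finset.abs_sum_le_sum_abs _ _
    _ ≤ ∑ j, Γ i j * M := Finset.sum_le_sum fun j _ => by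
        rw [abs_mul, abs_of_nonneg (hΓ.1 i j)]
        exact mul_le_mul_of_nonneg_left (hf j) (hΓ.1 i j)
    _ = M := by rw [← Finset.sum_mul, Matrix.sum_row_of_mem_rowStochastic hΓ, one_mul]

/-- **Doeblin contraction**: a power of the transition matrix that dominates `η π` contracts
functions of mean zero by the factor `1 - η`. -/
theorem abs_mulVec_le_of_mean_zero {R : Matrix S S ℝ} (hR : R ∈ Matrix.rowStochastic ℝ S) {η : ℝ}
    (hπ : ∑ i, π i = 1) (hη : ∀ i j, η * π j ≤ R i j) {f : S → ℝ} (hf0 : π ⬝ᵥ f = 0) {M : ℝ}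
    (hf : ∀ i, |f i| ≤ M) (i : S) : |(R *ᵥ f) i| ≤ (1 - η) * M := by
  have h1 : (R *ᵥ f) i = ∑ j, (R i j - η * π j) * f j := by
    simp only [sub_mul, Finset.sum_sub_distrib, mul_assoc, ← Finset.mul_sum]
    rw [show ∑ j, π j * f j = 0 from hf0, mul_zero, sub_zero]
    rfl
  rw [h1]
  calc |∑ j, (R i j - η * π j) * f j| ≤ ∑ j, |(R i j - η * π j) * f j| :=
        Finset.abs_sum_le_sum_abs _ _
    _ ≤ ∑ j, (R i j - η * π j) * M := Finset.sum_le_sum fun j _ => by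
        rw [abs_mul, abs_of_nonneg (sub_nonneg.2 (hη i j))]
        exact mul_le_mul_of_nonneg_left (hf j) (sub_nonneg.2 (hη i j))
    _ = (1 - η) * M := by
        rw [← Finset.sum_mul, Finset.sum_sub_distrib, Matrix.sum_row_of_mem_rowStochastic hR,
          ← Finset.mul_sum, hπ, mul_one]

/-- **Geometric ergodicity** of an irreducible aperiodic finite chain. -/
theorem exists_geometric_ergodicity (hΓ : Γ ∈ Matrix.rowStochastic ℝ S) (hirr : Γ.IsIrreducible)
    (haper : IsAperiodic Γ) (hπ : IsStationaryDistribution Γ π) :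
    ∃ C ρ : ℝ, 0 ≤ C ∧ 0 < ρ ∧ ρ < 1 ∧ ∀ (f : S → ℝ) (M : ℝ), (∀ i, |f i| ≤ M) →
      ∀ (k : ℕ) (i : S), |(Γ ^ k *ᵥ f) i - π ⬝ᵥ f| ≤ C * ρ ^ k * M := by
  obtain ⟨N, hN0, hN⟩ := exists_pow_pos hΓ hirr haper
  have hne : Nonempty S := by
    by_contra h
    rw [not_nonempty_iff] at h
    simpa using hπ.sum_eq_one
  obtain ⟨p, hp⟩ := Finite.exists_min fun p : S × S => (Γ ^ N) p.1 p.2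
  -- Capping at 1/2 keeps q = 1 - η positive, so that q has a positive N-th root and can be divided
  -- by.
  set η : ℝ := min ((Γ ^ N) p.1 p.2) (1 / 2) with hη
  have hη0 : 0 < η := lt_min (hN _ _) (by norm_num)
  have hη1 : η ≤ 1 / 2 := min_le_right _ _
  have hπ1 : ∀ j, π j ≤ 1 := fun j => by
    rw [← hπ.sum_eq_one]
    exact Finset.single_le_sum (fun i _ => hπ.nonneg i) (Finset.mem_univ j)
  have hdom : ∀ i j, η * π j ≤ (Γ ^ N) i j := fun i j =>
    calc η * π j ≤ η * 1 := mul_le_mul_of_nonneg_left (hπ1 j) hη0.le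
      _ ≤ (Γ ^ N) p.1 p.2 := by rw [mul_one]; exact min_le_left _ _
      _ ≤ (Γ ^ N) i j := hp (i, j)
  set q : ℝ := 1 - η with hq
  have hq0 : 0 < q := by linarith
  have hq1 : q < 1 := by linarith
  have hNr : (0 : ℝ) < N := by exact_mod_cast hN0
  set ρ : ℝ := q ^ (1 / (N : ℝ)) with hρ
  have hρ0 : 0 < ρ := Real.rpow_pos_of_pos hq0 _
  have hρ1 : ρ < 1 := Real.rpow_lt_one hq0.le hq1 (by positivity)
  have hρN : ρ ^ N = q := by
    rw [hρ, ← Real.rpow_natCast, ← Real.rpow_mul hq0.le, one_div, inv_mul_cancel₀ hNr.ne',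
      Real.rpow_one]
  have hcontr : ∀ (f : S → ℝ) (M : ℝ), π ⬝ᵥ f = 0 → (∀ i, |f i| ≤ M) →
      ∀ (m : ℕ) (i : S), |(Γ ^ (N * m) *ᵥ f) i| ≤ q ^ m * M := by
    intro f M hf0 hf m
    induction m with
    | zero => simpa using hf
    | succ m ih =>
      intro i
      rw [show N * (m + 1) = N + N * m by ring, pow_add, ← Matrix.mulVec_mulVec, pow_succ', mul_assoc]
      refine abs_mulVec_le_of_mean_zero (pow_mem hΓ N) hπ.sum_eq_one hdom ?_ ih i
      rw [Matrix.dotProduct_mulVec, hπ.vecMul_pow, hf0]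
  refine ⟨2 / q, ρ, by positivity, hρ0, hρ1, fun f M hf k i => ?_⟩
  have hM : 0 ≤ M := (abs_nonneg _).trans (hf i)
  set g : S → ℝ := fun j => f j - π ⬝ᵥ f with hg
  have hmean : |π ⬝ᵥ f| ≤ M :=
    calc |π ⬝ᵥ f| ≤ ∑ j, |π j * f j| := Finset.abs_sum_le_sum_abs _ _
      _ ≤ ∑ j, π j * M := Finset.sum_le_sum fun j _ => by
          rw [abs_mul, abs_of_nonneg (hπ.nonneg j)]
          exact mul_le_mul_of_nonneg_left (hf j) (hπ.nonneg j)
      _ = M := by rw [← Finset.sum_mul, hπ.sum_eq_one, one_mul]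
  have hg0 : π ⬝ᵥ g = 0 := by
    simp only [hg, dotProduct, mul_sub, Finset.sum_sub_distrib, ← Finset.sum_mul, hπ.sum_eq_one]
    ring
  have hgM : ∀ j, |g j| ≤ 2 * M := fun j => (abs_sub _ _).trans (by linarith [hf j])
  have hfg : (Γ ^ k *ᵥ f) i - π ⬝ᵥ f = (Γ ^ k *ᵥ g) i := by
    have : g = f - fun _ => π ⬝ᵥ f := rfl
    rw [this, Matrix.mulVec_sub, Pi.sub_apply]
    congr 1
    simp only [Matrix.mulVec, dotProduct, ← Finset.sum_mul,
      Matrix.sum_row_of_mem_rowStochastic (pow_mem hΓ k), one_mul]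
  -- Whole blocks of N steps contract the centred function; the k % N remaining steps do not expand
  -- it.
  have hdecay := abs_mulVec_le (pow_mem hΓ (k % N)) (hcontr g (2 * M) hg0 hgM (k / N)) i
  rw [Matrix.mulVec_mulVec, ← pow_add, Nat.mod_add_div, ← hfg] at hdecay
  refine hdecay.trans ?_
  -- Rounding k down to a multiple of N costs at most one factor q. With the factor 2 from centring,
  -- this is the constant 2/q.
  have h1 : q ^ (k / N) * q ≤ ρ ^ k := by
    rw [← pow_succ, ← hρN, ← pow_mul]
    exact pow_le_pow_of_le_one hρ0.le hρ1.le (Nat.lt_mul_div_succ k hN0).le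
  have h2 : q ^ (k / N) ≤ ρ ^ k / q := (le_div_iff₀ hq0).2 h1
  calc q ^ (k / N) * (2 * M) ≤ ρ ^ k / q * (2 * M) := by gcongr
    _ = 2 / q * ρ ^ k * M := by ring

/-! ### Resolvents and the TD(λ) operator U -/

/-- The resolvent series `∑ (rΓ)^j` of a stochastic matrix converges for `0 ≤ r < 1`. -/
theorem summable_smul_pow (hΓ : Γ ∈ Matrix.rowStochastic ℝ S) {r : ℝ} (h0 : 0 ≤ r) (h1 : r < 1) :
    Summable fun j : ℕ => (r • Γ) ^ j := by
  refine Pi.summable.2 fun i => Pi.summable.2 fun k => ?_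
  refine Summable.of_norm_bounded (summable_geometric_of_lt_one h0 h1) fun j => ?_
  rw [smul_pow, Matrix.smul_apply, smul_eq_mul, norm_mul, Real.norm_of_nonneg (pow_nonneg h0 j),
    Real.norm_of_nonneg ((pow_mem hΓ j).1 i k)]
  exact mul_le_of_le_one_right (pow_nonneg h0 j)
    (Matrix.le_one_of_mem_rowStochastic (pow_mem hΓ j))

/-- The resolvent `∑ (rΓ)^j`. -/
noncomputable def resolvent (Γ : Matrix S S ℝ) (r : ℝ) : Matrix S S ℝ := ∑' j : ℕ, (r • Γ) ^ j

theorem resolvent_eq (hΓ : Γ ∈ Matrix.rowStochastic ℝ S) {r : ℝ} (h0 : 0 ≤ r) (h1 : r < 1) :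
    resolvent Γ r = 1 + r • (Γ * resolvent Γ r) := by
  have h := (summable_smul_pow hΓ h0 h1).one_sub_mul_tsum_pow
  change (1 - r • Γ) * resolvent Γ r = 1 at h
  rw [sub_mul, one_mul, Matrix.smul_mul, sub_eq_iff_eq_add] at h
  exact h

theorem resolvent_eq' (hΓ : Γ ∈ Matrix.rowStochastic ℝ S) {r : ℝ} (h0 : 0 ≤ r) (h1 : r < 1) :
    resolvent Γ r = 1 + r • (resolvent Γ r * Γ) := by
  have h := (summable_smul_pow hΓ h0 h1).tsum_pow_mul_one_sub
  change resolvent Γ r * (1 - r • Γ) = 1 at h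
  rw [mul_sub, mul_one, Matrix.mul_smul, sub_eq_iff_eq_add] at h
  exact h

theorem tdlU_eq (hΓ : Γ ∈ Matrix.rowStochastic ℝ S) {α l : ℝ} (h0 : 0 ≤ α * l) (h1 : α * l < 1) :
    tdlU Γ α l = (1 - l) • (α • (resolvent Γ (α * l) * Γ)) := by
  have hs := summable_smul_pow hΓ h0 h1
  have : ∀ j : ℕ, l ^ j • (α • Γ) ^ (j + 1) = ((α * l) • Γ) ^ j * (α • Γ) := fun j => by
    rw [pow_succ, smul_pow, smul_pow, mul_pow, mul_comm (α ^ j), mul_smul, Matrix.smul_mul,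
      Matrix.smul_mul, Matrix.smul_mul]
  rw [tdlU, tsum_congr this, hs.tsum_mul_right, resolvent, Matrix.mul_smul]

/-- This factorization matches the dynamics: averaging the trace produces the resolvent, and
averaging one temporal difference produces αΓ - I. -/
theorem tdlU_sub_one_eq (hΓ : Γ ∈ Matrix.rowStochastic ℝ S) {α l : ℝ} (h0 : 0 ≤ α * l)
    (h1 : α * l < 1) : tdlU Γ α l - 1 = resolvent Γ (α * l) * (α • Γ - 1) := by
  have h := resolvent_eq' hΓ h0 h1
  rw [tdlU_eq hΓ h0 h1, mul_sub, mul_one, Matrix.mul_smul]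
  nth_rw 3 [h]
  module

/-- A self-consistency equation for U: it lets the contraction property be proved with a single
application of Γ instead of term by term in the series. -/
theorem tdlU_fixed (hΓ : Γ ∈ Matrix.rowStochastic ℝ S) {α l : ℝ} (h0 : 0 ≤ α * l)
    (h1 : α * l < 1) : tdlU Γ α l = α • (Γ * ((1 - l) • (1 : Matrix S S ℝ) + l • tdlU Γ α l)) := by
  have h := resolvent_eq hΓ h0 h1
  rw [tdlU_eq hΓ h0 h1]
  nth_rw 1 [h]
  simp only [mul_add, add_mul, Matrix.mul_smul, Matrix.smul_mul, mul_one, one_mul, ← mul_assoc]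
  module

/-- Jensen's inequality for a row of a stochastic matrix. -/
theorem mulVec_sq_le (hΓ : Γ ∈ Matrix.rowStochastic ℝ S) (f : S → ℝ) (i : S) :
    (Γ *ᵥ f) i ^ 2 ≤ (Γ *ᵥ fun j => f j ^ 2) i := by
  exact (even_two.convexOn_pow (𝕜 := ℝ)).map_sum_le (t := Finset.univ) (w := fun j => Γ i j)
    (p := f) (fun j _ => hΓ.1 i j) (Matrix.sum_row_of_mem_rowStochastic hΓ i) (fun _ _ => Set.mem_univ _)

/-- `U - I` is negative definite for the inner product weighted by the stationary distribution. -/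
theorem tdlU_sub_one_neg (hΓ : Γ ∈ Matrix.rowStochastic ℝ S) (hπ : IsStationaryDistribution Γ π)
    (hpos : ∀ i, 0 < π i) {α l : ℝ} (hα : α ∈ Set.Ico (0 : ℝ) 1) (hl : l ∈ Set.Icc (0 : ℝ) 1)
    {y : S → ℝ} (hy : y ≠ 0) : ∑ i, π i * (y i * ((tdlU Γ α l - 1) *ᵥ y) i) < 0 := by
  obtain ⟨hα0, hα1⟩ := hα
  obtain ⟨hl0, hl1⟩ := hl
  have h0 : 0 ≤ α * l := mul_nonneg hα0 hl0
  have h1 : α * l < 1 := (mul_le_of_le_one_right hα0 hl1).trans_lt hα1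
  set z := tdlU Γ α l *ᵥ y with hz
  set v : S → ℝ := fun i => (1 - l) * y i + l * z i with hv
  have hzv : ∀ i, z i = α * (Γ *ᵥ v) i := by
    intro i
    have : z = α • (Γ *ᵥ v) := by
      have hv' : v = ((1 - l) • (1 : Matrix S S ℝ) + l • tdlU Γ α l) *ᵥ y := by
        ext j
        simp [hv, hz, Matrix.add_mulVec, Matrix.smul_mulVec]
      rw [hv', Matrix.mulVec_mulVec, ← Matrix.smul_mulVec, ← tdlU_fixed hΓ h0 h1]
    rw [this]; rfl
  set Y : ℝ := ∑ i, π i * y i ^ 2 with hY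
  set W : ℝ := ∑ i, π i * z i ^ 2 with hW
  have hY0 : 0 < Y := by
    obtain ⟨i, hi⟩ := Function.ne_iff.1 hy
    exact (Finset.sum_pos_iff_of_nonneg fun x _ => mul_nonneg (hpos x).le (sq_nonneg _)).2
      ⟨i, Finset.mem_univ i, mul_pos (hpos i) (sq_pos_iff.2 hi)⟩
  -- Here z = αΓv, where v is a convex combination of y and z. Jensen's inequality bounds (Γv)² by
  -- Γ(v²), stationarity removes Γ under π, and convexity of the square splits v².
  have hWle : W ≤ α ^ 2 * ((1 - l) * Y + l * W) := by
    have hconv : ∀ i, v i ^ 2 ≤ (1 - l) * y i ^ 2 + l * z i ^ 2 := fun i => by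
      have : (1 - l) * y i ^ 2 + l * z i ^ 2 - v i ^ 2 = l * (1 - l) * (y i - z i) ^ 2 := by
        simp only [hv]; ring
      nlinarith [mul_nonneg (mul_nonneg hl0 (sub_nonneg.2 hl1)) (sq_nonneg (y i - z i))]
    calc W = ∑ i, π i * (α ^ 2 * (Γ *ᵥ v) i ^ 2) := by
          simp only [hW]; exact Finset.sum_congr rfl fun i _ => by rw [hzv i, mul_pow]
      _ ≤ ∑ i, π i * (α ^ 2 * (Γ *ᵥ fun j => v j ^ 2) i) := by
          refine Finset.sum_le_sum fun i _ => mul_le_mul_of_nonneg_left ?_ (hpos i).le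
          exact mul_le_mul_of_nonneg_left (mulVec_sq_le hΓ v i) (sq_nonneg α)
      _ = α ^ 2 * (π ⬝ᵥ (Γ *ᵥ fun j => v j ^ 2)) := by
          rw [dotProduct, Finset.mul_sum]; exact Finset.sum_congr rfl fun i _ => by ring
      _ = α ^ 2 * ∑ i, π i * v i ^ 2 := by rw [hπ.dotProduct_mulVec]; rfl
      _ ≤ α ^ 2 * ∑ i, π i * ((1 - l) * y i ^ 2 + l * z i ^ 2) := by
          refine mul_le_mul_of_nonneg_left (Finset.sum_le_sum fun i _ => ?_) (sq_nonneg α)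
          exact mul_le_mul_of_nonneg_left (hconv i) (hpos i).le
      _ = α ^ 2 * ((1 - l) * Y + l * W) := by
          simp only [hY, hW, Finset.mul_sum, ← Finset.sum_add_distrib]
          exact Finset.sum_congr rfl fun i _ => by ring
  have hα2 : α ^ 2 < 1 := by nlinarith
  -- If Y ≤ W, the preceding inequality gives W ≤ α²W with W > 0, which contradicts α < 1.
  have hWY : W < Y := by
    by_contra! h
    nlinarith [mul_nonneg hl0 hY0.le, mul_le_mul_of_nonneg_left h (sub_nonneg.2 hl1),
      mul_nonneg (sq_nonneg α) (mul_nonneg (sub_nonneg.2 hl1) (sub_nonneg.2 h)),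
      mul_pos (sub_pos.2 hα2) (hY0.trans_le h)]
  -- Young's inequality yz ≤ (y² + z²)/2, with y² subtracted.
  have hcross : ∀ i, π i * (y i * ((tdlU Γ α l - 1) *ᵥ y) i) ≤
      (π i * z i ^ 2 - π i * y i ^ 2) / 2 := fun i => by
    rw [Matrix.sub_mulVec, Matrix.one_mulVec, Pi.sub_apply, ← hz]
    nlinarith [mul_nonneg (hpos i).le (sq_nonneg (y i - z i))]
  calc _ ≤ ∑ i, (π i * z i ^ 2 - π i * y i ^ 2) / 2 := Finset.sum_le_sum fun i _ => hcross i
    _ = (W - Y) / 2 := by rw [← Finset.sum_div, Finset.sum_sub_distrib]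
    _ < 0 := by linarith

end FiniteChain

end TDLearning

namespace TDLearning

/-! ### Negative definite matrices and the Lyapunov equation -/

section Lyapunov

variable {d : ℕ} {A P : Matrix (Fin d) (Fin d) ℝ}

/-- The quadratic form of `A`, which need not be symmetric, is negative definite. -/
def IsNegDef (A : Matrix (Fin d) (Fin d) ℝ) : Prop := ∀ x : Fin d → ℝ, x ≠ 0 → x ⬝ᵥ (A *ᵥ x) < 0

theorem IsNegDef.mulVec_injective (hA : IsNegDef A) {x : Fin d → ℝ} (hx : A *ᵥ x = 0) : x = 0 := by
  by_contra h
  have := hA x h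
  simp [hx] at this

theorem IsNegDef.existsUnique (hA : IsNegDef A) (b : EuclideanSpace ℝ (Fin d)) :
    ∃! θ, app A θ + b = 0 := by
  have hinj : Function.Injective (Matrix.toEuclideanLin A) := by
    rw [← LinearMap.ker_eq_bot, LinearMap.ker_eq_bot']
    intro x hx
    have := hA.mulVec_injective (x := x.ofLp) (congrArg WithLp.ofLp hx)
    exact (WithLp.ofLp_injective 2) this
  obtain ⟨θ, hθ⟩ := LinearMap.injective_iff_surjective.1 hinj (-b)
  refine ⟨θ, by simp [app, hθ], fun y hy => hinj ?_⟩
  rw [hθ]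
  exact eq_neg_of_add_eq_zero_left hy

/-- For an eigenvector x + iy with eigenvalue z, the imaginary parts cancel in ⟨x, Ax⟩ + ⟨y, Ay⟩ =
Re z · (‖x‖² + ‖y‖²). The left side is negative. -/
theorem IsNegDef.assumption3 (hA : IsNegDef A) : Assumption3 A := by
  intro z hz
  set M : Matrix (Fin d) (Fin d) ℂ := algebraMap ℂ _ z - A.map (algebraMap ℝ ℂ) with hM
  have hdet : M.det = 0 := by
    by_contra h
    exact hz ((Matrix.isUnit_iff_isUnit_det _).2 (isUnit_iff_ne_zero.2 h))
  obtain ⟨v, hv0, hv⟩ := Matrix.exists_mulVec_eq_zero_iff.2 hdet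
  set x : Fin d → ℝ := fun i => (v i).re with hx
  set y : Fin d → ℝ := fun i => (v i).im with hy
  have hev : ∀ i, ∑ j, (A i j : ℂ) * v j = z * v i := fun i => by
    have h := congrFun hv i
    rw [hM, Matrix.sub_mulVec, Pi.sub_apply, Pi.zero_apply, sub_eq_zero,
      Algebra.algebraMap_eq_smul_one, Matrix.smul_mulVec, Matrix.one_mulVec] at h
    simpa [Matrix.mulVec, dotProduct] using h.symm
  have hre : ∀ i, (A *ᵥ x) i = z.re * x i - z.im * y i := fun i => by
    have h := congrArg Complex.re (hev i)
    simpa [Matrix.mulVec, dotProduct, hx, hy] using h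
  have him : ∀ i, (A *ᵥ y) i = z.re * y i + z.im * x i := fun i => by
    have h := congrArg Complex.im (hev i)
    simpa [Matrix.mulVec, dotProduct, hx, hy] using h
  have key : x ⬝ᵥ (A *ᵥ x) + y ⬝ᵥ (A *ᵥ y) = z.re * (x ⬝ᵥ x + y ⬝ᵥ y) := by
    simp only [dotProduct, hre, him, Finset.mul_sum, ← Finset.sum_add_distrib]
    exact Finset.sum_congr rfl fun i _ => by ring
  have hle : ∀ u : Fin d → ℝ, u ⬝ᵥ (A *ᵥ u) ≤ 0 := fun u => by
    rcases eq_or_ne u 0 with rfl | hu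
    · simp
    · exact (hA u hu).le
  have hneg : x ⬝ᵥ (A *ᵥ x) + y ⬝ᵥ (A *ᵥ y) < 0 := by
    by_cases hx0 : x = 0
    · have hy0 : y ≠ 0 := fun h => hv0 <| by
        ext i
        exact Complex.ext (congrFun hx0 i) (congrFun h i)
      exact add_neg_of_nonpos_of_neg (hle x) (hA y hy0)
    · exact add_neg_of_neg_of_nonpos (hA x hx0) (hle y)
  have hnn : 0 ≤ x ⬝ᵥ x + y ⬝ᵥ y :=
    add_nonneg (Finset.sum_nonneg fun i _ => mul_self_nonneg _)
      (Finset.sum_nonneg fun i _ => mul_self_nonneg _)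
  by_contra! h
  rw [key] at hneg
  exact absurd hneg (not_lt.2 (mul_nonneg h hnn))

/-- The Lyapunov operator, evaluated on an eigenvector of a symmetric matrix. -/
theorem dotProduct_lyapunov_mulVec (hP : Pᵀ = P) {v : Fin d → ℝ} {c : ℝ} (hv : P *ᵥ v = c • v) :
    v ⬝ᵥ ((Aᵀ * P + P * A) *ᵥ v) = 2 * c * (v ⬝ᵥ (A *ᵥ v)) := by
  rw [Matrix.add_mulVec, ← Matrix.mulVec_mulVec, ← Matrix.mulVec_mulVec, hv, dotProduct_add,
    Matrix.mulVec_smul, dotProduct_smul, Matrix.dotProduct_mulVec v P, ← Matrix.mulVec_transpose P v,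
    hP, hv, smul_dotProduct, Matrix.dotProduct_mulVec v Aᵀ, ← Matrix.mulVec_transpose,
    Matrix.transpose_transpose, dotProduct_comm (A *ᵥ v) v]
  simp only [smul_eq_mul]
  ring

theorem eigenvectorBasis_ne_zero (hP : P.IsHermitian) (i : Fin d) :
    (hP.eigenvectorBasis i).ofLp ≠ 0 := fun h =>
  hP.eigenvectorBasis.orthonormal.ne_zero i (WithLp.ofLp_injective 2 h)

/-- The Lyapunov operator `P ↦ Aᵀ P + P A` on symmetric matrices. -/
noncomputable def lyapunovMap (A : Matrix (Fin d) (Fin d) ℝ) :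
    selfAdjoint.submodule ℝ (Matrix (Fin d) (Fin d) ℝ) →ₗ[ℝ]
      selfAdjoint.submodule ℝ (Matrix (Fin d) (Fin d) ℝ) where
  toFun P := ⟨Aᵀ * P.1 + P.1 * A, by
    have hP : P.1ᴴ = P.1 := P.2
    change (Aᵀ * P.1 + P.1 * A)ᴴ = _
    rw [Matrix.conjTranspose_add, Matrix.conjTranspose_mul, Matrix.conjTranspose_mul, hP,
      Matrix.conjTranspose_eq_transpose_of_trivial, Matrix.conjTranspose_eq_transpose_of_trivial,
      Matrix.transpose_transpose, add_comm]⟩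
  map_add' P Q := Subtype.ext (by
    simp only [Submodule.coe_add, mul_add, add_mul]; abel)
  map_smul' c P := Subtype.ext (by
    simp only [Submodule.coe_smul, Matrix.mul_smul, Matrix.smul_mul, smul_add, RingHom.id_apply])

/-- If P is in the kernel and Pv = cv, testing on v gives 2c⟨v, Av⟩ = 0, hence c = 0. A symmetric
matrix whose eigenvalues all vanish is zero. -/
theorem IsNegDef.lyapunovMap_injective (hA : IsNegDef A) : Function.Injective (lyapunovMap A) := by
  rw [← LinearMap.ker_eq_bot, LinearMap.ker_eq_bot']
  intro P hP
  have hherm : P.1.IsHermitian := P.2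
  have hsymm : P.1ᵀ = P.1 := by
    rw [← Matrix.conjTranspose_eq_transpose_of_trivial]; exact hherm
  have hL : Aᵀ * P.1 + P.1 * A = 0 := congrArg Subtype.val hP
  refine Subtype.ext (hherm.eigenvalues_eq_zero_iff.1 (funext fun i => ?_))
  have h := dotProduct_lyapunov_mulVec (A := A) hsymm (hherm.mulVec_eigenvectorBasis i)
  rw [hL, Matrix.zero_mulVec, dotProduct_zero] at h
  have hneg := hA _ (eigenvectorBasis_ne_zero hherm i)
  have : 2 * hherm.eigenvalues i = 0 := (mul_eq_zero.1 h.symm).resolve_right hneg.ne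
  simpa using this

/-- In finite dimension injectivity of the Lyapunov operator gives a solution, so no integral
formula is needed. Positivity is read off eigenvectors: 2c⟨v, Av⟩ = -‖v‖² with ⟨v, Av⟩ < 0 forces c
> 0. -/
theorem IsNegDef.existsUnique_lyapunov (hA : IsNegDef A) : ∃! P, IsLyapunovSolution A P := by
  have hinj := hA.lyapunovMap_injective
  obtain ⟨P, hP⟩ := LinearMap.injective_iff_surjective.1 hinj ⟨-1, by
    change (-1 : Matrix (Fin d) (Fin d) ℝ)ᴴ = -1
    simp⟩
  have hherm : P.1.IsHermitian := P.2
  have hsymm : P.1ᵀ = P.1 := by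
    rw [← Matrix.conjTranspose_eq_transpose_of_trivial]; exact hherm
  have hL : Aᵀ * P.1 + P.1 * A = -1 := congrArg Subtype.val hP
  refine ⟨P.1, ⟨hherm.posDef_iff_eigenvalues_pos.2 fun i => ?_, hL.symm⟩, fun Q hQ => ?_⟩
  · have h := dotProduct_lyapunov_mulVec (A := A) hsymm (hherm.mulVec_eigenvectorBasis i)
    have hne := eigenvectorBasis_ne_zero hherm i
    have hneg := hA _ hne
    rw [hL, Matrix.neg_mulVec, Matrix.one_mulVec, dotProduct_neg] at h
    have hpos : 0 < (hherm.eigenvectorBasis i).ofLp ⬝ᵥ (hherm.eigenvectorBasis i).ofLp := by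
      refine lt_of_le_of_ne (Finset.sum_nonneg fun i _ => mul_self_nonneg _) fun h0 => hne ?_
      exact dotProduct_self_eq_zero.1 h0.symm
    by_contra! hle
    nlinarith [mul_nonneg_of_nonpos_of_nonpos hle hneg.le]
  · have : (⟨Q, hQ.1.isHermitian⟩ : selfAdjoint.submodule ℝ (Matrix (Fin d) (Fin d) ℝ)) = P :=
      hinj (by rw [hP]; exact Subtype.ext hQ.2.symm)
    exact congrArg Subtype.val this

theorem norm_app_le (M : Matrix (Fin d) (Fin d) ℝ) (v : EuclideanSpace ℝ (Fin d)) :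
    ‖app M v‖ ≤ ‖M‖ * ‖v‖ :=
  M.l2_opNorm_mulVec v

theorem inner_app_eq (M : Matrix (Fin d) (Fin d) ℝ) (x y : EuclideanSpace ℝ (Fin d)) :
    inner ℝ x (app M y) = x.ofLp ⬝ᵥ (M *ᵥ y.ofLp) := by
  rw [EuclideanSpace.inner_eq_star_dotProduct, dotProduct_comm]
  rfl

theorem inner_app_comm (hP : Pᵀ = P) (x y : EuclideanSpace ℝ (Fin d)) :
    inner ℝ x (app P y) = inner ℝ (app P x) y := by
  rw [show inner ℝ (app P x) y = inner ℝ y (app P x) from real_inner_comm _ _, inner_app_eq,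
    inner_app_eq, Matrix.dotProduct_mulVec,
    ← Matrix.mulVec_transpose, hP, dotProduct_comm]

/-- In the eigenbasis of a symmetric matrix. -/
theorem inner_eigenvectorBasis_app (hP : P.IsHermitian) (i : Fin d) (x : EuclideanSpace ℝ (Fin d)) :
    inner ℝ (hP.eigenvectorBasis i) (app P x) =
      hP.eigenvalues i * inner ℝ (hP.eigenvectorBasis i) x := by
  have hsymm : Pᵀ = P := by
    rw [← Matrix.conjTranspose_eq_transpose_of_trivial]; exact hP
  have h : app P (hP.eigenvectorBasis i) = hP.eigenvalues i • hP.eigenvectorBasis i :=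
    WithLp.ofLp_injective 2 (hP.mulVec_eigenvectorBasis i)
  rw [inner_app_comm hsymm, h, real_inner_smul_left]

variable {γmin γmax : ℝ}

theorem isLeast_spectrum_pos (hP : P.PosDef) (h : IsLeast (spectrum ℝ P) γmin) : 0 < γmin := by
  have := h.1
  rw [hP.isHermitian.spectrum_real_eq_range_eigenvalues] at this
  obtain ⟨i, rfl⟩ := this
  exact hP.eigenvalues_pos i

theorem inner_app_self_ge (hP : P.IsHermitian) (h : IsLeast (spectrum ℝ P) γmin)
    (x : EuclideanSpace ℝ (Fin d)) : γmin * ‖x‖ ^ 2 ≤ inner ℝ x (app P x) := by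
  rw [← hP.eigenvectorBasis.sum_inner_mul_inner, ← hP.eigenvectorBasis.sum_sq_norm_inner_right x,
    Finset.mul_sum]
  refine Finset.sum_le_sum fun i _ => ?_
  rw [inner_eigenvectorBasis_app, real_inner_comm, Real.norm_eq_abs, sq_abs]
  nlinarith [mul_le_mul_of_nonneg_right (h.2 (hP.eigenvalues_mem_spectrum_real i))
    (sq_nonneg (inner ℝ x (hP.eigenvectorBasis i)))]

theorem norm_app_le_of_isGreatest (hP : P.PosDef) (h : IsGreatest (spectrum ℝ P) γmax)
    (x : EuclideanSpace ℝ (Fin d)) : ‖app P x‖ ≤ γmax * ‖x‖ := by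
  have hle : ∀ i, hP.isHermitian.eigenvalues i ≤ γmax := fun i =>
    h.2 (hP.isHermitian.eigenvalues_mem_spectrum_real i)
  have hγ : 0 ≤ γmax := by
    have := h.1
    rw [hP.isHermitian.spectrum_real_eq_range_eigenvalues] at this
    obtain ⟨i, hi⟩ := this
    exact hi ▸ (hP.eigenvalues_pos i).le
  refine abs_le_of_sq_le_sq' ?_ (by positivity) |>.2
  rw [mul_pow, ← hP.isHermitian.eigenvectorBasis.sum_sq_norm_inner_right x,
    ← hP.isHermitian.eigenvectorBasis.sum_sq_norm_inner_right (app P x), Finset.mul_sum]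
  refine Finset.sum_le_sum fun i _ => ?_
  rw [inner_eigenvectorBasis_app, norm_mul, mul_pow]
  refine mul_le_mul_of_nonneg_right ?_ (sq_nonneg _)
  rw [Real.norm_of_nonneg (hP.eigenvalues_pos i).le]
  exact pow_le_pow_left₀ (hP.eigenvalues_pos i).le (hle i) 2

theorem IsLyapunovSolution.transpose_eq (hP : IsLyapunovSolution A P) : Pᵀ = P := by
  rw [← Matrix.conjTranspose_eq_transpose_of_trivial]; exact hP.1.isHermitian

/-- The source of the negative drift, and the form in which the Lyapunov equation enters all later
estimates. -/
theorem IsLyapunovSolution.inner_app_app (hP : IsLyapunovSolution A P)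
    (x : EuclideanSpace ℝ (Fin d)) : 2 * inner ℝ (app P x) (app A x) = -‖x‖ ^ 2 := by
  have h : x.ofLp ⬝ᵥ ((Aᵀ * P + P * A) *ᵥ x.ofLp) = -‖x‖ ^ 2 := by
    rw [← hP.2, Matrix.neg_mulVec, Matrix.one_mulVec, dotProduct_neg, EuclideanSpace.real_norm_sq_eq]
    simp [dotProduct, sq]
  have h1 : x.ofLp ⬝ᵥ ((P * A) *ᵥ x.ofLp) = inner ℝ (app P x) (app A x) := by
    rw [← inner_app_comm hP.transpose_eq, inner_app_eq, ← Matrix.mulVec_mulVec]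
    rfl
  have h2 : x.ofLp ⬝ᵥ ((Aᵀ * P) *ᵥ x.ofLp) = inner ℝ (app P x) (app A x) := by
    rw [inner_app_eq, ← Matrix.mulVec_mulVec, Matrix.dotProduct_mulVec, ← Matrix.mulVec_transpose,
      Matrix.transpose_transpose, dotProduct_comm]
    rfl
  rw [Matrix.add_mulVec, dotProduct_add, h1, h2] at h
  linarith

end Lyapunov

end TDLearning

namespace TDLearning

/-! ### Markov chains: several steps ahead -/

section Past

variable {Ω 𝓧 : Type*} [MeasurableSpace 𝓧] {X : ℕ → Ω → 𝓧}

/-- The `σ`-algebra generated by `X_0, …, X_n`. -/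
abbrev past (X : ℕ → Ω → 𝓧) (n : ℕ) : MeasurableSpace Ω :=
  ⨆ i ∈ Set.Iic n, MeasurableSpace.comap (X i) inferInstance

theorem past_mono {m n : ℕ} (h : m ≤ n) : past X m ≤ past X n :=
  biSup_mono fun _ hi => le_trans hi h

theorem measurable_past {m n : ℕ} (h : m ≤ n) : Measurable[past X n] (X m) := by
  rw [measurable_iff_comap_le]
  exact le_biSup (fun i => MeasurableSpace.comap (X i) inferInstance) (Set.mem_Iic.2 h)

end Past

section MarkovChain

variable {Ω 𝓧 : Type*} [MeasurableSpace Ω] [MeasurableSpace 𝓧] {μ : Measure Ω} {X : ℕ → Ω → 𝓧}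
  {Q : Kernel 𝓧 𝓧}

theorem IsMarkovChain.past_le (hX : IsMarkovChain μ X Q) (n : ℕ) : past X n ≤ ‹MeasurableSpace Ω› :=
  iSup₂_le fun i _ => (hX.measurable i).comap_le

/-- Restricting μ to a past event F plays the role of conditioning. The Markov property becomes an
identity between measures, which can be iterated because F stays in every later past. -/
theorem IsMarkovChain.map_restrict_succ (hX : IsMarkovChain μ X Q) {n : ℕ} {F : Set Ω}
    (hF : MeasurableSet[past X n] F) :
    (μ.restrict F).map (X (n + 1)) = Q ∘ₘ (μ.restrict F).map (X n) := by
  ext B hB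
  rw [Measure.map_apply (hX.measurable _) hB, Measure.restrict_apply (hX.measurable _ hB),
    Set.inter_comm, hX.markov n F hF B hB, Measure.bind_apply hB (Kernel.aemeasurable _),
    lintegral_map (Kernel.measurable_coe _ hB) (hX.measurable _)]

theorem IsMarkovChain.map_restrict_add (hX : IsMarkovChain μ X Q) {n : ℕ} {F : Set Ω}
    (hF : MeasurableSet[past X n] F) (m : ℕ) :
    (μ.restrict F).map (X (n + m)) = (Q ^ m) ∘ₘ (μ.restrict F).map (X n) := by
  induction m with
  | zero => exact (Measure.id_comp).symm
  | succ m ih =>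
    rw [← add_assoc, hX.map_restrict_succ (past_mono (Nat.le_add_right n m) _ hF), ih,
      Measure.comp_assoc, pow_succ']
    rfl

theorem isMarkovKernel_pow (Q : Kernel 𝓧 𝓧) [IsMarkovKernel Q] (m : ℕ) : IsMarkovKernel (Q ^ m) := by
  induction m with
  | zero => exact inferInstanceAs (IsMarkovKernel Kernel.id)
  | succ m ih =>
    rw [pow_succ]
    exact inferInstanceAs (IsMarkovKernel ((Q ^ m) ∘ₖ Q))

/-- The joint law of a quantity known at time `n` and of the state at time `n + m`. -/
theorem IsMarkovChain.map_prod [IsFiniteMeasure μ] [IsMarkovKernel Q] (hX : IsMarkovChain μ X Q)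
    {𝓗 : Type*} [MeasurableSpace 𝓗] {n : ℕ} {H : Ω → 𝓗} (hH : Measurable[past X n] H) {ψ : 𝓗 → 𝓧}
    (hψ : Measurable ψ) (hψH : ∀ ω, ψ (H ω) = X n ω) (m : ℕ) :
    μ.map (fun ω => (H ω, X (n + m) ω)) = (μ.map H) ⊗ₘ ((Q ^ m).comap ψ hψ) := by
  have := isMarkovKernel_pow Q m
  have hH' : Measurable H := hH.mono (hX.past_le n) le_rfl
  refine Measure.ext_prod fun {s t} hs ht => ?_
  rw [Measure.map_apply (hH'.prodMk (hX.measurable _)) (hs.prod ht), Measure.compProd_apply_prod hs ht,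
    setLIntegral_map hs (Kernel.measurable_coe _ ht) hH']
  -- On a rectangle s × t, the condition H ∈ s is an event of the past, so it can serve as the
  -- restricting set.
  have h := congrArg (fun ν : Measure 𝓧 => ν t) (hX.map_restrict_add (hH hs) m)
  rw [Measure.map_apply (hX.measurable _) ht, Measure.restrict_apply (hX.measurable _ ht),
    Measure.bind_apply ht (Kernel.aemeasurable _),
    lintegral_map (Kernel.measurable_coe _ ht) (hX.measurable _)] at h
  rw [Set.mk_preimage_prod, Set.inter_comm, h]
  exact lintegral_congr fun ω => by rw [Kernel.comap_apply, hψH]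

/-- Conditioning on the state at time `n` inside an expectation. -/
theorem IsMarkovChain.integral_eq [IsFiniteMeasure μ] [IsMarkovKernel Q] (hX : IsMarkovChain μ X Q)
    {𝓗 E : Type*} [MeasurableSpace 𝓗] [NormedAddCommGroup E] [NormedSpace ℝ E]
    {n : ℕ} {H : Ω → 𝓗} (hH : Measurable[past X n] H) {ψ : 𝓗 → 𝓧}
    (hψ : Measurable ψ) (hψH : ∀ ω, ψ (H ω) = X n ω) (m : ℕ) {f : 𝓗 × 𝓧 → E}
    (hf : StronglyMeasurable f) (hint : Integrable (fun ω => f (H ω, X (n + m) ω)) μ) :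
    ∫ ω, f (H ω, X (n + m) ω) ∂μ = ∫ ω, ∫ y, f (H ω, y) ∂((Q ^ m) (X n ω)) ∂μ := by
  have := isMarkovKernel_pow Q m
  have hH' : Measurable H := hH.mono (hX.past_le n) le_rfl
  have hpair : Measurable fun ω => (H ω, X (n + m) ω) := hH'.prodMk (hX.measurable _)
  have hint' : Integrable f (μ.map fun ω => (H ω, X (n + m) ω)) :=
    (integrable_map_measure hf.aestronglyMeasurable hpair.aemeasurable).2 hint
  rw [← integral_map hpair.aemeasurable hf.aestronglyMeasurable]
  rw [hX.map_prod hH hψ hψH m] at hint' ⊢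
  rw [Measure.integral_compProd hint', integral_map hH'.aemeasurable
    (hf.integral_kernel_prod_right' (κ := (Q ^ m).comap ψ hψ)).aestronglyMeasurable]
  exact integral_congr_ae (Eventually.of_forall fun ω => by simp [Kernel.comap_apply, hψH])

theorem IsMarkovChain.integral_comp_eq [IsFiniteMeasure μ] [IsMarkovKernel Q]
    (hX : IsMarkovChain μ X Q) {E : Type*} [NormedAddCommGroup E] [NormedSpace ℝ E]
    (m : ℕ) {f : 𝓧 → E} (hf : StronglyMeasurable f) (hint : Integrable (fun ω => f (X m ω)) μ) :
    ∫ ω, f (X m ω) ∂μ = ∫ ω, ∫ y, f y ∂((Q ^ m) (X 0 ω)) ∂μ := by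
  have h := hX.integral_eq (n := 0) (H := X 0) (measurable_past le_rfl) measurable_id (fun _ => rfl) m
    (f := fun p => f p.2) (hf.comp_measurable measurable_snd)
  simp only [zero_add] at h
  exact h hint

end MarkovChain

/-- A geometric rate gives mixing times that grow logarithmically. -/
theorem exists_log_mixing {C ρ : ℝ} (hC : 1 ≤ C) (hρ0 : 0 < ρ) (hρ1 : ρ < 1) :
    ∃ τ : ℝ → ℕ, (∀ δ > 0, 1 ≤ τ δ ∧ ∀ k ≥ τ δ, C * ρ ^ k ≤ δ) ∧
      ∀ δ₀ ∈ Set.Ioo (0 : ℝ) 1, ∃ K : ℝ, 1 ≤ K ∧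
        ∀ δ ∈ Set.Ioc 0 δ₀, (τ δ : ℝ) ≤ K * Real.log (1 / δ) := by
  have hc : 0 < -Real.log ρ := neg_pos.2 (Real.log_neg hρ0 hρ1)
  have hlogC : 0 ≤ Real.log C := Real.log_nonneg hC
  have hC0 : 0 < C := by linarith
  -- The ceiling solves Cρ^k ≤ δ for k; the extra 1 ensures τ ≥ 1.
  refine ⟨fun δ => 1 + ⌈Real.log (C / δ) / -Real.log ρ⌉₊, fun δ hδ => ⟨Nat.le_add_right _ _, ?_⟩, ?_⟩
  · intro k hk
    have h1 : Real.log (C / δ) / -Real.log ρ ≤ k :=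
      (Nat.le_ceil _).trans (by exact_mod_cast (Nat.le_add_left _ _).trans hk)
    rw [div_le_iff₀ hc] at h1
    have h2 : Real.log (C * ρ ^ k) ≤ Real.log δ := by
      rw [Real.log_mul hC0.ne' (by positivity), Real.log_pow]
      rw [Real.log_div hC0.ne' hδ.ne'] at h1
      linarith
    exact (Real.log_le_log_iff (by positivity) hδ).1 h2
  · rintro δ₀ ⟨h0, h1⟩
    have hL0 : 0 < Real.log (1 / δ₀) := Real.log_pos (by rw [lt_div_iff₀ h0]; linarith)
    set c := -Real.log ρ
    set L₀ := Real.log (1 / δ₀)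
    -- The bounded part 2 + log C / c (one unit for the explicit 1, one for the ceiling) is absorbed
    -- into a multiple of log(1/δ) ≥ L₀ > 0. This is where δ₀ < 1 matters.
    refine ⟨max 1 ((2 + Real.log C / c) / L₀ + 1 / c), le_max_left _ _, ?_⟩
    rintro δ ⟨hδ0, hδ1⟩
    have hL : L₀ ≤ Real.log (1 / δ) :=
      Real.log_le_log (by positivity) (one_div_le_one_div_of_le hδ0 hδ1)
    set L := Real.log (1 / δ) with hLdef
    have hx : Real.log (C / δ) = Real.log C + L := by
      rw [hLdef, div_eq_mul_one_div, Real.log_mul hC0.ne' (by positivity)]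
    have hLpos : 0 < L := hL0.trans_le hL
    have hxnn : 0 ≤ Real.log (C / δ) / c := by rw [hx]; positivity
    have hceil := Nat.ceil_lt_add_one hxnn
    push_cast
    have hK : ((2 + Real.log C / c) / L₀ + 1 / c) * L ≤ max 1 ((2 + Real.log C / c) / L₀ + 1 / c) * L :=
      mul_le_mul_of_nonneg_right (le_max_right _ _) hLpos.le
    have hb : 2 + Real.log C / c ≤ (2 + Real.log C / c) / L₀ * L := by
      rw [div_mul_eq_mul_div, le_div_iff₀ hL0]
      exact mul_le_mul_of_nonneg_left hL (by positivity)
    have hx2 : Real.log (C / δ) / c = Real.log C / c + 1 / c * L := by rw [hx]; ring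
    rw [hx2] at hceil ⊢
    linarith

section Geometric

variable {Ω 𝓧 : Type*} [MeasurableSpace Ω] [MeasurableSpace 𝓧] {μ : Measure Ω} {X : ℕ → Ω → 𝓧}
  {Q : Kernel 𝓧 𝓧} {d : ℕ} {𝒮 : Set 𝓧} {A : 𝓧 → Matrix (Fin d) (Fin d) ℝ}
  {b : 𝓧 → EuclideanSpace ℝ (Fin d)} {Abar : Matrix (Fin d) (Fin d) ℝ}

/-- A set that is closed under the transitions of `Q` is closed under those of `Q ^ k`. -/
theorem ae_mem_pow (h𝒮 : MeasurableSet 𝒮) (hQ : ∀ x ∈ 𝒮, ∀ᵐ y ∂(Q x), y ∈ 𝒮) (k : ℕ) :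
    ∀ x ∈ 𝒮, ∀ᵐ y ∂((Q ^ k) x), y ∈ 𝒮 := by
  induction k with
  | zero =>
    intro x hx
    change ∀ᵐ y ∂(Kernel.id x), y ∈ 𝒮
    rw [Kernel.id_apply, ae_dirac_iff (p := fun y => y ∈ 𝒮) h𝒮]
    exact hx
  | succ k ih =>
    intro x hx
    rw [pow_succ]
    change ∀ᵐ y ∂(((Q ^ k) ∘ₖ Q) x), y ∈ 𝒮
    rw [Kernel.comp_apply]
    exact Measure.ae_comp_of_ae_ae h𝒮 ((hQ x hx).mono fun y hy => ih y hy)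

theorem integral_pow_succ {E : Type*} [NormedAddCommGroup E] [NormedSpace ℝ E] {f : 𝓧 → E}
    {k : ℕ} {x : 𝓧} (hf : Integrable f ((Q ^ (k + 1)) x)) :
    ∫ y, f y ∂((Q ^ (k + 1)) x) = ∫ z, ∫ y, f y ∂((Q ^ k) z) ∂(Q x) := by
  rw [pow_succ] at hf ⊢
  exact Kernel.integral_comp hf

/-- A conditional mean that is uniformly close to `c` gives an unconditional mean close to `c`. -/
theorem IsMarkovChain.tendsto_integral [IsProbabilityMeasure μ] [IsMarkovKernel Q]
    (hX : IsMarkovChain μ X Q) (hmem : ∀ k, ∀ᵐ ω ∂μ, X k ω ∈ 𝒮)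
    {E : Type*} [NormedAddCommGroup E] [NormedSpace ℝ E] [CompleteSpace E]
    {f : 𝓧 → E} (hf : StronglyMeasurable f)
    (hint : ∀ k, Integrable (fun ω => f (X k ω)) μ) {c : E} {C ρ : ℝ} (hρ0 : 0 ≤ ρ) (hρ1 : ρ < 1)
    (hbound : ∀ x ∈ 𝒮, ∀ k, 1 ≤ k → ‖∫ y, f y ∂((Q ^ k) x) - c‖ ≤ C * ρ ^ k) :
    Tendsto (fun k => ∫ ω, f (X k ω) ∂μ) atTop (𝓝 c) := by
  rw [tendsto_iff_norm_sub_tendsto_zero]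
  have hlim : Tendsto (fun k : ℕ => C * ρ ^ k) atTop (𝓝 0) := by
    simpa using (tendsto_pow_atTop_nhds_zero_of_lt_one hρ0 hρ1).const_mul C
  refine squeeze_zero' (Eventually.of_forall fun _ => norm_nonneg _) ?_ hlim
  filter_upwards [eventually_ge_atTop 1] with k hk
  have := isMarkovKernel_pow Q k
  have hae : ∀ᵐ ω ∂μ, ‖∫ y, f y ∂((Q ^ k) (X 0 ω)) - c‖ ≤ C * ρ ^ k :=
    (hmem 0).mono fun ω hω => hbound _ hω k hk
  have hm : StronglyMeasurable fun ω => ∫ y, f y ∂((Q ^ k) (X 0 ω)) :=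
    ((hf.comp_measurable measurable_snd).integral_kernel_prod_right' (κ := Q ^ k)).comp_measurable
      (hX.measurable 0)
  have hi : Integrable (fun ω => ∫ y, f y ∂((Q ^ k) (X 0 ω)) - c) μ :=
    Integrable.of_bound (hm.sub stronglyMeasurable_const).aestronglyMeasurable _ hae
  have hi' : Integrable (fun ω => ∫ y, f y ∂((Q ^ k) (X 0 ω))) μ :=
    (hi.add (integrable_const c)).congr (ae_of_all _ fun ω => sub_add_cancel _ _)
  have : ∫ ω, f (X k ω) ∂μ - c = ∫ ω, (∫ y, f y ∂((Q ^ k) (X 0 ω)) - c) ∂μ := by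
    rw [integral_sub hi' (integrable_const c), hX.integral_comp_eq k hf (hint k)]
    simp
  rw [this]
  simpa using norm_integral_le_of_norm_le_const hae

theorem assumption1_of_geometric [IsProbabilityMeasure μ] [IsMarkovKernel Q]
    (hX : IsMarkovChain μ X Q) (hmem : ∀ k, ∀ᵐ ω ∂μ, X k ω ∈ 𝒮) (h𝒮 : MeasurableSet 𝒮)
    (hQ : ∀ x ∈ 𝒮, ∀ᵐ y ∂(Q x), y ∈ 𝒮) (hA : StronglyMeasurable A) (hb : StronglyMeasurable b)
    {a β : ℝ} (hAle : ∀ x ∈ 𝒮, ‖A x‖ ≤ a) (hble : ∀ x ∈ 𝒮, ‖b x‖ ≤ β)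
    {C ρ : ℝ} (hρ0 : 0 < ρ) (hρ1 : ρ < 1)
    (hAgeo : ∀ x ∈ 𝒮, ∀ k, 1 ≤ k → ‖∫ y, A y ∂((Q ^ k) x) - Abar‖ ≤ C * ρ ^ k)
    (hbgeo : ∀ x ∈ 𝒮, ∀ k, 1 ≤ k → ‖∫ y, b y ∂((Q ^ k) x)‖ ≤ C * ρ ^ k) :
    Assumption1 μ X Q 𝒮 A b Abar := by
  have hQk := fun k => isMarkovKernel_pow Q k
  have hintA : ∀ k, Integrable (fun ω => A (X k ω)) μ := fun k =>
    Integrable.of_bound (hA.comp_measurable (hX.measurable k)).aestronglyMeasurable a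
      ((hmem k).mono fun ω hω => hAle _ hω)
  have hintb : ∀ k, Integrable (fun ω => b (X k ω)) μ := fun k =>
    Integrable.of_bound (hb.comp_measurable (hX.measurable k)).aestronglyMeasurable β
      ((hmem k).mono fun ω hω => hble _ hω)
  refine ⟨hX, hmem, hintA, hintb, fun x hx k => ?_, fun x hx k => ?_, ?_, ?_, ?_⟩
  · have := hQk k
    exact Integrable.of_bound hA.aestronglyMeasurable a
      ((ae_mem_pow h𝒮 hQ k x hx).mono fun y hy => hAle _ hy)
  · have := hQk k
    exact Integrable.of_bound hb.aestronglyMeasurable β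
      ((ae_mem_pow h𝒮 hQ k x hx).mono fun y hy => hble _ hy)
  · exact hX.tendsto_integral hmem hA hintA hρ0.le hρ1 hAgeo
  · exact hX.tendsto_integral hmem hb hintb (c := 0) hρ0.le hρ1
      (by simpa only [sub_zero] using hbgeo)
  · obtain ⟨τ, hτ, hlog⟩ := exists_log_mixing (le_max_left 1 C) hρ0 hρ1
    refine ⟨τ, fun δ hδ => ⟨(hτ δ hδ).1, fun x hx k hk => ?_⟩, hlog⟩
    have hk1 : 1 ≤ k := (hτ δ hδ).1.trans hk
    have hle : C * ρ ^ k ≤ δ :=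
      (mul_le_mul_of_nonneg_right (le_max_right 1 C) (by positivity)).trans ((hτ δ hδ).2 k hk)
    refine ⟨(hbgeo x hx k hk1).trans hle, ?_⟩
    rw [norm_sub_rev]
    exact (hAgeo x hx k hk1).trans hle

end Geometric

end TDLearning

namespace TDLearning

/-! ### The finite-time bound -/

section Deterministic

variable {d : ℕ} {ε β : ℝ} {θ c : ℕ → EuclideanSpace ℝ (Fin d)} {M : ℕ → Matrix (Fin d) (Fin d) ℝ}

theorem norm_app_add_le {M : Matrix (Fin d) (Fin d) ℝ} (hM : ‖M‖ ≤ 1)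
    {x b : EuclideanSpace ℝ (Fin d)} (hb : ‖b‖ ≤ β) : ‖app M x + b‖ ≤ ‖x‖ + β :=
  (norm_add_le _ _).trans (add_le_add ((norm_app_le M x).trans
    (mul_le_of_le_one_left (norm_nonneg x) hM)) hb)

/-- A discrete Gronwall estimate: the shifted norm ‖θ‖ + β grows by at most a factor 1 + ε per step.
-/
theorem norm_add_le_pow (hε : 0 ≤ ε) (hM : ∀ k, ‖M k‖ ≤ 1) (hc : ∀ k, ‖c k‖ ≤ β)
    (hθ : ∀ k, θ (k + 1) = θ k + ε • (app (M k) (θ k) + c k)) (k m : ℕ) :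
    ‖θ (k + m)‖ + β ≤ (1 + ε) ^ m * (‖θ k‖ + β) := by
  induction m with
  | zero => simp
  | succ m ih =>
    have h1 : ‖θ (k + (m + 1))‖ ≤ ‖θ (k + m)‖ + ε * (‖θ (k + m)‖ + β) := by
      rw [← add_assoc, hθ]
      refine (norm_add_le _ _).trans ?_
      rw [norm_smul, Real.norm_of_nonneg hε]
      gcongr
      exact norm_app_add_le (hM _) (hc _)
    calc ‖θ (k + (m + 1))‖ + β ≤ (1 + ε) * (‖θ (k + m)‖ + β) := by linarith
      _ ≤ (1 + ε) * ((1 + ε) ^ m * (‖θ k‖ + β)) := by gcongr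
      _ = (1 + ε) ^ (m + 1) * (‖θ k‖ + β) := by ring

theorem norm_sub_le_pow (hε : 0 ≤ ε) (hM : ∀ k, ‖M k‖ ≤ 1) (hc : ∀ k, ‖c k‖ ≤ β)
    (hθ : ∀ k, θ (k + 1) = θ k + ε • (app (M k) (θ k) + c k)) (k m : ℕ) :
    ‖θ (k + m) - θ k‖ ≤ ((1 + ε) ^ m - 1) * (‖θ k‖ + β) := by
  induction m with
  | zero => simp
  | succ m ih =>
    have h1 : ‖θ (k + (m + 1)) - θ k‖ ≤ ‖θ (k + m) - θ k‖ + ε * (‖θ (k + m)‖ + β) := by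
      rw [← add_assoc, hθ, add_sub_right_comm]
      refine (norm_add_le _ _).trans ?_
      rw [norm_smul, Real.norm_of_nonneg hε]
      gcongr
      exact norm_app_add_le (hM _) (hc _)
    have h2 := mul_le_mul_of_nonneg_left (norm_add_le_pow hε hM hc hθ k m) hε
    calc ‖θ (k + (m + 1)) - θ k‖
        ≤ ((1 + ε) ^ m - 1) * (‖θ k‖ + β) + ε * ((1 + ε) ^ m * (‖θ k‖ + β)) := by linarith
      _ = ((1 + ε) ^ (m + 1) - 1) * (‖θ k‖ + β) := by ring

/-- With s = εm, (1 + ε)^m ≤ e^s ≤ 1/(1 - s), and s/(1 - s) ≤ (4/3)s when s ≤ 1/4. -/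
theorem one_add_pow_sub_one_le (hε : 0 ≤ ε) {m : ℕ} (hm : ε * m ≤ 1 / 4) :
    (1 + ε) ^ m - 1 ≤ 4 / 3 * (ε * m) := by
  have hs0 : 0 ≤ ε * m := by positivity
  have h1 : (1 + ε) ^ m ≤ Real.exp (ε * m) := by
    rw [mul_comm, Real.exp_nat_mul]
    exact pow_le_pow_left₀ (by linarith) (by linarith [Real.add_one_le_exp ε]) m
  have h2 : Real.exp (ε * m) * (1 - ε * m) ≤ 1 := by
    have h3 := mul_le_mul_of_nonneg_left (Real.one_sub_le_exp_neg (ε * m)) (Real.exp_pos (ε * m)).le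
    rwa [← Real.exp_add, add_neg_cancel, Real.exp_zero] at h3
  nlinarith [Real.exp_pos (ε * m)]

theorem norm_sub_le_of_mul_le (hε : 0 ≤ ε) (hM : ∀ k, ‖M k‖ ≤ 1) (hc : ∀ k, ‖c k‖ ≤ β)
    (hθ : ∀ k, θ (k + 1) = θ k + ε • (app (M k) (θ k) + c k)) (k : ℕ) {m : ℕ}
    (hm : ε * m ≤ 1 / 4) :
    ‖θ (k + m) - θ k‖ ≤ 4 / 3 * (ε * m) * (‖θ k‖ + β) :=
  (norm_sub_le_pow hε hM hc hθ k m).trans <|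
    mul_le_mul_of_nonneg_right (one_add_pow_sub_one_le hε hm)
      (add_nonneg (norm_nonneg _) ((norm_nonneg _).trans (hc 0)))

/-- The error terms of the drift, collected. -/
theorem drift_error_le {R r u s : ℝ} (hR : 0 ≤ R) (hr : 0 ≤ r) (hβ : 0 ≤ β)
    (hε : 0 ≤ ε) (hεs : ε ≤ s) (hs : s ≤ 1 / 4) (hur : u ≤ 4 / 3 * s * (r + β))
    (hrR : r ≤ R + u) :
    2 * (u * (2 * (R + r) + β)) + 2 * (ε * (r ^ 2 + r)) + ε * (R + β) ^ 2 ≤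
      s * (62 * (1 + β) * R ^ 2 + 55 * (1 + β) ^ 3) := by
  have hs0 : 0 ≤ s := hε.trans hεs
  set T := R + β with hT
  have hT0 : 0 ≤ T := add_nonneg hR hβ
  -- Since s ≤ 1/4, u ≤ (r + β)/3. Inserting this in r ≤ R + u and solving for r + β gives the
  -- factor 3/2.
  have hrβ : r + β ≤ 3 / 2 * T := by
    nlinarith [mul_nonneg (sub_nonneg.2 hs) (add_nonneg hr hβ)]
  have hu2 : u ≤ 2 * s * T := hur.trans (by nlinarith)
  have hrT : r ≤ 3 / 2 * T := by linarith
  have h1 : u * (2 * (R + r) + β) ≤ (2 * s * T) * (5 * T) := by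
    have h5 : 2 * (R + r) + β ≤ 5 * T := by linarith
    calc u * (2 * (R + r) + β) ≤ (2 * s * T) * (2 * (R + r) + β) :=
          mul_le_mul_of_nonneg_right hu2 (by positivity)
      _ ≤ _ := mul_le_mul_of_nonneg_left h5 (by positivity)
  have h2 : ε * (r ^ 2 + r) ≤ s * (9 / 4 * T ^ 2 + 3 / 2 * T) := by
    have : r ^ 2 + r ≤ 9 / 4 * T ^ 2 + 3 / 2 * T := by nlinarith
    exact mul_le_mul hεs this (by positivity) hs0
  have h3 : ε * T ^ 2 ≤ s * T ^ 2 := mul_le_mul_of_nonneg_right hεs (sq_nonneg T)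
  -- The coefficients collect the three errors: 51/2 = 2·10 + 2·(9/4) + 1 and 3 = 2·(3/2). The
  -- constants 62 and 55 leave room for splitting T² and for trading R against R².
  have h4 : 51 / 2 * T ^ 2 + 3 * T ≤ 62 * (1 + β) * R ^ 2 + 55 * (1 + β) ^ 3 := by
    have hT2 : T ^ 2 ≤ 2 * R ^ 2 + 2 * β ^ 2 := by rw [hT]; nlinarith [sq_nonneg (R - β)]
    have hR1 : R ≤ (1 + R ^ 2) / 2 := by nlinarith [sq_nonneg (R - 1)]
    have hb3 : 0 ≤ β ^ 3 := by positivity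
    nlinarith [mul_nonneg hβ (sq_nonneg R)]
  nlinarith [mul_le_mul_of_nonneg_left h4 hs0]

variable {A Abar P : Matrix (Fin d) (Fin d) ℝ} {γmin γmax : ℝ}

/-- The cross term of the drift of the Lyapunov function. -/
noncomputable def crossTerm (P Abar : Matrix (Fin d) (Fin d) ℝ) (x : EuclideanSpace ℝ (Fin d))
    (A : Matrix (Fin d) (Fin d) ℝ) (b : EuclideanSpace ℝ (Fin d)) : ℝ :=
  inner ℝ (app P x) (app (A - Abar) x + b)

theorem app_sub_left (M N : Matrix (Fin d) (Fin d) ℝ) (x : EuclideanSpace ℝ (Fin d)) :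
    app (M - N) x = app M x - app N x := by
  simp [app, map_sub]

/-- Expand the quadratic form and write A = Abar + (A - Abar). The Abar part is evaluated exactly by
the Lyapunov equation, so all randomness of first order sits in the cross term. -/
theorem lyapunov_drift (hP : IsLyapunovSolution Abar P) (x b : EuclideanSpace ℝ (Fin d)) :
    inner ℝ (x + ε • (app A x + b)) (app P (x + ε • (app A x + b))) =
      inner ℝ x (app P x) - ε * ‖x‖ ^ 2 + 2 * ε * crossTerm P Abar x A b +
        ε ^ 2 * inner ℝ (app A x + b) (app P (app A x + b)) := by
  have h1 := hP.inner_app_app x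
  set Δ := app A x + b with hΔ
  have h2 : crossTerm P Abar x A b = inner ℝ (app P x) Δ - inner ℝ (app P x) (app Abar x) := by
    rw [crossTerm, app_sub_left, hΔ, ← inner_sub_right]
    congr 1; abel
  have h3 : inner ℝ x (app P Δ) = inner ℝ (app P x) Δ := inner_app_comm hP.transpose_eq _ _
  have h4 : inner ℝ Δ (app P x) = inner ℝ (app P x) Δ := real_inner_comm _ _
  rw [h2, app, map_add, map_smul, inner_add_left, inner_add_right, inner_add_right,
    real_inner_smul_left, real_inner_smul_left, real_inner_smul_right, real_inner_smul_right]
  change _ + ε * inner ℝ x (app P Δ) + (ε * inner ℝ Δ (app P x) + ε * (ε * inner ℝ Δ (app P Δ))) = _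
  rw [h3, h4]
  linear_combination ε * h1

/-- Used at two scales: with δ = 2 and δ' = b_max for integrability, and with δ = δ' = ε for
conditional means after mixing. -/
theorem abs_crossTerm_le (hP : P.PosDef) (hγ : IsGreatest (spectrum ℝ P) γmax) {δ δ' : ℝ}
    {x b : EuclideanSpace ℝ (Fin d)} (hA : ‖A - Abar‖ ≤ δ) (hb : ‖b‖ ≤ δ') (hγ0 : 0 ≤ γmax) :
    |crossTerm P Abar x A b| ≤ γmax * (‖x‖ * (δ * ‖x‖ + δ')) := by
  refine (abs_real_inner_le_norm _ _).trans ?_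
  rw [← mul_assoc]
  refine mul_le_mul (norm_app_le_of_isGreatest hP hγ x) ?_ (norm_nonneg _) (by positivity)
  refine (norm_add_le _ _).trans (add_le_add ((norm_app_le _ _).trans ?_) hb)
  exact mul_le_mul_of_nonneg_right hA (norm_nonneg _)

/-- The price of freezing the iterate. The cross term is a quadratic polynomial in it, so the change
is proportional to the displacement times the size of the iterates. -/
theorem crossTerm_sub_le (hP : P.PosDef) (hγ : IsGreatest (spectrum ℝ P) γmax) (hγ0 : 0 ≤ γmax)
    (hA : ‖A‖ ≤ 1) (hAbar : ‖Abar‖ ≤ 1) {x y b : EuclideanSpace ℝ (Fin d)} (hb : ‖b‖ ≤ β) :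
    crossTerm P Abar x A b - crossTerm P Abar y A b ≤
      γmax * (‖x - y‖ * (2 * (‖x‖ + ‖y‖) + β)) := by
  have hβ : 0 ≤ β := (norm_nonneg b).trans hb
  have hA2 : ‖A - Abar‖ ≤ 2 := (norm_sub_le _ _).trans (by linarith)
  have h1 : crossTerm P Abar x A b - crossTerm P Abar y A b =
      inner ℝ (app P (x - y)) (app (A - Abar) x + b) +
        inner ℝ (app P y) (app (A - Abar) (x - y)) := by
    rw [crossTerm, crossTerm]
    simp only [app, map_sub, inner_sub_left, inner_sub_right, inner_add_right]
    ring
  have hPn := fun z => norm_app_le_of_isGreatest hP hγ z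
  have hAn : ∀ z : EuclideanSpace ℝ (Fin d), ‖app (A - Abar) z‖ ≤ 2 * ‖z‖ := fun z =>
    (norm_app_le _ z).trans (mul_le_mul_of_nonneg_right hA2 (norm_nonneg z))
  have h2 : inner ℝ (app P (x - y)) (app (A - Abar) x + b) ≤ (γmax * ‖x - y‖) * (2 * ‖x‖ + β) :=
    (real_inner_le_norm _ _).trans <| mul_le_mul (hPn _)
      ((norm_add_le _ _).trans (add_le_add (hAn x) hb)) (norm_nonneg _) (by positivity)
  have h3 : inner ℝ (app P y) (app (A - Abar) (x - y)) ≤ (γmax * ‖y‖) * (2 * ‖x - y‖) :=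
    (real_inner_le_norm _ _).trans <| mul_le_mul (hPn _) (hAn _) (norm_nonneg _) (by positivity)
  rw [h1]
  linarith

theorem inner_app_self_le (hP : P.PosDef) (hγ : IsGreatest (spectrum ℝ P) γmax)
    (x : EuclideanSpace ℝ (Fin d)) : inner ℝ x (app P x) ≤ γmax * ‖x‖ ^ 2 := by
  refine (real_inner_le_norm _ _).trans ?_
  nlinarith [mul_le_mul_of_nonneg_left (norm_app_le_of_isGreatest hP hγ x) (norm_nonneg x)]

/-- On a unit vector the Lyapunov equation reads 1 = -2⟨Px, Abar x⟩ ≤ 2γ_max. This lower bound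
forces ετ to be small and keeps the contraction factor nonnegative. -/
theorem half_le_of_isGreatest (hP : IsLyapunovSolution Abar P) (hγ : IsGreatest (spectrum ℝ P) γmax)
    (hAbar : ‖Abar‖ ≤ 1) : 1 / 2 ≤ γmax := by
  have hmem := hγ.1
  rw [hP.1.isHermitian.spectrum_real_eq_range_eigenvalues] at hmem
  obtain ⟨i, hi⟩ := hmem
  set x := hP.1.isHermitian.eigenvectorBasis i
  have hx : ‖x‖ = 1 := hP.1.isHermitian.eigenvectorBasis.orthonormal.1 i
  have h1 := hP.inner_app_app x
  have h2 := abs_real_inner_le_norm (app P x) (app Abar x)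
  have h3 := norm_app_le_of_isGreatest hP.1 hγ x
  have h4 := norm_app_le Abar x
  rw [hx] at h1 h3 h4
  have h5 : ‖app P x‖ * ‖app Abar x‖ ≤ γmax * 1 :=
    mul_le_mul (by linarith) (by linarith) (norm_nonneg _) ((norm_nonneg (app P x)).trans (by linarith))
  have h6 := neg_le_of_abs_le h2
  linarith

/-- One step of the Lyapunov drift, up to the cross term at the earlier iterate `y`. -/
theorem drift_step_le (hP : IsLyapunovSolution Abar P) (hγ : IsGreatest (spectrum ℝ P) γmax)
    (hγ0 : 0 < γmax) (hA : ‖A‖ ≤ 1) (hAbar : ‖Abar‖ ≤ 1) {x y b : EuclideanSpace ℝ (Fin d)}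
    (hb : ‖b‖ ≤ β) {s : ℝ} (hε : 0 ≤ ε) (hεs : ε ≤ s) (hs : s ≤ 1 / 4)
    (hxy : ‖x - y‖ ≤ 4 / 3 * s * (‖y‖ + β)) (hκ : kappa1 γmax β * s ≤ 0.05) :
    inner ℝ (x + ε • (app A x + b)) (app P (x + ε • (app A x + b))) +
        2 * ε * (γmax * (ε * (‖y‖ ^ 2 + ‖y‖)) - crossTerm P Abar y A b) ≤
      (1 - 0.9 * ε / γmax) * inner ℝ x (app P x) + ε * (s * kappa2 γmax β) := by
  have hβ : 0 ≤ β := (norm_nonneg b).trans hb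
  have hyx : ‖y‖ ≤ ‖x‖ + ‖x - y‖ := by
    have := norm_sub_le x (x - y)
    simpa using this
  have herr := drift_error_le (norm_nonneg x) (norm_nonneg y) hβ hε hεs hs hxy hyx
  have hcross := crossTerm_sub_le hP.1 hγ hγ0.le hA hAbar (x := x) (y := y) hb
  have hΔ : inner ℝ (app A x + b) (app P (app A x + b)) ≤ γmax * (‖x‖ + β) ^ 2 :=
    (inner_app_self_le hP.1 hγ _).trans <| mul_le_mul_of_nonneg_left
      (pow_le_pow_left₀ (norm_nonneg _) (norm_app_add_le hA hb) 2) hγ0.le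
  have hW := inner_app_self_le hP.1 hγ x
  -- Of the gain ε‖x‖², the share 0.9 becomes contraction of the Lyapunov function, and 0.05 pays
  -- for the errors proportional to ‖x‖².
  have hW2 : 0.9 * ε / γmax * inner ℝ x (app P x) ≤ 0.9 * ε * ‖x‖ ^ 2 := by
    rw [div_mul_eq_mul_div, div_le_iff₀ hγ0]
    nlinarith [mul_le_mul_of_nonneg_left hW hε]
  have hκ' : s * γmax * (62 * (1 + β) * ‖x‖ ^ 2) ≤ 0.05 * ‖x‖ ^ 2 := by
    rw [kappa1] at hκ
    nlinarith [mul_le_mul_of_nonneg_right hκ (sq_nonneg ‖x‖)]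
  rw [lyapunov_drift hP, kappa2]
  have e1 := mul_le_mul_of_nonneg_left herr (mul_nonneg hε hγ0.le)
  have e2 := mul_le_mul_of_nonneg_left hcross (mul_nonneg two_pos.le hε)
  have e3 := mul_le_mul_of_nonneg_left hΔ (sq_nonneg ε)
  have e4 := mul_le_mul_of_nonneg_left hκ' hε
  have e5 : 0 ≤ ε * ‖x‖ ^ 2 := by positivity
  linarith

end Deterministic

end TDLearning

namespace TDLearning

/-! ### From the pathwise drift to the mean-square bound -/

section FiniteTime

variable {d : ℕ} {Abar P : Matrix (Fin d) (Fin d) ℝ} {ε : ℝ} {θ₀ : EuclideanSpace ℝ (Fin d)}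

theorem continuous_app :
    Continuous fun p : Matrix (Fin d) (Fin d) ℝ × EuclideanSpace ℝ (Fin d) => app p.1 p.2 := by
  change Continuous fun p : Matrix (Fin d) (Fin d) ℝ × EuclideanSpace ℝ (Fin d) =>
    WithLp.toLp 2 (p.1 *ᵥ p.2.ofLp)
  exact (PiLp.continuous_toLp 2 _).comp
    (continuous_fst.matrix_mulVec ((PiLp.continuous_ofLp 2 _).comp continuous_snd))

theorem stronglyMeasurable_app_prod {α : Type*} {m : MeasurableSpace α}
    {p : α → Matrix (Fin d) (Fin d) ℝ × EuclideanSpace ℝ (Fin d)} (hp : StronglyMeasurable p) :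
    StronglyMeasurable fun a => app (p a).1 (p a).2 :=
  Continuous.comp_stronglyMeasurable
    (g := fun p : Matrix (Fin d) (Fin d) ℝ × EuclideanSpace ℝ (Fin d) => app p.1 p.2)
    continuous_app hp

theorem stronglyMeasurable_app {α : Type*} {m : MeasurableSpace α}
    {M : α → Matrix (Fin d) (Fin d) ℝ} {v : α → EuclideanSpace ℝ (Fin d)}
    (hM : StronglyMeasurable M) (hv : StronglyMeasurable v) :
    StronglyMeasurable fun a => app (M a) (v a) :=
  stronglyMeasurable_app_prod (p := fun a => (M a, v a)) (hM.prodMk hv)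

theorem stronglyMeasurable_crossTerm {α : Type*} {m : MeasurableSpace α}
    {M : α → Matrix (Fin d) (Fin d) ℝ} {v w : α → EuclideanSpace ℝ (Fin d)}
    (hM : StronglyMeasurable M) (hv : StronglyMeasurable v) (hw : StronglyMeasurable w) :
    StronglyMeasurable fun a => crossTerm P Abar (v a) (M a) (w a) :=
  (stronglyMeasurable_app stronglyMeasurable_const hv).inner
    ((stronglyMeasurable_app (hM.sub stronglyMeasurable_const) hv).add hw)

/-- The iterate at time `k` is determined by the states up to time `k`. -/
theorem stronglyMeasurable_iterate {Ω 𝓧 : Type*} [MeasurableSpace 𝓧] {X : ℕ → Ω → 𝓧}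
    {A : 𝓧 → Matrix (Fin d) (Fin d) ℝ} {b : 𝓧 → EuclideanSpace ℝ (Fin d)}
    {Θ : ℕ → Ω → EuclideanSpace ℝ (Fin d)} (hA : StronglyMeasurable A) (hb : StronglyMeasurable b)
    (h0 : ∀ ω, Θ 0 ω = θ₀)
    (hΘ : ∀ k ω, Θ (k + 1) ω = Θ k ω + ε • (app (A (X k ω)) (Θ k ω) + b (X k ω))) (k : ℕ) :
    StronglyMeasurable[past X k] (Θ k) := by
  induction k with
  | zero => rw [show Θ 0 = fun _ => θ₀ from funext h0]; exact stronglyMeasurable_const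
  | succ k ih =>
    have ih' : StronglyMeasurable[past X (k + 1)] (Θ k) := ih.mono (past_mono (Nat.le_succ k))
    have hXk : Measurable[past X (k + 1)] (X k) := measurable_past (Nat.le_succ k)
    rw [show Θ (k + 1) = fun ω => Θ k ω + ε • (app (A (X k ω)) (Θ k ω) + b (X k ω)) from
      funext (hΘ k)]
    exact ih'.add (((stronglyMeasurable_app (hA.comp_measurable hXk) ih').add
      (hb.comp_measurable hXk)).const_smul ε)

variable {Ω 𝓧 : Type*} [MeasurableSpace Ω] [MeasurableSpace 𝓧] {μ : Measure Ω} {X : ℕ → Ω → 𝓧}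
  {Q : Kernel 𝓧 𝓧} {𝒮 : Set 𝓧} {A : 𝓧 → Matrix (Fin d) (Fin d) ℝ}
  {b : 𝓧 → EuclideanSpace ℝ (Fin d)} {Θ : ℕ → Ω → EuclideanSpace ℝ (Fin d)}

/-- The conditional mean of the cross term, in terms of the conditional means of `A` and `b`. -/
theorem integral_crossTerm {κ : Measure 𝓧} [IsProbabilityMeasure κ] (hA : Integrable A κ)
    (hb : Integrable b κ) (x : EuclideanSpace ℝ (Fin d)) :
    ∫ y, crossTerm P Abar x (A y) (b y) ∂κ = crossTerm P Abar x (∫ y, A y ∂κ) (∫ y, b y ∂κ) := by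
  -- For fixed x the cross term is a continuous affine function of the pair (A, b), so it commutes
  -- with the mean.
  let L₁ : Matrix (Fin d) (Fin d) ℝ →L[ℝ] ℝ := LinearMap.toContinuousLinearMap
    { toFun := fun M => inner ℝ (app P x) (app M x)
      map_add' := fun M N => by simp [app, inner_add_right]
      map_smul' := fun c M => by simp [app, real_inner_smul_right] }
  let L₂ : EuclideanSpace ℝ (Fin d) →L[ℝ] ℝ := innerSL ℝ (app P x)
  have h : ∀ (M : Matrix (Fin d) (Fin d) ℝ) (v : EuclideanSpace ℝ (Fin d)),
      crossTerm P Abar x M v = L₁ M + L₂ v - L₁ Abar := fun M v => by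
    have e : L₁ (M - Abar) = L₁ M - L₁ Abar := map_sub L₁ _ _
    rw [crossTerm, inner_add_right]
    change L₁ (M - Abar) + L₂ v = _
    rw [e]; ring
  simp only [h]
  have i₁ : Integrable (fun y => L₁ (A y)) κ := L₁.integrable_comp hA
  have i₂ : Integrable (fun y => L₂ (b y)) κ := L₂.integrable_comp hb
  rw [integral_sub (f := fun y => L₁ (A y) + L₂ (b y)) (i₁.add i₂) (integrable_const _), integral_add i₁ i₂,
    L₁.integral_comp_comm hA, L₂.integral_comp_comm hb]
  simp

/-- The limit of means of matrices in the closed unit ball stays in that ball. -/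
theorem norm_Abar_le [IsProbabilityMeasure μ] (h1 : Assumption1 μ X Q 𝒮 A b Abar)
    (h2 : Assumption2 𝒮 A b) : ‖Abar‖ ≤ 1 := by
  refine le_of_tendsto' h1.tendsto_A.norm fun k => ?_
  have := norm_integral_le_of_norm_le_const (μ := μ) (f := fun ω => A (X k ω)) (C := 1)
    ((h1.mem_stateSpace k).mono fun ω hω => h2.norm_A_le _ hω)
  simpa using this

/-- The drift at time n + τ is compared with the cross term frozen at time n. Conditioning at time n
then replaces A and b by their τ-step conditional means, which the mixing time controls. -/
theorem finiteTimeBound [IsProbabilityMeasure μ] [IsMarkovKernel Q]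
    (h1 : Assumption1 μ X Q 𝒮 A b Abar) (h2 : Assumption2 𝒮 A b)
    (hA : StronglyMeasurable A) (hb : StronglyMeasurable b) (hε : 0 < ε)
    (h0 : ∀ ω, Θ 0 ω = θ₀)
    (hΘ : ∀ k ω, Θ (k + 1) ω = Θ k ω + ε • (app (A (X k ω)) (Θ k ω) + b (X k ω))) :
    FiniteTimeBound μ Q 𝒮 A b Abar ε θ₀ Θ := by
  intro P γmin γmax hP hγmin hγmax τ hτ hετ hκ
  set β := bMax 𝒮 b with hβ
  set s : ℝ := ε * τ with hs
  have hX := h1.isMarkovChain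
  have hAbar := norm_Abar_le h1 h2
  have hγ2 := half_le_of_isGreatest hP hγmax hAbar
  have hγ0 : 0 < γmax := by linarith
  have hγmin0 := isLeast_spectrum_pos hP.1 hγmin
  have hτ1 : (1 : ℝ) ≤ τ := by exact_mod_cast hτ.1
  have hεs : ε ≤ s := le_mul_of_one_le_right hε.le hτ1
  have hble : ∀ x ∈ 𝒮, ‖b x‖ ≤ β := fun x hx => le_csSup h2.bddAbove_b ⟨x, hx, rfl⟩
  have hall : ∀ᵐ ω ∂μ, ∀ k, X k ω ∈ 𝒮 := ae_all_iff.2 h1.mem_stateSpace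
  have hβ0 : 0 ≤ β := by
    obtain ⟨ω, hω⟩ := hall.exists
    exact (norm_nonneg _).trans (hble _ (hω 0))
  have hκs : kappa1 γmax β * s ≤ 0.05 := by
    have : kappa1 γmax β * ε * τ = kappa1 γmax β * s := by rw [hs]; ring
    rw [this] at hκ
    linarith [mul_nonneg hε.le hγ0.le]
  have hs1 : s ≤ 0.05 := by
    rw [kappa1] at hκs
    have : 1 ≤ 62 * γmax * (1 + β) := by nlinarith [mul_nonneg hγ0.le hβ0]
    nlinarith [hε.le.trans hεs]
  -- At each fixed time the iterate is almost surely bounded, since it starts at a deterministic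
  -- vector. This bound serves only integrability.
  have hgrow : ∀ k, ∀ᵐ ω ∂μ, ‖Θ k ω‖ ≤ (1 + ε) ^ k * (‖θ₀‖ + β) := fun k => by
    filter_upwards [hall] with ω hω
    have := norm_add_le_pow (θ := fun k => Θ k ω) (M := fun k => A (X k ω)) (c := fun k => b (X k ω))
      hε.le (fun k => h2.norm_A_le _ (hω k)) (fun k => hble _ (hω k)) (fun k => hΘ k ω) 0 k
    simp only [zero_add, h0] at this
    linarith
  have hsub : ∀ k, ∀ᵐ ω ∂μ, ‖Θ (k + τ) ω - Θ k ω‖ ≤ 4 / 3 * s * (‖Θ k ω‖ + β) := fun k => by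
    filter_upwards [hall] with ω hω
    exact norm_sub_le_of_mul_le (θ := fun k => Θ k ω) (M := fun k => A (X k ω))
      (c := fun k => b (X k ω)) hε.le (fun k => h2.norm_A_le _ (hω k)) (fun k => hble _ (hω k))
      (fun k => hΘ k ω) k hετ
  have hΘm := fun k => stronglyMeasurable_iterate (X := X) hA hb h0 hΘ k
  have hΘm' : ∀ k, StronglyMeasurable (Θ k) := fun k => (hΘm k).mono (hX.past_le k)
  set W : ℕ → Ω → ℝ := fun k ω => inner ℝ (Θ k ω) (app P (Θ k ω)) with hW
  have hWint : ∀ k, Integrable (W k) μ := fun k => by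
    refine Integrable.of_bound ((hΘm' k).inner
      (stronglyMeasurable_app stronglyMeasurable_const (hΘm' k))).aestronglyMeasurable
      (((1 + ε) ^ k * (‖θ₀‖ + β)) * (γmax * ((1 + ε) ^ k * (‖θ₀‖ + β)))) ?_
    filter_upwards [hgrow k] with ω hω
    refine (norm_inner_le_norm _ _).trans (mul_le_mul hω ?_ (norm_nonneg _) (by positivity))
    exact (norm_app_le_of_isGreatest hP.1 hγmax _).trans (by gcongr)
  have hsqint : ∀ k, Integrable (fun ω => ‖Θ k ω‖ ^ 2) μ := fun k => by
    refine Integrable.of_bound ((hΘm' k).norm.pow 2).aestronglyMeasurable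
      (((1 + ε) ^ k * (‖θ₀‖ + β)) ^ 2) ?_
    filter_upwards [hgrow k] with ω hω
    rw [Real.norm_of_nonneg (sq_nonneg _)]
    exact pow_le_pow_left₀ (norm_nonneg _) hω 2
  have hstep : ∀ n, ∫ ω, W (n + τ + 1) ω ∂μ ≤
      (1 - 0.9 * ε / γmax) * ∫ ω, W (n + τ) ω ∂μ + ε * (s * kappa2 γmax β) := by
    intro n
    have hQτ := isMarkovKernel_pow Q τ
    set f : (EuclideanSpace ℝ (Fin d) × 𝓧) × 𝓧 → ℝ :=
      fun p => crossTerm P Abar p.1.1 (A p.2) (b p.2) with hf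
    -- The state is carried along with the iterate so that the conditional law of the state τ steps
    -- later is a function of H.
    set H : Ω → EuclideanSpace ℝ (Fin d) × 𝓧 := fun ω => (Θ n ω, X n ω) with hH
    have hHm : Measurable[past X n] H := (hΘm n).measurable.prodMk (measurable_past le_rfl)
    have hfm : StronglyMeasurable f :=
      stronglyMeasurable_crossTerm (hA.comp_measurable measurable_snd)
        (measurable_fst.comp measurable_fst).stronglyMeasurable (hb.comp_measurable measurable_snd)
    have hgb : ∀ᵐ ω ∂μ, ∀ M v, ‖M - Abar‖ ≤ 2 → ‖v‖ ≤ β → ‖crossTerm P Abar (Θ n ω) M v‖ ≤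
        γmax * (((1 + ε) ^ n * (‖θ₀‖ + β)) * (2 * ((1 + ε) ^ n * (‖θ₀‖ + β)) + β)) := by
      filter_upwards [hgrow n] with ω hω M v hM hv
      exact (abs_crossTerm_le hP.1 hγmax hM hv hγ0.le).trans (by gcongr)
    have hA2 : ∀ x ∈ 𝒮, ‖A x - Abar‖ ≤ 2 := fun x hx =>
      (norm_sub_le _ _).trans (by linarith [h2.norm_A_le x hx])
    have hgint : Integrable (fun ω => f (H ω, X (n + τ) ω)) μ := by
      refine Integrable.of_bound (hfm.comp_measurable
        ((hHm.mono (hX.past_le n) le_rfl).prodMk (hX.measurable _))).aestronglyMeasurable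
        (γmax * (((1 + ε) ^ n * (‖θ₀‖ + β)) * (2 * ((1 + ε) ^ n * (‖θ₀‖ + β)) + β))) ?_
      filter_upwards [hgb, hall] with ω hω hω'
      exact hω _ _ (hA2 _ (hω' _)) (hble _ (hω' _))
    set h : Ω → ℝ := fun ω => ∫ y, f (H ω, y) ∂((Q ^ τ) (X n ω)) with hh
    have hheq : ∀ᵐ ω ∂μ, h ω = crossTerm P Abar (Θ n ω) (∫ y, A y ∂((Q ^ τ) (X n ω)))
        (∫ y, b y ∂((Q ^ τ) (X n ω))) := by
      filter_upwards [hall] with ω hω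
      exact integral_crossTerm (h1.integrable_A_cond _ (hω n) τ) (h1.integrable_b_cond _ (hω n) τ) _
    have hhle : ∀ᵐ ω ∂μ, |h ω| ≤ γmax * (ε * (‖Θ n ω‖ ^ 2 + ‖Θ n ω‖)) := by
      filter_upwards [hheq, hall] with ω hω hω'
      obtain ⟨hb', hA'⟩ := hτ.2 _ (hω' n) τ le_rfl
      rw [norm_sub_rev] at hA'
      rw [hω]
      refine (abs_crossTerm_le hP.1 hγmax hA' hb' hγ0.le).trans (le_of_eq ?_)
      ring
    have hhint : Integrable h μ := by
      refine Integrable.of_bound ((hfm.integral_kernel_prod_right'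
        (κ := (Q ^ τ).comap Prod.snd measurable_snd)).comp_measurable
        (hHm.mono (hX.past_le n) le_rfl)).aestronglyMeasurable
        (γmax * (ε * (((1 + ε) ^ n * (‖θ₀‖ + β)) ^ 2 + (1 + ε) ^ n * (‖θ₀‖ + β)))) ?_
      filter_upwards [hhle, hgrow n] with ω hω hω'
      exact hω.trans (by gcongr)
    have hcond : ∫ ω, f (H ω, X (n + τ) ω) ∂μ = ∫ ω, h ω ∂μ :=
      hX.integral_eq hHm measurable_snd (fun _ => rfl) τ hfm hgint
    -- The added term h - f has mean zero, because h is the conditional mean of f. Keeping it makes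
    -- the drift inequality hold pathwise, and integration removes it.
    have hpt : ∀ᵐ ω ∂μ, W (n + τ + 1) ω + 2 * ε * (h ω - f (H ω, X (n + τ) ω)) ≤
        (1 - 0.9 * ε / γmax) * W (n + τ) ω + ε * (s * kappa2 γmax β) := by
      filter_upwards [hall, hhle, hsub n] with ω hω hω' hω''
      have hd := drift_step_le (A := A (X (n + τ) ω)) hP hγmax hγ0 (h2.norm_A_le _ (hω _)) hAbar
        (hble _ (hω (n + τ))) hε.le hεs hετ hω'' hκs
      rw [← hΘ] at hd
      refine le_trans ?_ hd
      have h3 := le_of_abs_le hω'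
      simp only [hW, hf, hH]
      gcongr
    have hi := integral_mono_ae ((hWint _).add ((hhint.sub hgint).const_mul (2 * ε)))
      (((hWint (n + τ)).const_mul _).add (integrable_const _)) hpt
    simp only [Pi.add_apply, Pi.sub_apply] at hi
    rw [integral_add (g := fun ω => 2 * ε * (h ω - f (H ω, X (n + τ) ω))) (hWint _)
      ((hhint.sub hgint).const_mul (2 * ε)), integral_const_mul] at hi
    rw [integral_sub hhint hgint, hcond, sub_self, mul_zero, add_zero,
      integral_add ((hWint (n + τ)).const_mul _) (integrable_const _), integral_const_mul] at hi
    simpa using hi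
  set c : ℝ := 1 - 0.9 * ε / γmax with hc
  have hc0 : 0 ≤ c := by
    rw [hc, sub_nonneg, div_le_one hγ0]
    linarith
  -- The fixed point of the affine recursion x ↦ cx + ε s κ₂.
  set D : ℝ := s * kappa2 γmax β * γmax / 0.9 with hD
  have hDc : ε * (s * kappa2 γmax β) = (1 - c) * D := by
    rw [hc, hD]; field_simp; ring
  have hiter : ∀ j, ∫ ω, W (τ + j) ω ∂μ ≤ c ^ j * ∫ ω, W τ ω ∂μ + D := by
    have hD0 : 0 ≤ D := by
      rw [hD, kappa2]; have := hε.le.trans hεs; positivity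
    intro j
    induction j with
    | zero => simpa using hD0
    | succ j ih =>
      have hj := hstep j
      rw [add_comm j τ, hDc] at hj
      rw [← add_assoc]
      calc _ ≤ c * ∫ ω, W (τ + j) ω ∂μ + (1 - c) * D := hj
        _ ≤ c * (c ^ j * ∫ ω, W τ ω ∂μ + D) + (1 - c) * D := by gcongr
        _ = _ := by ring
  -- During the first τ steps only the displacement bound is used: it gives (4/3)‖θ₀‖ + β/3, rounded
  -- up to 1.5 and 0.5.
  have hWτ : ∫ ω, W τ ω ∂μ ≤ γmax * (1.5 * ‖θ₀‖ + 0.5 * β) ^ 2 := by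
    have hae : ∀ᵐ ω ∂μ, W τ ω ≤ γmax * (1.5 * ‖θ₀‖ + 0.5 * β) ^ 2 := by
      filter_upwards [hsub 0] with ω hω
      rw [zero_add, h0] at hω
      have hn : ‖Θ τ ω‖ ≤ 1.5 * ‖θ₀‖ + 0.5 * β := by
        have e1 : ‖Θ τ ω‖ ≤ ‖θ₀‖ + ‖Θ τ ω - θ₀‖ := by
          have := norm_add_le θ₀ (Θ τ ω - θ₀)
          rwa [add_sub_cancel] at this
        have e2 : 4 / 3 * s * (‖θ₀‖ + β) ≤ 4 / 3 * (1 / 4) * (‖θ₀‖ + β) := by gcongr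
        linarith [norm_nonneg θ₀]
      exact (inner_app_self_le hP.1 hγmax _).trans (by gcongr)
    have := integral_mono_ae (hWint τ) (integrable_const _) hae
    simpa using this
  intro k hk
  refine ⟨hsqint k, ?_⟩
  obtain ⟨j, rfl⟩ := Nat.exists_eq_add_of_le hk
  have hlow : γmin * ∫ ω, ‖Θ (τ + j) ω‖ ^ 2 ∂μ ≤ ∫ ω, W (τ + j) ω ∂μ := by
    rw [← integral_const_mul]
    exact integral_mono ((hsqint _).const_mul _) (hWint _) fun ω =>
      inner_app_self_ge hP.1.isHermitian hγmin _
  have hκ2 : kappa2 γmax β ≤ kappa2Tilde γmax β := by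
    have : 0 ≤ kappa2 γmax β := by rw [kappa2]; positivity
    rw [kappa2Tilde]
    nlinarith [mul_nonneg hγ0.le (sq_nonneg β)]
  have hmain : γmin * ∫ ω, ‖Θ (τ + j) ω‖ ^ 2 ∂μ ≤
      c ^ j * (γmax * (1.5 * ‖θ₀‖ + 0.5 * β) ^ 2) + s * kappa2Tilde γmax β * γmax / 0.9 := by
    refine hlow.trans ((hiter j).trans (add_le_add (by gcongr) ?_))
    have := hε.le.trans hεs
    rw [hD]; gcongr
  rw [Nat.add_sub_cancel_left]
  rw [← le_div_iff₀' hγmin0] at hmain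
  refine hmain.trans (le_of_eq ?_)
  rw [hs]
  field_simp

end FiniteTime

end TDLearning

namespace TDLearning

/-! ### The chains that drive temporal-difference learning -/

section RewardPast

variable {Ω S : Type*} [MeasurableSpace S] {Z : ℕ → Ω → S} {C : ℕ → Ω → ℝ}

theorem measurable_mk_reward (i j : S) : Measurable fun c : ℝ => (i, c, j) :=
  measurable_const.prodMk (measurable_id.prodMk measurable_const)

/-- The past of the reward process before the reward at time `n` is received. -/
abbrev rewardPast (Z : ℕ → Ω → S) (C : ℕ → Ω → ℝ) (n : ℕ) : MeasurableSpace Ω :=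
  (⨆ i ∈ Set.Iic n, MeasurableSpace.comap (Z i) inferInstance) ⊔
    (⨆ i ∈ Set.Iio n, MeasurableSpace.comap (C i) inferInstance)

/-- The past of the reward process, including the reward at time `n`. -/
abbrev rewardPast' (Z : ℕ → Ω → S) (C : ℕ → Ω → ℝ) (n : ℕ) : MeasurableSpace Ω :=
  (⨆ i ∈ Set.Iic n, MeasurableSpace.comap (Z i) inferInstance) ⊔
    (⨆ i ∈ Set.Iic n, MeasurableSpace.comap (C i) inferInstance)

theorem rewardPast_le (Z : ℕ → Ω → S) (C : ℕ → Ω → ℝ) (n : ℕ) :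
    rewardPast Z C n ≤ rewardPast' Z C n :=
  sup_le_sup_left (biSup_mono fun _ hi => Set.mem_Iic.2 (Set.mem_Iio.1 hi).le) _

theorem measurable_state_rewardPast (Z : ℕ → Ω → S) (C : ℕ → Ω → ℝ) {k n : ℕ} (h : k ≤ n) :
    Measurable[rewardPast Z C n] (Z k) := by
  rw [measurable_iff_comap_le]
  exact (le_biSup (fun i => MeasurableSpace.comap (Z i) inferInstance) (Set.mem_Iic.2 h)).trans
    le_sup_left

theorem measurable_reward_rewardPast (Z : ℕ → Ω → S) (C : ℕ → Ω → ℝ) {k n : ℕ} (h : k < n) :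
    Measurable[rewardPast Z C n] (C k) := by
  rw [measurable_iff_comap_le]
  exact (le_biSup (fun i => MeasurableSpace.comap (C i) inferInstance) (Set.mem_Iio.2 h)).trans
    le_sup_right

theorem measurable_reward_rewardPast' (Z : ℕ → Ω → S) (C : ℕ → Ω → ℝ) (n : ℕ) :
    Measurable[rewardPast' Z C n] (C n) := by
  rw [measurable_iff_comap_le]
  exact (le_biSup (fun i => MeasurableSpace.comap (C i) inferInstance) (Set.mem_Iic.2 le_rfl)).trans
    le_sup_right

/-- At time n the driving state already reveals Z_{n+1}, but not C_{n+1}. This is why the past of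
states runs one index further than that of rewards. -/
theorem past_td0Chain_le (Z : ℕ → Ω → S) (C : ℕ → Ω → ℝ) (n : ℕ) :
    past (td0Chain Z C) n ≤ rewardPast Z C (n + 1) := by
  refine iSup₂_le fun k hk => ?_
  rw [Set.mem_Iic] at hk
  rw [← measurable_iff_comap_le]
  exact (measurable_state_rewardPast Z C (by omega)).prodMk
    ((measurable_reward_rewardPast Z C (by omega)).prodMk
      (measurable_state_rewardPast Z C (by omega)))

theorem measurable_td0Chain [MeasurableSpace Ω] (hZ : ∀ n, Measurable (Z n)) (hC : ∀ n, Measurable (C n))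
    (k : ℕ) :
    Measurable (td0Chain Z C k) :=
  (hZ k).prodMk ((hC k).prodMk (hZ (k + 1)))

end RewardPast

section Kernels

variable {S : Type*} [Fintype S] [MeasurableSpace S] [MeasurableSingletonClass S]
  {Γ : Matrix S S ℝ} {ν : Kernel S ℝ} {d : ℕ} {φ : S → EuclideanSpace ℝ (Fin d)} {α l : ℝ}

theorem stateKernel_apply (Γ : Matrix S S ℝ) (i : S) :
    stateKernel Γ i = ∑ j, ENNReal.ofReal (Γ i j) • Measure.dirac j := rfl

theorem isMarkovKernel_stateKernel [DecidableEq S] (hΓ : Γ ∈ Matrix.rowStochastic ℝ S) :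
    IsMarkovKernel (stateKernel Γ) := ⟨fun i => ⟨by
  rw [stateKernel_apply, Measure.finsetSum_apply]
  simp only [Measure.smul_apply, measure_univ, smul_eq_mul, mul_one]
  rw [← ENNReal.ofReal_sum_of_nonneg fun j _ => hΓ.1 i j, Matrix.sum_row_of_mem_rowStochastic hΓ,
    ENNReal.ofReal_one]⟩⟩

theorem isMarkovKernel_td0Kernel [DecidableEq S] [IsMarkovKernel ν]
    (hΓ : Γ ∈ Matrix.rowStochastic ℝ S) : IsMarkovKernel (td0Kernel Γ ν) := by
  have := isMarkovKernel_stateKernel hΓ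
  unfold td0Kernel
  infer_instance

theorem isMarkovKernel_tdlKernel [DecidableEq S] [IsMarkovKernel ν]
    (hΓ : Γ ∈ Matrix.rowStochastic ℝ S) : IsMarkovKernel (tdlKernel Γ ν φ α l) := by
  have := isMarkovKernel_td0Kernel (ν := ν) hΓ
  unfold tdlKernel
  infer_instance

/-- One step of the TD(0) chain: the next state `j` has probability `Γ i j`, and independently the
reward has law `ν i`. -/
theorem td0Kernel_eq_sum [IsMarkovKernel ν] [IsMarkovKernel (stateKernel Γ)] (x : S × ℝ × S) :
    td0Kernel Γ ν x =
      ∑ j, ENNReal.ofReal (Γ x.2.2 j) • (ν x.2.2).map fun c => (x.2.2, c, j) := by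
  rw [td0Kernel, Kernel.comap_apply, Kernel.prod_apply, Kernel.prod_apply, Kernel.id_apply,
    Measure.dirac_prod]
  ext B hB
  have hB' : MeasurableSet (Prod.mk x.2.2 ⁻¹' B) := measurable_prodMk_left hB
  rw [Measure.map_apply measurable_prodMk_left hB, Measure.prod_apply hB', Measure.finsetSum_apply]
  simp only [stateKernel_apply, Measure.finsetSum_apply, Measure.smul_apply, smul_eq_mul]
  have hsec : ∀ j, MeasurableSet ((fun c : ℝ => (x.2.2, c, j)) ⁻¹' B) := fun j =>
    measurable_mk_reward _ _ hB
  have hd : ∀ (c : ℝ) (j : S), Measure.dirac j (Prod.mk c ⁻¹' (Prod.mk x.2.2 ⁻¹' B)) =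
      ((fun c : ℝ => (x.2.2, c, j)) ⁻¹' B).indicator 1 c := fun c j => by
    rw [Measure.dirac_apply' _ (measurable_prodMk_left hB')]
    rfl
  simp only [hd]
  rw [lintegral_finsetSum _ fun j _ => (measurable_one.indicator (hsec j)).const_mul _]
  refine Finset.sum_congr rfl fun j _ => ?_
  rw [lintegral_const_mul _ (measurable_one.indicator (hsec j)), lintegral_indicator_one (hsec j),
    Measure.map_apply (measurable_mk_reward _ _) hB]

theorem tdlKernel_apply_eq_map [IsMarkovKernel (td0Kernel Γ ν)]
    (x : (S × ℝ × S) × EuclideanSpace ℝ (Fin d)) :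
    tdlKernel Γ ν φ α l x =
      (td0Kernel Γ ν x.1).map fun y => (y, (α * l) • x.2 + φ x.1.2.2) := by
  rw [tdlKernel, Kernel.prod_apply, Kernel.comap_apply, Kernel.deterministic_apply,
    Measure.prod_dirac]

theorem integral_td0Kernel [IsMarkovKernel ν] [IsMarkovKernel (stateKernel Γ)]
    (hΓ : ∀ i j, 0 ≤ Γ i j) {x : S × ℝ × S} {F : S × ℝ × S → ℝ} (hF : Measurable F)
    (hint : Integrable F (td0Kernel Γ ν x)) :
    ∫ y, F y ∂(td0Kernel Γ ν x) = ∑ j, Γ x.2.2 j * ∫ c, F (x.2.2, c, j) ∂(ν x.2.2) := by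
  rw [td0Kernel_eq_sum] at hint ⊢
  rw [integral_finsetSum_measure fun j hj => (integrable_finsetSum_measure.1 hint) j hj]
  refine Finset.sum_congr rfl fun j _ => ?_
  rw [integral_smul_measure, ENNReal.toReal_ofReal (hΓ _ _), smul_eq_mul,
    integral_map (measurable_mk_reward _ _).aemeasurable hF.aestronglyMeasurable]

theorem measurable_eligibilityTrace {Ω : Type*} {m : MeasurableSpace Ω} {Z : ℕ → Ω → S} {n : ℕ}
    (hZ : ∀ k ≤ n, Measurable (Z k)) :
    ∀ k ≤ n, Measurable fun ω => eligibilityTrace φ α l (fun n => Z n ω) k := by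
  intro k
  induction k with
  | zero => exact fun hk => (measurable_of_finite φ).comp (hZ 0 hk)
  | succ k ih =>
    intro hk
    have h := (measurable_of_finite φ).comp (hZ (k + 1) hk)
    exact ((ih (Nat.le_of_succ_le hk)).const_smul (α * l)).add h

theorem past_tdlChain_le {Ω : Type*} (Z : ℕ → Ω → S) (C : ℕ → Ω → ℝ) (n : ℕ) :
    past (tdlChain φ α l Z C) n ≤ rewardPast Z C (n + 1) := by
  refine iSup₂_le fun k hk => ?_
  rw [← measurable_iff_comap_le]
  refine Measurable.prodMk ((measurable_past (X := td0Chain Z C) hk).mono (past_td0Chain_le Z C n)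
    le_rfl) ?_
  exact measurable_eligibilityTrace
    (fun i hi => measurable_state_rewardPast Z C (show i ≤ n + 1 by omega)) k hk

/-! #### The Markov property -/

variable {Ω : Type*} [MeasurableSpace Ω] {μ : Measure Ω} {Z : ℕ → Ω → S} {C : ℕ → Ω → ℝ}

theorem IsMarkovRewardProcess.rewardPast_le (h : IsMarkovRewardProcess μ Γ ν Z C) (n : ℕ) :
    rewardPast Z C n ≤ ‹MeasurableSpace Ω› :=
  sup_le (iSup₂_le fun i _ => (h.measurable_Z i).comap_le)
    (iSup₂_le fun i _ => (h.measurable_C i).comap_le)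

theorem measure_eq_sum_fiber {g : Ω → S} (hg : Measurable g) (E : Set Ω) :
    μ E = ∑ j, μ (E ∩ g ⁻¹' {j}) := by
  have h := sum_measure_preimage_singleton (μ := μ.restrict E) (Finset.univ : Finset S) (f := g)
    fun j _ => hg (measurableSet_singleton j)
  rw [Finset.coe_univ, Set.preimage_univ, Measure.restrict_apply_univ] at h
  rw [← h]
  refine Finset.sum_congr rfl fun j _ => ?_
  rw [Measure.restrict_apply (hg (measurableSet_singleton j)), Set.inter_comm]

theorem setLIntegral_comp_eq_sum {g : Ω → S} (hg : Measurable g) (E : Set Ω) (u : S → ENNReal) :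
    ∫⁻ ω in E, u (g ω) ∂μ = ∑ i, u i * μ (E ∩ g ⁻¹' {i}) := by
  rw [← lintegral_map (measurable_of_finite u) hg, lintegral_fintype]
  refine Finset.sum_congr rfl fun i _ => ?_
  rw [Measure.map_apply hg (measurableSet_singleton i),
    Measure.restrict_apply (hg (measurableSet_singleton i)), Set.inter_comm]

theorem setLIntegral_fiber {g : Ω → S} (hg : Measurable g) (E : Set Ω) (u : S → ENNReal) (i : S) :
    ∫⁻ ω in E ∩ g ⁻¹' {i}, u (g ω) ∂μ = u i * μ (E ∩ g ⁻¹' {i}) := by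
  classical
  rw [setLIntegral_comp_eq_sum hg, Finset.sum_eq_single i]
  · rw [Set.inter_assoc, Set.inter_self]
  · intro j _ hj
    have : E ∩ g ⁻¹' {i} ∩ g ⁻¹' {j} = ∅ := by
      ext ω
      simp only [Set.mem_inter_iff, Set.mem_preimage, Set.mem_singleton_iff, Set.mem_empty_iff_false,
        iff_false, not_and]
      rintro ⟨-, h⟩ h'
      exact hj (h' ▸ h)
    rw [this, measure_empty, mul_zero]
  · simp

/-- The law of the next transition, given the past. -/
theorem IsMarkovRewardProcess.measure_inter_td0Chain [IsMarkovKernel ν]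
    [IsMarkovKernel (stateKernel Γ)] (h : IsMarkovRewardProcess μ Γ ν Z C) (n : ℕ) {F : Set Ω}
    (hF : MeasurableSet[rewardPast Z C (n + 1)] F) {B : Set (S × ℝ × S)} (hB : MeasurableSet B) :
    μ (F ∩ td0Chain Z C (n + 1) ⁻¹' B) = ∫⁻ ω in F, td0Kernel Γ ν (td0Chain Z C n ω) B ∂μ := by
  set u : S → ENNReal := fun i =>
    ∑ j, ENNReal.ofReal (Γ i j) * ν i ((fun c : ℝ => (i, c, j)) ⁻¹' B) with hu
  have hker : ∀ ω, td0Kernel Γ ν (td0Chain Z C n ω) B = u (Z (n + 1) ω) := fun ω => by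
    rw [td0Kernel_eq_sum, Measure.finsetSum_apply]
    refine Finset.sum_congr rfl fun j _ => ?_
    rw [Measure.smul_apply, smul_eq_mul, Measure.map_apply (measurable_mk_reward _ _) hB]
    rfl
  simp only [hker]
  rw [setLIntegral_comp_eq_sum (h.measurable_Z (n + 1)),
    measure_eq_sum_fiber (h.measurable_Z (n + 1))]
  refine Finset.sum_congr rfl fun i _ => ?_
  rw [measure_eq_sum_fiber (h.measurable_Z (n + 2)), hu, Finset.sum_mul]
  refine Finset.sum_congr rfl fun j _ => ?_
  set Bij : Set ℝ := (fun c : ℝ => (i, c, j)) ⁻¹' B with hBij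
  have hBm : MeasurableSet Bij := measurable_mk_reward i j hB
  have hset : F ∩ td0Chain Z C (n + 1) ⁻¹' B ∩ Z (n + 1) ⁻¹' {i} ∩ Z (n + 2) ⁻¹' {j} =
      (F ∩ C (n + 1) ⁻¹' Bij) ∩ Z (n + 1) ⁻¹' {i} ∩ Z (n + 1 + 1) ⁻¹' {j} := by
    ext ω
    simp only [Set.mem_inter_iff, Set.mem_preimage, Set.mem_singleton_iff, td0Chain, hBij]
    constructor
    · rintro ⟨⟨⟨h1, h2⟩, h3⟩, h4⟩
      subst h3 h4
      exact ⟨⟨⟨h1, h2⟩, rfl⟩, rfl⟩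
    · rintro ⟨⟨⟨h1, h2⟩, h3⟩, h4⟩
      subst h3 h4
      exact ⟨⟨⟨h1, h2⟩, rfl⟩, rfl⟩
  have hFi : MeasurableSet[rewardPast Z C (n + 1)] (F ∩ Z (n + 1) ⁻¹' {i}) :=
    hF.inter (measurable_state_rewardPast Z C le_rfl (measurableSet_singleton i))
  have hFC : MeasurableSet[rewardPast' Z C (n + 1)] ((F ∩ C (n + 1) ⁻¹' Bij) ∩ Z (n + 1) ⁻¹' {i}) := by
    rw [Set.inter_right_comm]
    exact (TDLearning.rewardPast_le Z C _ _ hFi).inter (measurable_reward_rewardPast' Z C _ hBm)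
  -- On the slice Z_{n+1} = i, Z_{n+2} = j, the transition law is used first, with the reward in the
  -- past, and then the reward law. The two constants multiply to the kernel's weight.
  rw [hset, h.transition (n + 1) _ hFC j, setLIntegral_fiber (h.measurable_Z (n + 1)) _
    (fun i => ENNReal.ofReal (Γ i j)), Set.inter_right_comm, h.reward (n + 1) _ hFi Bij hBm,
    setLIntegral_fiber (h.measurable_Z (n + 1)) F (fun i => ν i Bij), mul_assoc]

theorem IsMarkovRewardProcess.isMarkovChain_td0 [IsMarkovKernel ν] [IsMarkovKernel (stateKernel Γ)]
    (h : IsMarkovRewardProcess μ Γ ν Z C) : IsMarkovChain μ (td0Chain Z C) (td0Kernel Γ ν) where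
  measurable := measurable_td0Chain h.measurable_Z h.measurable_C
  markov n _ hF _ hB := h.measure_inter_td0Chain n (past_td0Chain_le Z C n _ hF) hB

/-- The next trace is a function of the present state. On a rectangle, the condition on the trace
therefore moves into the past event, and the law of the next transition does the rest. -/
theorem IsMarkovRewardProcess.isMarkovChain_tdl [IsFiniteMeasure μ] [IsMarkovKernel ν]
    [IsMarkovKernel (stateKernel Γ)] [IsMarkovKernel (td0Kernel Γ ν)]
    [IsMarkovKernel (tdlKernel Γ ν φ α l)] (h : IsMarkovRewardProcess μ Γ ν Z C) :
    IsMarkovChain μ (tdlChain φ α l Z C) (tdlKernel Γ ν φ α l) := by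
  have hmeas : ∀ n, Measurable (tdlChain φ α l Z C n) := fun n =>
    (measurable_td0Chain h.measurable_Z h.measurable_C n).prodMk
      (measurable_eligibilityTrace (fun k _ => h.measurable_Z k) n le_rfl)
  refine ⟨hmeas, fun n F hF B hB => ?_⟩
  have hFm : MeasurableSet F := h.rewardPast_le _ _ (past_tdlChain_le Z C n _ hF)
  set ψ : Ω → EuclideanSpace ℝ (Fin d) := fun ω =>
    (α * l) • (tdlChain φ α l Z C n ω).2 + φ (tdlChain φ α l Z C n ω).1.2.2 with hψ
  have hψm : Measurable[rewardPast Z C (n + 1)] ψ := by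
    have hm : Measurable[rewardPast Z C (n + 1)] (tdlChain φ α l Z C n) :=
      (measurable_past le_rfl).mono (past_tdlChain_le Z C n) le_rfl
    exact ((measurable_snd.comp hm).const_smul (α * l)).add ((measurable_of_finite φ).comp
      (measurable_snd.comp (measurable_snd.comp (measurable_fst.comp hm))))
  have hmap : (μ.restrict F).map (tdlChain φ α l Z C (n + 1)) =
      (tdlKernel Γ ν φ α l) ∘ₘ (μ.restrict F).map (tdlChain φ α l Z C n) := by
    refine Measure.ext_prod fun {s t} hs ht => ?_
    have hψt : MeasurableSet (ψ ⁻¹' t) := h.rewardPast_le _ _ (hψm ht)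
    rw [Measure.map_apply (hmeas _) (hs.prod ht), Measure.restrict_apply (hmeas _ (hs.prod ht)),
      Measure.bind_apply (hs.prod ht) (Kernel.aemeasurable _),
      lintegral_map (Kernel.measurable_coe _ (hs.prod ht)) (hmeas _)]
    have hset : tdlChain φ α l Z C (n + 1) ⁻¹' s ×ˢ t ∩ F =
        (F ∩ ψ ⁻¹' t) ∩ td0Chain Z C (n + 1) ⁻¹' s := by
      ext ω
      simp only [Set.mem_inter_iff, Set.mem_preimage, Set.mem_prod, hψ, tdlChain, td0Chain,
        eligibilityTrace]
      tauto
    have hker : ∀ ω, tdlKernel Γ ν φ α l (tdlChain φ α l Z C n ω) (s ×ˢ t) =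
        (ψ ⁻¹' t).indicator (fun ω => td0Kernel Γ ν (td0Chain Z C n ω) s) ω := fun ω => by
      rw [tdlKernel_apply_eq_map, Measure.map_apply measurable_prodMk_right (hs.prod ht)]
      by_cases hω : ψ ω ∈ t
      · rw [Set.indicator_of_mem (show ω ∈ ψ ⁻¹' t from hω)]
        congr 1
        ext y
        simp only [Set.mem_preimage, Set.mem_prod]
        exact and_iff_left hω
      · rw [Set.indicator_of_notMem (show ω ∉ ψ ⁻¹' t from hω)]
        have hempty : (fun y => (y, ψ ω)) ⁻¹' s ×ˢ t = ∅ := by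
          ext y
          simp only [Set.mem_preimage, Set.mem_prod, Set.mem_empty_iff_false, iff_false, not_and]
          exact fun _ => hω
        change td0Kernel Γ ν _ ((fun y => (y, ψ ω)) ⁻¹' s ×ˢ t) = 0
        rw [hempty, measure_empty]
    simp only [hker]
    rw [hset, h.measure_inter_td0Chain n
      ((past_tdlChain_le Z C n _ hF).inter (hψm ht)) hs, lintegral_indicator hψt,
      Measure.restrict_restrict hψt, Set.inter_comm]
  have hB' := congrArg (fun m : Measure _ => m B) hmap
  rw [Measure.map_apply (hmeas _) hB, Measure.restrict_apply (hmeas _ hB),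
    Measure.bind_apply hB (Kernel.aemeasurable _),
    lintegral_map (Kernel.measurable_coe _ hB) (hmeas _), Set.inter_comm] at hB'
  exact hB'

end Kernels

end TDLearning

namespace TDLearning

/-! ### Bounds on rewards, features and traces -/

section Bounds

variable {S : Type*} {d : ℕ}

/-- The set |c| ≤ c_max is closed and has full measure, so it contains the support. The almost sure
bound thus holds at every point of the state space. -/
theorem abs_le_of_mem_support [MeasurableSpace S] {ν : Kernel S ℝ} {cmax : ℝ}
    (hν : ∀ i, ∀ᵐ c ∂(ν i), |c| ≤ cmax) {i : S} {c : ℝ}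
    (hc : c ∈ (ν i).support) : |c| ≤ cmax :=
  Measure.support_subset_of_isClosed (isClosed_le continuous_abs continuous_const) (hν i) hc

theorem norm_le_phiMax [Finite S] (φ : S → EuclideanSpace ℝ (Fin d)) (i : S) : ‖φ i‖ ≤ phiMax φ :=
  le_ciSup (f := fun i => ‖φ i‖) (Set.finite_range _).bddAbove i

theorem phiMax_nonneg (φ : S → EuclideanSpace ℝ (Fin d)) : 0 ≤ phiMax φ :=
  Real.iSup_nonneg fun _ => norm_nonneg _

theorem integrable_state [Finite S] [MeasurableSpace S] [MeasurableSingletonClass S]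
    {κ : Measure (S × ℝ × S)} [IsFiniteMeasure κ] (f : S → ℝ) :
    Integrable (fun y : S × ℝ × S => f y.2.2) κ :=
  Integrable.comp_measurable (f := fun y : S × ℝ × S => y.2.2) (g := f) Integrable.of_finite
    (measurable_snd.comp measurable_snd)

theorem measurable_trace_apply [MeasurableSpace S] (a : Fin d) :
    Measurable fun y : (S × ℝ × S) × EuclideanSpace ℝ (Fin d) => y.2 a :=
  (EuclideanSpace.proj (𝕜 := ℝ) a).measurable.comp measurable_snd

theorem abs_apply_le_norm (v : EuclideanSpace ℝ (Fin d)) (a : Fin d) : |v a| ≤ ‖v‖ :=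
  PiLp.norm_apply_le v a

theorem abs_trace_mul_le [MeasurableSpace S] {Γ : Matrix S S ℝ} {ν : Kernel S ℝ}
    {φ : S → EuclideanSpace ℝ (Fin d)} {α l : ℝ} {g : S × ℝ × S → ℝ} {G : ℝ}
    (hG : ∀ y ∈ td0States Γ ν, |g y| ≤ G) (a : Fin d) : ∀ y ∈ tdlStates Γ ν φ α l, |y.2 a * g y.1| ≤ phiMax φ / (1 - α * l) * G := by
  intro y hy
  rw [abs_mul]
  exact mul_le_mul ((abs_apply_le_norm _ a).trans hy.2) (hG _ hy.1) (abs_nonneg _)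
    ((norm_nonneg _).trans hy.2)

/-- The ball of possible traces is stable under the trace recursion. -/
theorem norm_trace_step_le [Finite S] {φ : S → EuclideanSpace ℝ (Fin d)} {α l : ℝ}
    (h0 : 0 ≤ α * l) (h1 : α * l < 1) {e : EuclideanSpace ℝ (Fin d)}
    (he : ‖e‖ ≤ phiMax φ / (1 - α * l)) (i : S) :
    ‖(α * l) • e + φ i‖ ≤ phiMax φ / (1 - α * l) := by
  have hpos : 0 < 1 - α * l := by linarith
  refine (norm_add_le _ _).trans ?_
  rw [norm_smul, Real.norm_of_nonneg h0]
  calc α * l * ‖e‖ + ‖φ i‖ ≤ α * l * (phiMax φ / (1 - α * l)) + phiMax φ := by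
        gcongr; exact norm_le_phiMax φ i
    _ = phiMax φ / (1 - α * l) := by field_simp; ring

theorem norm_eligibilityTrace_le [Finite S] {φ : S → EuclideanSpace ℝ (Fin d)} {α l : ℝ}
    (h0 : 0 ≤ α * l) (h1 : α * l < 1) (z : ℕ → S) (k : ℕ) :
    ‖eligibilityTrace φ α l z k‖ ≤ phiMax φ / (1 - α * l) := by
  induction k with
  | zero =>
    refine (norm_le_phiMax φ _).trans ?_
    rw [le_div_iff₀ (by linarith)]
    nlinarith [mul_nonneg (phiMax_nonneg φ) h0]
  | succ k ih => exact norm_trace_step_le h0 h1 ih _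

end Bounds

/-! ### Measurability and invariance of the state spaces -/

section StateSpace

variable {S : Type*} [Fintype S] [MeasurableSpace S] [MeasurableSingletonClass S]
  {Γ : Matrix S S ℝ} {ν : Kernel S ℝ} {d : ℕ} {φ : S → EuclideanSpace ℝ (Fin d)} {α l : ℝ}

theorem measurableSet_td0States : MeasurableSet (td0States Γ ν) := by
  have h : td0States Γ ν = ⋃ p : S × S,
      ((fun x : S × ℝ × S => x.1) ⁻¹' {p.1} ∩ (fun x : S × ℝ × S => x.2.2) ⁻¹' {p.2}) ∩
        ((fun x : S × ℝ × S => x.2.1) ⁻¹' (ν p.1).support ∩ {_x | 0 < Γ p.1 p.2}) := by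
    ext x
    simp only [td0States, Set.mem_ofPred_eq, Set.mem_iUnion, Set.mem_inter_iff, Set.mem_preimage,
      Set.mem_singleton_iff]
    constructor
    · exact fun hx => ⟨(x.1, x.2.2), ⟨rfl, rfl⟩, hx⟩
    · rintro ⟨p, ⟨h1, h2⟩, h3⟩
      rw [h1, h2]
      exact h3
  rw [h]
  refine MeasurableSet.iUnion fun p => ?_
  refine ((measurable_fst (measurableSet_singleton _)).inter
    ((measurable_snd.comp measurable_snd) (measurableSet_singleton _))).inter
    (((measurable_fst.comp measurable_snd) Measure.isClosed_support.measurableSet).inter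
      (MeasurableSet.const _))

theorem measurableSet_tdlStates : MeasurableSet (tdlStates Γ ν φ α l) :=
  (measurable_fst measurableSet_td0States).inter
    (measurableSet_le measurable_snd.norm measurable_const)

theorem ae_mem_td0States [IsMarkovKernel ν] [IsMarkovKernel (stateKernel Γ)] (x : S × ℝ × S) :
    ∀ᵐ y ∂(td0Kernel Γ ν x), y ∈ td0States Γ ν := by
  rw [ae_iff, td0Kernel_eq_sum, Measure.finsetSum_apply]
  refine Finset.sum_eq_zero fun j _ => ?_
  rw [Measure.smul_apply, smul_eq_mul]
  rcases le_or_gt (Γ x.2.2 j) 0 with h | h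
  · rw [ENNReal.ofReal_of_nonpos h, zero_mul]
  · have hm : MeasurableSet {y | ¬y ∈ td0States Γ ν} := measurableSet_td0States.compl
    rw [Measure.map_apply (measurable_mk_reward _ _) hm]
    have : (fun c : ℝ => (x.2.2, c, j)) ⁻¹' {y | ¬y ∈ td0States Γ ν} = (ν x.2.2).supportᶜ := by
      ext c
      simp only [td0States, Set.mem_preimage, Set.mem_ofPred_eq, Set.mem_compl_iff, h, and_true]
    rw [this, Measure.measure_compl_support, mul_zero]

theorem ae_mem_tdlStates [IsMarkovKernel ν] [IsMarkovKernel (stateKernel Γ)]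
    [IsMarkovKernel (td0Kernel Γ ν)] (h0 : 0 ≤ α * l) (h1 : α * l < 1)
    {x : (S × ℝ × S) × EuclideanSpace ℝ (Fin d)} (hx : x ∈ tdlStates Γ ν φ α l) :
    ∀ᵐ y ∂(tdlKernel Γ ν φ α l x), y ∈ tdlStates Γ ν φ α l := by
  rw [tdlKernel_apply_eq_map, ae_map_iff (p := fun y => y ∈ tdlStates Γ ν φ α l)
    measurable_prodMk_right.aemeasurable measurableSet_tdlStates]
  exact (ae_mem_td0States x.1).mono fun y hy => ⟨hy, norm_trace_step_le h0 h1 hx.2 _⟩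

variable {Ω : Type*} [MeasurableSpace Ω] {μ : Measure Ω} {Z : ℕ → Ω → S} {C : ℕ → Ω → ℝ}

/-- Time 0 is included, where no kernel step precedes; so the claim is derived directly from the
reward and transition laws. -/
theorem IsMarkovRewardProcess.ae_mem_td0States [IsMarkovKernel ν]
    (h : IsMarkovRewardProcess μ Γ ν Z C) (k : ℕ) :
    ∀ᵐ ω ∂μ, td0Chain Z C k ω ∈ td0States Γ ν := by
  have hreward : ∀ᵐ ω ∂μ, ∀ i, Z k ω = i → C k ω ∈ (ν i).support := by
    refine ae_all_iff.2 fun i => ?_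
    have h1 := h.reward k (Z k ⁻¹' {i})
      (measurable_state_rewardPast Z C le_rfl (measurableSet_singleton i)) _
      (Measure.isClosed_support (μ := ν i)).measurableSet.compl
    have h2 := setLIntegral_fiber (μ := μ) (h.measurable_Z k) Set.univ
      (fun j => ν j (ν i).supportᶜ) i
    rw [Set.univ_inter] at h2
    rw [h2, Measure.measure_compl_support, zero_mul] at h1
    refine measure_mono_null (fun ω hω => ?_) h1
    simp only [Set.mem_compl_iff, Set.mem_ofPred_eq, Classical.not_imp] at hω
    exact ⟨hω.1, hω.2⟩
  have htrans : ∀ᵐ ω ∂μ, ∀ i j, Z k ω = i → Z (k + 1) ω = j → 0 < Γ i j := by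
    refine ae_all_iff.2 fun i => ae_all_iff.2 fun j => ?_
    rcases lt_or_ge 0 (Γ i j) with hpos | hle
    · exact Eventually.of_forall fun _ _ _ => hpos
    have h1 := h.transition k (Z k ⁻¹' {i})
      (TDLearning.rewardPast_le Z C k _
        (measurable_state_rewardPast Z C le_rfl (measurableSet_singleton i))) j
    have h2 := setLIntegral_fiber (μ := μ) (h.measurable_Z k) Set.univ
      (fun i => ENNReal.ofReal (Γ i j)) i
    rw [Set.univ_inter] at h2
    rw [h2, ENNReal.ofReal_of_nonpos hle, zero_mul] at h1
    refine measure_mono_null (fun ω hω => ?_) h1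
    simp only [Set.mem_compl_iff, Set.mem_ofPred_eq, Classical.not_imp] at hω
    exact ⟨hω.1, hω.2.1⟩
  filter_upwards [hreward, htrans] with ω h1 h2
  exact ⟨h1 _ rfl, h2 _ _ rfl rfl⟩

theorem IsMarkovRewardProcess.ae_mem_tdlStates [IsMarkovKernel ν]
    (h : IsMarkovRewardProcess μ Γ ν Z C) (h0 : 0 ≤ α * l) (h1 : α * l < 1) (k : ℕ) :
    ∀ᵐ ω ∂μ, tdlChain φ α l Z C k ω ∈ tdlStates Γ ν φ α l :=
  (h.ae_mem_td0States k).mono fun _ hω => ⟨hω, norm_eligibilityTrace_le h0 h1 _ _⟩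

end StateSpace

/-! ### Conditional means along the chains -/

section TracePart

variable {S : Type*} [Fintype S] [DecidableEq S] {Γ : Matrix S S ℝ} {π : S → ℝ}

/-- The part of the conditional mean of `φ_k g(X_k)` that is due to the features visited after
time `0`. -/
noncomputable def tracePart (Γ : Matrix S S ℝ) (r : ℝ) (f g : S → ℝ) : ℕ → S → ℝ
  | 0 => f * g
  | k + 1 => Γ *ᵥ tracePart Γ r f g k + f * (Γ *ᵥ (r ^ (k + 1) • (Γ ^ k *ᵥ g)))

/-- Here w is the discounted sum of the (rΓ)^j g. Adding to the trace part the missing tail u of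
that series for the first feature gives q with q₀ = fw and q_{k+1} = Γq_k + (u_k - Γu_k). Each
increment has π-mean zero, so the mean of q is conserved. The increments also have size O(r^k) and
are contracted by later powers of Γ, which leaves a convolution of r^k with ρ^k; the gap r < ρ keeps
it O(ρ^k). -/
theorem exists_tracePart_geometric (hΓ : Γ ∈ Matrix.rowStochastic ℝ S)
    (hπ : IsStationaryDistribution Γ π) {C ρ r : ℝ} (hC : 0 ≤ C) (hr : 0 ≤ r) (hrρ : r < ρ)
    (hρ1 : ρ < 1)
    (hgeo : ∀ (f : S → ℝ) (M : ℝ), (∀ i, |f i| ≤ M) →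
      ∀ (k : ℕ) (i : S), |(Γ ^ k *ᵥ f) i - π ⬝ᵥ f| ≤ C * ρ ^ k * M)
    (f g w : S → ℝ) (hw : w = g + r • (Γ *ᵥ w)) :
    ∃ K, ∀ k i, |tracePart Γ r f g k i - π ⬝ᵥ (f * w)| ≤ K * ρ ^ k := by
  have hρ0 : 0 < ρ := hr.trans_lt hrρ
  set v : ℕ → S → ℝ := fun k => r ^ (k + 1) • (Γ ^ k *ᵥ w) with hv
  set u : ℕ → S → ℝ := fun k => f * (Γ *ᵥ v k) with hu
  set q : ℕ → S → ℝ := fun k => tracePart Γ r f g k + u k with hq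
  have hg : g = w - r • (Γ *ᵥ w) := eq_sub_of_add_eq hw.symm
  have hvg : ∀ k, r ^ (k + 1) • (Γ ^ k *ᵥ g) = v k - v (k + 1) := fun k => by
    rw [hg, hv]
    simp only [Matrix.mulVec_sub, Matrix.mulVec_smul, smul_sub, Matrix.mulVec_mulVec, ← pow_succ,
      smul_smul]
  have hq0 : q 0 = f * w := by
    have : Γ *ᵥ v 0 = r • (Γ *ᵥ w) := by simp [hv, Matrix.mulVec_smul]
    simp only [hq, hu, tracePart, this]
    rw [← mul_add]
    exact congrArg (f * ·) hw.symm
  have hqs : ∀ k, q (k + 1) = Γ *ᵥ q k + (u k - Γ *ᵥ u k) := fun k => by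
    simp only [hq, tracePart, hvg, Matrix.mulVec_add, Matrix.mulVec_sub, hu, mul_sub]
    abel
  set U : ℝ := ‖f‖ * ‖w‖ with hU
  have hU0 : 0 ≤ U := by positivity
  have hub : ∀ k i, |u k i| ≤ U * r ^ k := fun k i => by
    have h1 : |(Γ *ᵥ (Γ ^ k *ᵥ w)) i| ≤ ‖w‖ := by
      rw [Matrix.mulVec_mulVec, ← pow_succ']
      exact abs_mulVec_le (pow_mem hΓ _) (fun j => norm_le_pi_norm w j) i
    have h2 : r ^ (k + 1) ≤ r ^ k := pow_le_pow_of_le_one hr (hrρ.trans hρ1).le (Nat.le_succ k)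
    simp only [hu, hv, Pi.mul_apply, Matrix.mulVec_smul, Pi.smul_apply, smul_eq_mul, abs_mul,
      abs_of_nonneg (pow_nonneg hr (k + 1))]
    calc |f i| * (r ^ (k + 1) * |(Γ *ᵥ (Γ ^ k *ᵥ w)) i|) ≤ ‖f‖ * (r ^ k * ‖w‖) := by
          gcongr
          exact norm_le_pi_norm f i
      _ = U * r ^ k := by rw [hU]; ring
  -- Chosen so that L(ρ^k - r^k)ρ + 2Ur^k = L(ρ^{k+1} - r^{k+1}), which closes the induction
  -- exactly.
  set L : ℝ := 2 * U / (ρ - r) with hL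
  have hLρ : L * (ρ - r) = 2 * U := div_mul_cancel₀ _ (sub_pos.2 hrρ).ne'
  have hL0 : 0 ≤ L := div_nonneg (by positivity) (sub_pos.2 hrρ).le
  -- All powers n are needed in the induction: unfolding q by one step moves a factor Γ into the
  -- power.
  have key : ∀ k n i, |(Γ ^ n *ᵥ q k) i - π ⬝ᵥ (f * w)| ≤
      C * ρ ^ n * (‖f * w‖ * ρ ^ k + L * (ρ ^ k - r ^ k)) := by
    intro k
    induction k with
    | zero =>
      intro n i
      rw [hq0]
      simpa using hgeo (f * w) ‖f * w‖ (fun j => norm_le_pi_norm (f * w) j) n i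
    | succ k ih =>
      intro n i
      have h1 := ih (n + 1) i
      have hmean : π ⬝ᵥ (u k - Γ *ᵥ u k) = 0 := by
        rw [dotProduct_sub, hπ.dotProduct_mulVec, sub_self]
      have h2 := hgeo (u k - Γ *ᵥ u k) (2 * (U * r ^ k)) (fun j => by
        have e1 := hub k j
        have e2 := abs_mulVec_le hΓ (hub k) j
        rw [Pi.sub_apply]
        exact (abs_sub _ _).trans (by linarith)) n i
      rw [hmean, sub_zero] at h2
      have h3 : (Γ ^ n *ᵥ q (k + 1)) i = (Γ ^ (n + 1) *ᵥ q k) i + (Γ ^ n *ᵥ (u k - Γ *ᵥ u k)) i := by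
        rw [hqs, Matrix.mulVec_add, Pi.add_apply, Matrix.mulVec_mulVec, ← pow_succ]
      rw [h3, add_sub_right_comm]
      refine (abs_add_le _ _).trans ((add_le_add h1 h2).trans (le_of_eq ?_))
      have : 2 * (U * r ^ k) = L * (ρ - r) * r ^ k := by rw [hLρ]; ring
      rw [this]
      ring
  refine ⟨C * (‖f * w‖ + L) + U, fun k i => ?_⟩
  have h1 := key k 0 i
  have h2 := hub k i
  have hrk : r ^ k ≤ ρ ^ k := pow_le_pow_left₀ hr hrρ.le k
  have h3 : tracePart Γ r f g k i - π ⬝ᵥ (f * w) =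
      ((Γ ^ 0 *ᵥ q k) i - π ⬝ᵥ (f * w)) - u k i := by
    simp only [pow_zero, Matrix.one_mulVec, hq, Pi.add_apply]
    ring
  rw [h3]
  refine (abs_sub _ _).trans ((add_le_add h1 h2).trans ?_)
  have h4 : L * (ρ ^ k - r ^ k) ≤ L * ρ ^ k :=
    mul_le_mul_of_nonneg_left (by linarith [pow_nonneg hr k]) hL0
  have h5 : U * r ^ k ≤ U * ρ ^ k := mul_le_mul_of_nonneg_left hrk hU0
  rw [pow_zero, mul_one]
  calc _ ≤ C * (‖f * w‖ * ρ ^ k + L * ρ ^ k) + U * ρ ^ k := by gcongr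
    _ = _ := by ring

end TracePart

section ConditionalMeans

variable {S : Type*} [Fintype S] [DecidableEq S] [MeasurableSpace S] [MeasurableSingletonClass S]
  {Γ : Matrix S S ℝ} {ν : Kernel S ℝ} {d : ℕ} {φ : S → EuclideanSpace ℝ (Fin d)} {α l : ℝ}

/-- The mean of `g(Z_k, C_k, Z_{k+1})` given `Z_k = i`. -/
noncomputable def transitionMean (Γ : Matrix S S ℝ) (ν : Kernel S ℝ) (g : S × ℝ × S → ℝ) (i : S) : ℝ :=
  ∑ j, Γ i j * ∫ c, g (i, c, j) ∂(ν i)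

/-- The start x already contains the next state, so k + 1 steps of the chain amount to k steps of Γ
from there and one averaged transition. -/
theorem integral_td0Kernel_pow [IsMarkovKernel ν] (hΓ : Γ ∈ Matrix.rowStochastic ℝ S)
    {g : S × ℝ × S → ℝ} (hg : Measurable g) {G : ℝ} (hG : ∀ y ∈ td0States Γ ν, |g y| ≤ G) (k : ℕ) :
    ∀ x ∈ td0States Γ ν, ∫ y, g y ∂((td0Kernel Γ ν ^ (k + 1)) x) =
      (Γ ^ k *ᵥ transitionMean Γ ν g) x.2.2 := by
  have := isMarkovKernel_stateKernel hΓ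
  have := isMarkovKernel_td0Kernel (ν := ν) hΓ
  have hint : ∀ (k : ℕ), ∀ x ∈ td0States Γ ν, Integrable g ((td0Kernel Γ ν ^ k) x) := fun k x hx => by
    have := isMarkovKernel_pow (td0Kernel Γ ν) k
    exact Integrable.of_bound hg.aestronglyMeasurable G
      ((ae_mem_pow measurableSet_td0States (fun x _ => ae_mem_td0States x) k x hx).mono hG)
  induction k with
  | zero =>
    intro x hx
    have h1 := hint 1 x hx
    rw [pow_one] at h1
    rw [zero_add, pow_one, integral_td0Kernel hΓ.1 hg h1, pow_zero, Matrix.one_mulVec]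
    rfl
  | succ k ih =>
    intro x hx
    rw [integral_pow_succ (hint _ x hx), integral_congr_ae ((ae_mem_td0States x).mono ih),
      integral_td0Kernel (F := fun y => (Γ ^ k *ᵥ transitionMean Γ ν g) y.2.2) hΓ.1
        ((measurable_of_finite (Γ ^ k *ᵥ transitionMean Γ ν g)).comp
          (measurable_snd.comp measurable_snd)) (integrable_state _)]
    simp only [integral_const, probReal_univ, one_smul]
    rw [pow_succ', ← Matrix.mulVec_mulVec]
    rfl

theorem integral_tdlKernel [IsMarkovKernel ν] (hΓ : Γ ∈ Matrix.rowStochastic ℝ S)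
    {F : (S × ℝ × S) × EuclideanSpace ℝ (Fin d) → ℝ} (hF : Measurable F)
    {x : (S × ℝ × S) × EuclideanSpace ℝ (Fin d)} (hint : Integrable F (tdlKernel Γ ν φ α l x)) :
    ∫ y, F y ∂(tdlKernel Γ ν φ α l x) = ∑ j, Γ x.1.2.2 j *
      ∫ c, F ((x.1.2.2, c, j), (α * l) • x.2 + φ x.1.2.2) ∂(ν x.1.2.2) := by
  have := isMarkovKernel_stateKernel hΓ
  have := isMarkovKernel_td0Kernel (ν := ν) hΓ
  rw [tdlKernel_apply_eq_map] at hint ⊢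
  rw [integral_map measurable_prodMk_right.aemeasurable hF.aestronglyMeasurable,
    integral_td0Kernel (F := fun y => F (y, (α * l) • x.2 + φ x.1.2.2)) hΓ.1
      (hF.comp measurable_prodMk_right)
      ((integrable_map_measure hF.aestronglyMeasurable measurable_prodMk_right.aemeasurable).1 hint)]

/-- The mean is affine in the initial trace: the first summand is what survives of that trace, the
second comes from the features added since. One kernel step e ↦ αλe + φ preserves this form and
reproduces the recursion of `tracePart`. -/
theorem integral_tdlKernel_pow [IsMarkovKernel ν] (hΓ : Γ ∈ Matrix.rowStochastic ℝ S)
    (h0 : 0 ≤ α * l) (h1 : α * l < 1)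
    {g : S × ℝ × S → ℝ} (hg : Measurable g) {G : ℝ} (hG : ∀ y ∈ td0States Γ ν, |g y| ≤ G)
    (a : Fin d) (k : ℕ) :
    ∀ x ∈ tdlStates Γ ν φ α l, ∫ y, y.2 a * g y.1 ∂((tdlKernel Γ ν φ α l ^ (k + 1)) x) =
      x.2 a * ((α * l) ^ (k + 1) • (Γ ^ k *ᵥ transitionMean Γ ν g)) x.1.2.2 +
        tracePart Γ (α * l) (fun i => φ i a) (transitionMean Γ ν g) k x.1.2.2 := by
  have := isMarkovKernel_stateKernel hΓ
  have := isMarkovKernel_td0Kernel (ν := ν) hΓ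
  have := isMarkovKernel_tdlKernel (ν := ν) (φ := φ) (α := α) (l := l) hΓ
  set F : (S × ℝ × S) × EuclideanSpace ℝ (Fin d) → ℝ := fun y => y.2 a * g y.1 with hF
  have hFm : Measurable F := (measurable_trace_apply a).mul (hg.comp measurable_fst)
  have hQ := fun x hx => ae_mem_tdlStates (Γ := Γ) (ν := ν) (φ := φ) h0 h1 (x := x) hx
  have hint : ∀ (k : ℕ), ∀ x ∈ tdlStates Γ ν φ α l,
      Integrable F ((tdlKernel Γ ν φ α l ^ k) x) := fun k x hx => by
    have := isMarkovKernel_pow (tdlKernel Γ ν φ α l) k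
    exact Integrable.of_bound hFm.aestronglyMeasurable _
      ((ae_mem_pow measurableSet_tdlStates hQ k x hx).mono (abs_trace_mul_le hG a))
  induction k with
  | zero =>
    intro x hx
    have h1 := hint 1 x hx
    rw [pow_one] at h1
    rw [zero_add, pow_one, integral_tdlKernel hΓ hFm h1, pow_zero, Matrix.one_mulVec]
    simp only [hF, integral_const_mul, PiLp.add_apply, PiLp.smul_apply, smul_eq_mul, tracePart,
      Pi.smul_apply, Pi.mul_apply, transitionMean, Finset.mul_sum, ← Finset.sum_add_distrib, pow_one]
    exact Finset.sum_congr rfl fun j _ => by ring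
  | succ k ih =>
    intro x hx
    set h := (α * l) ^ (k + 1) • (Γ ^ k *ᵥ transitionMean Γ ν g) with hh
    set p := tracePart Γ (α * l) (fun i => φ i a) (transitionMean Γ ν g) k with hp
    have hm : Measurable fun y : (S × ℝ × S) × EuclideanSpace ℝ (Fin d) =>
        y.2 a * h y.1.2.2 + p y.1.2.2 := by
      have hs : Measurable fun y : (S × ℝ × S) × EuclideanSpace ℝ (Fin d) => y.1.2.2 :=
        measurable_snd.comp (measurable_snd.comp measurable_fst)
      exact ((measurable_trace_apply a).mul ((measurable_of_finite h).comp hs)).add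
        ((measurable_of_finite p).comp hs)
    have hi : Integrable (fun y : (S × ℝ × S) × EuclideanSpace ℝ (Fin d) =>
        y.2 a * h y.1.2.2 + p y.1.2.2) (tdlKernel Γ ν φ α l x) := by
      refine Integrable.of_bound hm.aestronglyMeasurable
        (phiMax φ / (1 - α * l) * ‖h‖ + ‖p‖) ((hQ x hx).mono fun y hy => ?_)
      refine (norm_add_le _ _).trans (add_le_add ?_ (norm_le_pi_norm p _))
      rw [norm_mul]
      exact mul_le_mul ((abs_apply_le_norm _ a).trans hy.2) (norm_le_pi_norm h _) (norm_nonneg _)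
        ((norm_nonneg _).trans hy.2)
    rw [integral_pow_succ (hint _ x hx), integral_congr_ae ((hQ x hx).mono ih),
      integral_tdlKernel hΓ hm hi]
    have hnext : (α * l) ^ (k + 1 + 1) • (Γ ^ (k + 1) *ᵥ transitionMean Γ ν g) =
        (α * l) • (Γ *ᵥ h) := by
      rw [hh, Matrix.mulVec_smul, smul_smul, Matrix.mulVec_mulVec, ← pow_succ', ← pow_succ']
    have hp' : tracePart Γ (α * l) (fun i => φ i a) (transitionMean Γ ν g) (k + 1) =
        Γ *ᵥ p + (fun i => φ i a) * (Γ *ᵥ h) := rfl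
    rw [hnext, hp']
    simp only [integral_const, probReal_univ, PiLp.add_apply, PiLp.smul_apply, smul_eq_mul,
      Pi.smul_apply, Pi.add_apply, Pi.mul_apply, Matrix.mulVec, dotProduct, Finset.mul_sum,
      ← Finset.sum_add_distrib]
    exact Finset.sum_congr rfl fun j _ => by ring

end ConditionalMeans

end TDLearning

namespace TDLearning

/-! ### The limiting matrix is negative definite -/

section Limit

variable {S : Type*} [Fintype S] {d : ℕ} {φ : S → EuclideanSpace ℝ (Fin d)}

theorem featureMatrix_transpose_mulVec_ne_zero (hφ : (featureMatrix φ).rank = d) {x : Fin d → ℝ}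
    (hx : x ≠ 0) : (featureMatrix φ)ᵀ *ᵥ x ≠ 0 := by
  intro h
  have hr : Module.finrank ℝ (LinearMap.range (featureMatrix φ)ᵀ.mulVecLin) = d := by
    have := Matrix.rank_transpose (featureMatrix φ)
    rw [hφ] at this
    exact this
  have h1 := LinearMap.finrank_range_add_finrank_ker (featureMatrix φ)ᵀ.mulVecLin
  rw [hr, Module.finrank_fin_fun, Nat.add_eq_left] at h1
  have h2 : LinearMap.ker (featureMatrix φ)ᵀ.mulVecLin = ⊥ := Submodule.finrank_eq_zero.1 h1
  exact hx (LinearMap.ker_eq_bot'.1 h2 x h)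

variable [DecidableEq S] {Γ : Matrix S S ℝ} {π : S → ℝ} {α l : ℝ}

/-- The form of Abar at x is the π-weighted form of U - I at Φᵀx, and Φᵀ is injective by full rank.
-/
theorem isNegDef_tdlAbar (hΓ : Γ ∈ Matrix.rowStochastic ℝ S) (hπ : IsStationaryDistribution Γ π)
    (hpos : ∀ i, 0 < π i) (hα : α ∈ Set.Ico (0 : ℝ) 1) (hl : l ∈ Set.Icc (0 : ℝ) 1)
    (hφ : (featureMatrix φ).rank = d) : IsNegDef (tdlAbar Γ π φ α l) := by
  intro x hx
  have h := tdlU_sub_one_neg hΓ hπ hpos hα hl (featureMatrix_transpose_mulVec_ne_zero hφ hx)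
  set y := (featureMatrix φ)ᵀ *ᵥ x with hy
  have e : x ⬝ᵥ (tdlAbar Γ π φ α l *ᵥ x) = ∑ i, π i * (y i * ((tdlU Γ α l - 1) *ᵥ y) i) := by
    rw [tdlAbar, ← Matrix.mulVec_mulVec, ← Matrix.mulVec_mulVec, ← Matrix.mulVec_mulVec, ← hy,
      Matrix.dotProduct_mulVec, ← Matrix.mulVec_transpose, ← hy, dotProduct]
    refine Finset.sum_congr rfl fun i _ => ?_
    rw [Matrix.mulVec_diagonal]
    ring
  rw [e]
  exact h

theorem resolvent_zero (hΓ : Γ ∈ Matrix.rowStochastic ℝ S) : resolvent Γ 0 = 1 := by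
  have h := resolvent_eq hΓ le_rfl zero_lt_one
  rwa [zero_smul, add_zero] at h

/-- The algebra of TD(0) is the case λ = 0 of TD(λ). Only the driving chains differ, since that of
TD(0) carries no trace. -/
theorem td0Abar_eq (hΓ : Γ ∈ Matrix.rowStochastic ℝ S) :
    td0Abar Γ π φ α = tdlAbar Γ π φ α 0 := by
  rw [td0Abar, tdlAbar, tdlU_sub_one_eq hΓ (by simp) (by simp), mul_zero, resolvent_zero hΓ, one_mul,
    ← Matrix.mul_neg, neg_sub, Matrix.mul_assoc (featureMatrix φ * _), Matrix.sub_mul,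
    Matrix.one_mul, Matrix.smul_mul]

theorem td0Bbar_eq [MeasurableSpace S] (hΓ : Γ ∈ Matrix.rowStochastic ℝ S) (ν : Kernel S ℝ) :
    td0Bbar π φ ν = tdlBbar Γ π φ ν α 0 := by
  have h : ∑' j : ℕ, ((α * 0) • Γ) ^ j = 1 := by
    rw [mul_zero]; exact resolvent_zero hΓ
  rw [td0Bbar, tdlBbar, h, Matrix.mul_one]

theorem tdlAbar_eq (hΓ : Γ ∈ Matrix.rowStochastic ℝ S) (h0 : 0 ≤ α * l) (h1 : α * l < 1) :
    tdlAbar Γ π φ α l = featureMatrix φ * Matrix.diagonal π * resolvent Γ (α * l) *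
      ((α • Γ - 1) * (featureMatrix φ)ᵀ) := by
  rw [tdlAbar, tdlU_sub_one_eq hΓ h0 h1]
  simp only [Matrix.mul_assoc]

theorem dotProduct_feature_mul (V : Matrix S S ℝ) (u : S → ℝ) (a : Fin d) :
    π ⬝ᵥ ((fun i => φ i a) * (V *ᵥ u)) =
      ((featureMatrix φ * Matrix.diagonal π * V) *ᵥ u) a := by
  rw [← Matrix.mulVec_mulVec, ← Matrix.mulVec_mulVec]
  simp only [dotProduct, Pi.mul_apply]
  rw [Matrix.mulVec, dotProduct]
  refine Finset.sum_congr rfl fun i _ => ?_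
  rw [Matrix.mulVec_diagonal, featureMatrix, Matrix.of_apply]
  ring

end Limit

/-! ### The matrices `A` and the vectors `b` -/

section Coordinates

variable {S : Type*} {d : ℕ} {φ : S → EuclideanSpace ℝ (Fin d)} {α l : ℝ}

theorem app_tdMatrix (v : EuclideanSpace ℝ (Fin d)) (i j : S) (x : EuclideanSpace ℝ (Fin d)) :
    app (tdMatrix φ α v i j) x = -(inner ℝ (φ i - α • φ j) x • v) := by
  refine WithLp.ofLp_injective 2 ?_
  change (-Matrix.vecMulVec v.ofLp (φ i - α • φ j).ofLp) *ᵥ x.ofLp = -(inner ℝ (φ i - α • φ j) x • v.ofLp)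
  rw [Matrix.neg_mulVec, Matrix.vecMulVec_mulVec, real_inner_comm,
    EuclideanSpace.inner_eq_star_dotProduct, op_smul_eq_smul, star_trivial]

theorem norm_tdMatrix_le (v : EuclideanSpace ℝ (Fin d)) (i j : S) :
    ‖tdMatrix φ α v i j‖ ≤ ‖v‖ * ‖φ i - α • φ j‖ := by
  rw [← Matrix.l2_opNorm_toEuclideanCLM]
  refine ContinuousLinearMap.opNorm_le_bound _ (by positivity) fun x => ?_
  change ‖app (tdMatrix φ α v i j) x‖ ≤ _
  rw [app_tdMatrix, norm_neg, norm_smul]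
  calc ‖(inner ℝ (φ i - α • φ j) x : ℝ)‖ * ‖v‖ ≤ (‖φ i - α • φ j‖ * ‖x‖) * ‖v‖ := by
        gcongr; exact norm_inner_le_norm _ _
    _ = _ := by ring

/-- The scalar function with `A(x)_{ab} = e_a tdWeight_b`. -/
def tdWeight (φ : S → EuclideanSpace ℝ (Fin d)) (α : ℝ) (b : Fin d) (y : S × ℝ × S) : ℝ :=
  -(φ y.1 b - α * φ y.2.2 b)

/-- The scalar function with `b(x)_a = e_a tdTarget`. -/
def tdTarget (φ : S → EuclideanSpace ℝ (Fin d)) (α : ℝ) (θs : EuclideanSpace ℝ (Fin d))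
    (y : S × ℝ × S) : ℝ :=
  y.2.1 + ∑ b, θs b * tdWeight φ α b y

theorem tdlA_apply (x : (S × ℝ × S) × EuclideanSpace ℝ (Fin d)) (a b : Fin d) :
    tdlA φ α x a b = x.2 a * tdWeight φ α b x.1 := by
  simp only [tdlA, tdMatrix, tdWeight, Matrix.neg_apply, Matrix.vecMulVec_apply, PiLp.sub_apply,
    PiLp.smul_apply, smul_eq_mul]
  ring

theorem tdlb_apply (θs : EuclideanSpace ℝ (Fin d)) (x : (S × ℝ × S) × EuclideanSpace ℝ (Fin d))
    (a : Fin d) : tdlb φ α θs x a = x.2 a * tdTarget φ α θs x.1 := by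
  have h : app (tdlA φ α x) θs a = ∑ b, tdlA φ α x a b * θs b := rfl
  rw [tdlb, PiLp.add_apply, PiLp.smul_apply, h, tdTarget, smul_eq_mul, mul_add, Finset.mul_sum,
    mul_comm (x.1.2.1)]
  congr 1
  refine Finset.sum_congr rfl fun b _ => ?_
  rw [tdlA_apply]
  ring

theorem td0A_eq (y : S × ℝ × S) : td0A φ α y = tdlA φ α (y, φ y.1) := rfl

theorem td0b_eq (θs : EuclideanSpace ℝ (Fin d)) (y : S × ℝ × S) :
    td0b φ α θs y = tdlb φ α θs (y, φ y.1) := rfl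

/-- The temporal-difference update, centred at `θs`. -/
theorem tdUpdate_sub (ε : ℝ) (θs v θ : EuclideanSpace ℝ (Fin d)) (i j : S) (c : ℝ) :
    tdUpdate φ α ε v i c j θ - θs = (θ - θs) +
      ε • (app (tdMatrix φ α v i j) (θ - θs) + (c • v + app (tdMatrix φ α v i j) θs)) := by
  have h : app (tdMatrix φ α v i j) (θ - θs) + (c • v + app (tdMatrix φ α v i j) θs) =
      c • v + app (tdMatrix φ α v i j) θ := by
    simp only [app, map_sub]; abel
  rw [h, app_tdMatrix, tdUpdate, inner_sub_left, real_inner_smul_left]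
  module

variable [Finite S]

theorem norm_sub_smul_le (hα : 0 ≤ α) (i j : S) : ‖φ i - α • φ j‖ ≤ (1 + α) * phiMax φ := by
  refine (norm_sub_le _ _).trans ?_
  rw [norm_smul, Real.norm_of_nonneg hα]
  nlinarith [norm_le_phiMax φ i, mul_le_mul_of_nonneg_left (norm_le_phiMax φ j) hα]

theorem norm_tdlA_le (hα : 0 ≤ α) (x : (S × ℝ × S) × EuclideanSpace ℝ (Fin d)) :
    ‖tdlA φ α x‖ ≤ ‖x.2‖ * ((1 + α) * phiMax φ) :=
  (norm_tdMatrix_le _ _ _).trans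
    (mul_le_mul_of_nonneg_left (norm_sub_smul_le hα _ _) (norm_nonneg _))

theorem norm_tdlb_le (hα : 0 ≤ α) (θs : EuclideanSpace ℝ (Fin d))
    (x : (S × ℝ × S) × EuclideanSpace ℝ (Fin d)) :
    ‖tdlb φ α θs x‖ ≤ (|x.1.2.1| + (1 + α) * phiMax φ * ‖θs‖) * ‖x.2‖ := by
  refine (norm_add_le _ _).trans ?_
  rw [norm_smul, Real.norm_eq_abs]
  have := (norm_app_le (tdlA φ α x) θs).trans
    (mul_le_mul_of_nonneg_right (norm_tdlA_le hα x) (norm_nonneg θs))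
  linarith

theorem abs_tdWeight_le (hα : 0 ≤ α) (b : Fin d) (y : S × ℝ × S) :
    |tdWeight φ α b y| ≤ (1 + α) * phiMax φ := by
  rw [tdWeight, abs_neg]
  exact (abs_apply_le_norm (φ y.1 - α • φ y.2.2) b).trans (norm_sub_smul_le hα _ _)

theorem abs_tdTarget_le (hα : 0 ≤ α) (θs : EuclideanSpace ℝ (Fin d)) {cmax : ℝ} {y : S × ℝ × S}
    (hy : |y.2.1| ≤ cmax) :
    |tdTarget φ α θs y| ≤ cmax + ∑ b, |θs b| * ((1 + α) * phiMax φ) := by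
  refine (abs_add_le _ _).trans (add_le_add hy ((Finset.abs_sum_le_sum_abs _ _).trans ?_))
  refine Finset.sum_le_sum fun b _ => ?_
  rw [abs_mul]
  exact mul_le_mul_of_nonneg_left (abs_tdWeight_le hα b y) (abs_nonneg _)

variable [MeasurableSpace S] [MeasurableSingletonClass S]

theorem measurable_tdWeight (b : Fin d) : Measurable (tdWeight φ α b) := by
  have h : Measurable fun i => φ i b := measurable_of_finite _
  exact ((h.comp measurable_fst).sub
    ((h.comp (measurable_snd.comp measurable_snd)).const_mul α)).neg

theorem measurable_tdTarget (θs : EuclideanSpace ℝ (Fin d)) : Measurable (tdTarget φ α θs) :=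
  (measurable_fst.comp measurable_snd).add
    (Finset.measurable_fun_sum _ fun b _ => (measurable_tdWeight b).const_mul _)

theorem stronglyMeasurable_tdlA : StronglyMeasurable (tdlA φ α) := by
  -- Expansion in matrix units reduces the claim to measurability of scalar entries.
  have h : tdlA φ α = fun x => ∑ a, ∑ b, tdlA φ α x a b • Matrix.single a b (1 : ℝ) := by
    ext1 x
    conv_lhs => rw [Matrix.matrix_eq_sum_single (tdlA φ α x)]
    simp
  rw [h]
  refine Finset.stronglyMeasurable_fun_sum _ fun a _ => Finset.stronglyMeasurable_fun_sum _ fun b _ => ?_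
  have hm : Measurable fun x : (S × ℝ × S) × EuclideanSpace ℝ (Fin d) => tdlA φ α x a b := by
    simp only [tdlA_apply]
    exact (measurable_trace_apply a).mul ((measurable_tdWeight b).comp measurable_fst)
  exact hm.stronglyMeasurable.smul_const _

theorem stronglyMeasurable_tdlb (θs : EuclideanSpace ℝ (Fin d)) :
    StronglyMeasurable (tdlb φ α θs) := by
  refine StronglyMeasurable.add ?_ (stronglyMeasurable_app stronglyMeasurable_tdlA
    stronglyMeasurable_const)
  exact ((measurable_fst.comp (measurable_snd.comp measurable_fst)).smul
    measurable_snd).stronglyMeasurable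

theorem measurable_pair_feature : Measurable fun y : S × ℝ × S => (y, φ y.1) :=
  measurable_id.prodMk ((measurable_of_finite φ).comp measurable_fst)

theorem stronglyMeasurable_td0A : StronglyMeasurable (td0A φ α) :=
  stronglyMeasurable_tdlA.comp_measurable measurable_pair_feature

theorem stronglyMeasurable_td0b (θs : EuclideanSpace ℝ (Fin d)) :
    StronglyMeasurable (td0b φ α θs) :=
  (stronglyMeasurable_tdlb θs).comp_measurable measurable_pair_feature

end Coordinates

end TDLearning

namespace TDLearning

/-! ### From coordinates to norms -/

section Coordinatewise

/-- Finitely many coordinate functionals with reconstructing vectors e turn scalar estimates into a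
norm estimate. The constant is uniform in the index i, which will range over pairs (initial state,
time). -/
theorem exists_norm_integral_sub_le {E 𝓧 ι κ : Type*} [NormedAddCommGroup E] [NormedSpace ℝ E]
    [CompleteSpace E] [MeasurableSpace 𝓧] [Fintype κ] (L : κ → E →L[ℝ] ℝ) (e : κ → E)
    (he : ∀ v, v = ∑ j, L j v • e j) {m : ι → Measure 𝓧} {f : 𝓧 → E}
    (hf : ∀ i, Integrable f (m i)) {c : E} {r : ι → ℝ}
    (h : ∀ j, ∃ K, ∀ i, |∫ y, L j (f y) ∂(m i) - L j c| ≤ K * r i) :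
    ∃ K, ∀ i, ‖∫ y, f y ∂(m i) - c‖ ≤ K * r i := by
  choose K hK using h
  refine ⟨∑ j, K j * ‖e j‖, fun i => ?_⟩
  conv_lhs => rw [he (∫ y, f y ∂(m i) - c)]
  rw [Finset.sum_mul]
  refine (norm_sum_le _ _).trans (Finset.sum_le_sum fun j _ => ?_)
  rw [norm_smul, map_sub, ← (L j).integral_comp_comm (hf i), Real.norm_eq_abs]
  calc _ ≤ K j * r i * ‖e j‖ := by gcongr; exact hK j i
    _ = _ := by ring

variable {Ω 𝓧 : Type*} [MeasurableSpace Ω] [MeasurableSpace 𝓧] {d : ℕ} {μ : Measure Ω}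
  {X : ℕ → Ω → 𝓧} {Q : Kernel 𝓧 𝓧} {𝒮 : Set 𝓧} {A : 𝓧 → Matrix (Fin d) (Fin d) ℝ}
  {b : 𝓧 → EuclideanSpace ℝ (Fin d)} {Abar : Matrix (Fin d) (Fin d) ℝ}

theorem assumption1_of_coordinates [IsProbabilityMeasure μ] [IsMarkovKernel Q]
    (hX : IsMarkovChain μ X Q) (hmem : ∀ k, ∀ᵐ ω ∂μ, X k ω ∈ 𝒮) (h𝒮 : MeasurableSet 𝒮)
    (hQ : ∀ x ∈ 𝒮, ∀ᵐ y ∂(Q x), y ∈ 𝒮) (hA : StronglyMeasurable A) (hb : StronglyMeasurable b)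
    {a β : ℝ} (hAle : ∀ x ∈ 𝒮, ‖A x‖ ≤ a) (hble : ∀ x ∈ 𝒮, ‖b x‖ ≤ β)
    {ρ : ℝ} (hρ0 : 0 < ρ) (hρ1 : ρ < 1)
    (hAgeo : ∀ i j, ∃ K, ∀ x ∈ 𝒮, ∀ k,
      |∫ y, A y i j ∂((Q ^ (k + 1)) x) - Abar i j| ≤ K * ρ ^ k)
    (hbgeo : ∀ i, ∃ K, ∀ x ∈ 𝒮, ∀ k, |∫ y, b y i ∂((Q ^ (k + 1)) x)| ≤ K * ρ ^ k) :
    Assumption1 μ X Q 𝒮 A b Abar := by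
  have hQk := fun k => isMarkovKernel_pow Q k
  have hae := fun (p : 𝒮 × ℕ) => ae_mem_pow h𝒮 hQ (p.2 + 1) p.1 p.1.2
  obtain ⟨K₁, hK₁⟩ := exists_norm_integral_sub_le (ι := 𝒮 × ℕ) (κ := Fin d × Fin d)
    (fun p => (Matrix.entryLinearMap ℝ ℝ p.1 p.2).toContinuousLinearMap)
    (fun p => Matrix.single p.1 p.2 (1 : ℝ))
    (fun M => by
      conv_lhs => rw [Matrix.matrix_eq_sum_single M]
      rw [Fintype.sum_prod_type]
      simp)
    (m := fun p => (Q ^ (p.2 + 1)) p.1) (f := A) (c := Abar) (r := fun p => ρ ^ p.2)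
    (fun p => by
      have := hQk (p.2 + 1)
      exact Integrable.of_bound hA.aestronglyMeasurable a ((hae p).mono fun y hy => hAle _ hy))
    (fun p => (hAgeo p.1 p.2).imp fun K hK q => hK q.1 q.1.2 q.2)
  obtain ⟨K₂, hK₂⟩ := exists_norm_integral_sub_le (ι := 𝒮 × ℕ) (κ := Fin d)
    (fun i => EuclideanSpace.proj (𝕜 := ℝ) i) (fun i => EuclideanSpace.single i (1 : ℝ))
    (fun v => by
      ext i
      simp [Pi.single_apply])
    (m := fun p => (Q ^ (p.2 + 1)) p.1) (f := b) (c := 0) (r := fun p => ρ ^ p.2)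
    (fun p => by
      have := hQk (p.2 + 1)
      exact Integrable.of_bound hb.aestronglyMeasurable β ((hae p).mono fun y hy => hble _ hy))
    (fun i => (hbgeo i).imp fun K hK q => by
      rw [map_zero, sub_zero]
      exact hK q.1 q.1.2 q.2)
  -- The coordinate estimates bound the mean after k + 1 steps by ρ^k; dividing the constant by ρ
  -- realigns the exponent.
  have hshift : ∀ K : ℝ, K ≤ max K₁ K₂ → ∀ k : ℕ,
      K * ρ ^ k ≤ max K₁ K₂ / ρ * ρ ^ (k + 1) := fun K hK k => by
    rw [pow_succ', ← mul_assoc, div_mul_cancel₀ _ hρ0.ne']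
    gcongr
  refine assumption1_of_geometric hX hmem h𝒮 hQ hA hb hAle hble hρ0 hρ1
    (C := max K₁ K₂ / ρ) (fun x hx k hk => ?_) (fun x hx k hk => ?_)
  · obtain ⟨k, rfl⟩ := Nat.exists_eq_add_of_le' hk
    exact (hK₁ (⟨x, hx⟩, k)).trans (hshift _ (le_max_left _ _) k)
  · obtain ⟨k, rfl⟩ := Nat.exists_eq_add_of_le' hk
    have := hK₂ (⟨x, hx⟩, k)
    rw [sub_zero] at this
    exact this.trans (hshift _ (le_max_right _ _) k)

end Coordinatewise

/-! ### Mean drift of one transition -/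

section TransitionMean

variable {S : Type*} [Fintype S] [DecidableEq S] [MeasurableSpace S]
  {Γ : Matrix S S ℝ} {π : S → ℝ} {ν : Kernel S ℝ} [IsMarkovKernel ν] {d : ℕ}
  {φ : S → EuclideanSpace ℝ (Fin d)} {α l cmax : ℝ}

theorem transitionMean_tdWeight (hΓ : Γ ∈ Matrix.rowStochastic ℝ S) (b : Fin d) :
    transitionMean Γ ν (tdWeight φ α b) =
      fun i => ((α • Γ - 1) * (featureMatrix φ)ᵀ : Matrix S (Fin d) ℝ) i b := by
  ext i
  have h1 := Matrix.sum_row_of_mem_rowStochastic hΓ i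
  simp only [transitionMean, tdWeight, integral_const, probReal_univ, one_smul]
  rw [Matrix.sub_mul, Matrix.one_mul, Matrix.smul_mul, Matrix.sub_apply, Matrix.smul_apply,
    Matrix.mul_apply, smul_eq_mul, Finset.mul_sum]
  simp only [Matrix.transpose_apply, featureMatrix, Matrix.of_apply, mul_sub,
    neg_sub, Finset.sum_sub_distrib, ← Finset.sum_mul, h1, one_mul]
  congr 1
  exact Finset.sum_congr rfl fun j _ => by ring

theorem transitionMean_tdTarget (hΓ : Γ ∈ Matrix.rowStochastic ℝ S)
    (hν : ∀ i, ∀ᵐ c ∂(ν i), |c| ≤ cmax) (θs : EuclideanSpace ℝ (Fin d)) :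
    transitionMean Γ ν (tdTarget φ α θs) =
      meanReward ν + ((α • Γ - 1) * (featureMatrix φ)ᵀ) *ᵥ θs.ofLp := by
  ext i
  have hint : Integrable (fun c : ℝ => c) (ν i) :=
    Integrable.of_bound measurable_id.aestronglyMeasurable cmax (hν i)
  have h1 := Matrix.sum_row_of_mem_rowStochastic hΓ i
  have h2 : ∀ j, ∫ c, tdTarget φ α θs (i, c, j) ∂(ν i) =
      meanReward ν i + ∑ b, θs b * tdWeight φ α b (i, 0, j) := fun j => by
    have : ∀ c, tdTarget φ α θs (i, c, j) = c + ∑ b, θs b * tdWeight φ α b (i, 0, j) :=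
      fun c => rfl
    simp only [this]
    rw [integral_add hint (integrable_const _), integral_const, probReal_univ, one_smul]
    rfl
  have h3 : ∀ b, ((α • Γ - 1) * (featureMatrix φ)ᵀ : Matrix S (Fin d) ℝ) i b =
      ∑ j, Γ i j * tdWeight φ α b (i, 0, j) := fun b => by
    rw [← congrFun (transitionMean_tdWeight (ν := ν) hΓ b) i, transitionMean]
    refine Finset.sum_congr rfl fun j _ => ?_
    have : ∀ c, tdWeight φ α b (i, c, j) = tdWeight φ α b (i, 0, j) := fun c => rfl
    simp only [this, integral_const, probReal_univ, one_smul]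
  simp only [transitionMean, h2, mul_add, Finset.sum_add_distrib, ← Finset.sum_mul, h1, one_mul,
    Pi.add_apply, Matrix.mulVec, dotProduct, h3]
  congr 1
  simp only [Finset.mul_sum, Finset.sum_mul]
  rw [Finset.sum_comm]
  exact Finset.sum_congr rfl fun b _ => Finset.sum_congr rfl fun j _ => by ring

end TransitionMean

/-! ### Geometric convergence of the conditional means -/

section Geometric

variable {S : Type*} [Fintype S] [DecidableEq S] [MeasurableSpace S] [MeasurableSingletonClass S]
  {Γ : Matrix S S ℝ} {π : S → ℝ} {ν : Kernel S ℝ} [IsMarkovKernel ν] {d : ℕ}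
  {φ : S → EuclideanSpace ℝ (Fin d)} {α l : ℝ}

/-- The conditional means of `φ(Z_k) g(X_k)` converge geometrically fast. -/
theorem exists_td0_geometric (hΓ : Γ ∈ Matrix.rowStochastic ℝ S) {C ρ : ℝ}
    (hgeo : ∀ (f : S → ℝ) (M : ℝ), (∀ i, |f i| ≤ M) →
      ∀ (k : ℕ) (i : S), |(Γ ^ k *ᵥ f) i - π ⬝ᵥ f| ≤ C * ρ ^ k * M)
    {g : S × ℝ × S → ℝ} (hg : Measurable g) {G : ℝ} (hG : ∀ y ∈ td0States Γ ν, |g y| ≤ G)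
    (a : Fin d) :
    ∃ K, ∀ x ∈ td0States Γ ν, ∀ k,
      |∫ y, φ y.1 a * g y ∂((td0Kernel Γ ν ^ (k + 1)) x) -
        ((featureMatrix φ * Matrix.diagonal π) *ᵥ transitionMean Γ ν g) a| ≤ K * ρ ^ k := by
  have hm : Measurable fun y : S × ℝ × S => φ y.1 a * g y :=
    ((measurable_of_finite fun i => φ i a).comp measurable_fst).mul hg
  have hbd : ∀ y ∈ td0States Γ ν, |φ y.1 a * g y| ≤ phiMax φ * G := fun y hy => by
    rw [abs_mul]
    exact mul_le_mul ((abs_apply_le_norm _ a).trans (norm_le_phiMax φ _)) (hG y hy) (abs_nonneg _)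
      (phiMax_nonneg φ)
  have htm : transitionMean Γ ν (fun y => φ y.1 a * g y) =
      (fun i => φ i a) * transitionMean Γ ν g := by
    ext i
    simp only [transitionMean, Pi.mul_apply, integral_const_mul, Finset.mul_sum]
    exact Finset.sum_congr rfl fun j _ => by ring
  have hlim := dotProduct_feature_mul (π := π) (φ := φ) 1 (transitionMean Γ ν g) a
  rw [Matrix.one_mulVec, Matrix.mul_one] at hlim
  refine ⟨C * ‖(fun i => φ i a) * transitionMean Γ ν g‖, fun x hx k => ?_⟩
  rw [integral_td0Kernel_pow hΓ hm hbd k x hx, htm, ← hlim]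
  refine (hgeo _ _ (norm_le_pi_norm ((fun i => φ i a) * transitionMean Γ ν g)) k _).trans_eq ?_
  ring

/-- The conditional means of `φ_k g(X_k)` converge geometrically fast. -/
theorem exists_tdl_geometric (hΓ : Γ ∈ Matrix.rowStochastic ℝ S)
    (hπ : IsStationaryDistribution Γ π) {C ρ : ℝ} (hC : 0 ≤ C) (h0 : 0 ≤ α * l)
    (hrρ : α * l < ρ) (hρ1 : ρ < 1)
    (hgeo : ∀ (f : S → ℝ) (M : ℝ), (∀ i, |f i| ≤ M) →
      ∀ (k : ℕ) (i : S), |(Γ ^ k *ᵥ f) i - π ⬝ᵥ f| ≤ C * ρ ^ k * M)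
    {g : S × ℝ × S → ℝ} (hg : Measurable g) {G : ℝ} (hG : ∀ y ∈ td0States Γ ν, |g y| ≤ G)
    (a : Fin d) :
    ∃ K, ∀ x ∈ tdlStates Γ ν φ α l, ∀ k,
      |∫ y, y.2 a * g y.1 ∂((tdlKernel Γ ν φ α l ^ (k + 1)) x) -
        ((featureMatrix φ * Matrix.diagonal π * resolvent Γ (α * l)) *ᵥ
          transitionMean Γ ν g) a| ≤ K * ρ ^ k := by
  have h1 : α * l < 1 := hrρ.trans hρ1
  set u := transitionMean Γ ν g with hu
  -- The resolvent supplies the solution w required by the trace estimate, and so determines the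
  -- limit.
  have hw : resolvent Γ (α * l) *ᵥ u = u + (α * l) • (Γ *ᵥ (resolvent Γ (α * l) *ᵥ u)) := by
    conv_lhs => rw [resolvent_eq hΓ h0 h1]
    rw [Matrix.add_mulVec, Matrix.one_mulVec, Matrix.smul_mulVec, Matrix.mulVec_mulVec]
  obtain ⟨K, hK⟩ := exists_tracePart_geometric hΓ hπ hC h0 hrρ hρ1 hgeo (fun i => φ i a) u _ hw
  rw [dotProduct_feature_mul] at hK
  set B := phiMax φ / (1 - α * l) with hB
  have hB0 : 0 ≤ B := div_nonneg (phiMax_nonneg φ) (by linarith)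
  refine ⟨B * ‖u‖ + K, fun x hx k => ?_⟩
  rw [integral_tdlKernel_pow hΓ h0 h1 hg hG a k x hx, ← hu, add_sub_assoc, add_mul]
  refine (abs_add_le _ _).trans (add_le_add ?_ (hK k _))
  have hpow : ∀ k : ℕ, ∀ i, |(Γ ^ k *ᵥ u) i| ≤ ‖u‖ := fun k =>
    abs_mulVec_le (Submonoid.pow_mem _ hΓ k) fun i => norm_le_pi_norm u i
  -- The initial trace is forgotten at the rate αλ, faster than ρ.
  have hr : (α * l) ^ (k + 1) ≤ ρ ^ k :=
    (pow_le_pow_of_le_one h0 h1.le k.le_succ).trans (pow_le_pow_left₀ h0 hrρ.le k)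
  rw [Pi.smul_apply, smul_eq_mul, abs_mul, abs_mul, abs_of_nonneg (pow_nonneg h0 _)]
  calc |x.2 a| * ((α * l) ^ (k + 1) * |(Γ ^ k *ᵥ u) x.1.2.2|) ≤ B * (ρ ^ k * ‖u‖) :=
        mul_le_mul ((abs_apply_le_norm _ a).trans hx.2)
          (mul_le_mul hr (hpow k _) (abs_nonneg _) (pow_nonneg (h0.trans hrρ.le) _))
          (mul_nonneg (pow_nonneg h0 _) (abs_nonneg _)) hB0
    _ = _ := by ring

end Geometric

end TDLearning

namespace TDLearning

/-! ### Assumptions 1 and 2 for temporal-difference learning -/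

section Bounds

variable {S : Type*} {d : ℕ} {φ : S → EuclideanSpace ℝ (Fin d)}

theorem bMax_le {𝓧 : Type*} {𝒮 : Set 𝓧} {b : 𝓧 → EuclideanSpace ℝ (Fin d)} {β : ℝ} (hβ : 0 ≤ β)
    (h : ∀ x ∈ 𝒮, ‖b x‖ ≤ β) : bMax 𝒮 b ≤ β :=
  Real.sSup_le (Set.forall_mem_image.2 h) hβ

theorem assumption2_of_bound {𝓧 : Type*} {𝒮 : Set 𝓧} {A : 𝓧 → Matrix (Fin d) (Fin d) ℝ}
    {b : 𝓧 → EuclideanSpace ℝ (Fin d)} {β : ℝ} (hA : ∀ x ∈ 𝒮, ‖A x‖ ≤ 1)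
    (h : ∀ x ∈ 𝒮, ‖b x‖ ≤ β) : Assumption2 𝒮 A b :=
  ⟨⟨β, Set.forall_mem_image.2 h⟩, hA⟩

theorem phiMax_sq_le {s : ℝ} (hs : 0 ≤ s) (h : ∀ i, ‖φ i‖ ≤ √s) : phiMax φ * phiMax φ ≤ s := by
  have h1 : phiMax φ ≤ √s := Real.iSup_le h (Real.sqrt_nonneg _)
  calc phiMax φ * phiMax φ ≤ √s * √s :=
        mul_le_mul h1 h1 (phiMax_nonneg φ) (Real.sqrt_nonneg _)
    _ = s := Real.mul_self_sqrt hs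

variable [Finite S] [MeasurableSpace S] {Γ : Matrix S S ℝ} {ν : Kernel S ℝ} {α cmax : ℝ}

theorem norm_tdlb_le_of_mem (hν : ∀ i, ∀ᵐ c ∂(ν i), |c| ≤ cmax) (hα : 0 ≤ α)
    (θs : EuclideanSpace ℝ (Fin d)) {x : (S × ℝ × S) × EuclideanSpace ℝ (Fin d)}
    (hx : x.1 ∈ td0States Γ ν) {B : ℝ} (hB : ‖x.2‖ ≤ B) :
    ‖tdlb φ α θs x‖ ≤ (cmax + (1 + α) * phiMax φ * ‖θs‖) * B := by
  have hc : |x.1.2.1| ≤ cmax := abs_le_of_mem_support hν hx.1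
  have hφ := phiMax_nonneg φ
  refine (norm_tdlb_le hα θs x).trans (mul_le_mul (by gcongr) hB (norm_nonneg _) ?_)
  have := (abs_nonneg _).trans hc
  positivity

end Bounds

section Assumptions

/-- A rate may always be worsened. Raising it strictly above the trace decay r provides the gap that
the convolution estimate needs. -/
theorem exists_geometric_ergodicity_gt {S : Type*} [Fintype S] [DecidableEq S] {Γ : Matrix S S ℝ}
    {π : S → ℝ} (hΓ : Γ ∈ Matrix.rowStochastic ℝ S) (hirr : Γ.IsIrreducible)
    (haper : IsAperiodic Γ) (hπ : IsStationaryDistribution Γ π) {r : ℝ} (h1 : r < 1) :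
    ∃ C ρ : ℝ, 0 ≤ C ∧ 0 < ρ ∧ r < ρ ∧ ρ < 1 ∧ ∀ (f : S → ℝ) (M : ℝ), (∀ i, |f i| ≤ M) →
      ∀ (k : ℕ) (i : S), |(Γ ^ k *ᵥ f) i - π ⬝ᵥ f| ≤ C * ρ ^ k * M := by
  obtain ⟨C, ρ, hC, hρ0, hρ1, h⟩ := exists_geometric_ergodicity hΓ hirr haper hπ
  refine ⟨C, max ρ ((1 + r) / 2), hC, lt_max_of_lt_left hρ0, lt_max_of_lt_right (by linarith),
    max_lt hρ1 (by linarith), fun f M hM k i => (h f M hM k i).trans ?_⟩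
  have hM0 : 0 ≤ M := (abs_nonneg _).trans (hM i)
  gcongr
  exact le_max_left _ _

variable {S : Type*} [Fintype S] [DecidableEq S] [MeasurableSpace S]
  {Γ : Matrix S S ℝ} {π : S → ℝ} {ν : Kernel S ℝ} [IsMarkovKernel ν] {d : ℕ}
  {φ : S → EuclideanSpace ℝ (Fin d)} {α l cmax : ℝ}

/-- At the fixed point `θs`, the limiting mean of `b` vanishes. -/
theorem mulVec_transitionMean_tdTarget (hΓ : Γ ∈ Matrix.rowStochastic ℝ S)
    (hν : ∀ i, ∀ᵐ c ∂(ν i), |c| ≤ cmax) (h0 : 0 ≤ α * l) (h1 : α * l < 1)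
    {θs : EuclideanSpace ℝ (Fin d)}
    (hθs : app (tdlAbar Γ π φ α l) θs + tdlBbar Γ π φ ν α l = 0) :
    (featureMatrix φ * Matrix.diagonal π * resolvent Γ (α * l)) *ᵥ
      transitionMean Γ ν (tdTarget φ α θs) = 0 := by
  rw [transitionMean_tdTarget hΓ hν, Matrix.mulVec_add, Matrix.mulVec_mulVec,
    ← tdlAbar_eq hΓ h0 h1, add_comm]
  exact congrArg WithLp.ofLp hθs

variable [MeasurableSingletonClass S] {Ω : Type*} [MeasurableSpace Ω] {μ : Measure Ω}
  [IsProbabilityMeasure μ] {Z : ℕ → Ω → S} {C : ℕ → Ω → ℝ}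

theorem assumption1_td0 (hΓ : Γ ∈ Matrix.rowStochastic ℝ S) (hirr : Γ.IsIrreducible)
    (haper : IsAperiodic Γ) (hπ : IsStationaryDistribution Γ π)
    (hν : ∀ i, ∀ᵐ c ∂(ν i), |c| ≤ cmax) (hα : α ∈ Set.Ico (0 : ℝ) 1)
    (hZC : IsMarkovRewardProcess μ Γ ν Z C) {θs : EuclideanSpace ℝ (Fin d)}
    (hθs : app (td0Abar Γ π φ α) θs + td0Bbar π φ ν = 0) :
    Assumption1 μ (td0Chain Z C) (td0Kernel Γ ν) (td0States Γ ν)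
      (td0A φ α) (td0b φ α θs) (td0Abar Γ π φ α) := by
  have := isMarkovKernel_stateKernel hΓ
  have := isMarkovKernel_td0Kernel (ν := ν) hΓ
  obtain ⟨K, ρ, -, hρ0, -, hρ1, hgeo⟩ :=
    exists_geometric_ergodicity_gt hΓ hirr haper hπ (zero_lt_one (α := ℝ))
  have h00 : (0 : ℝ) ≤ α * 0 := by simp
  have h01 : α * 0 < 1 := by simp
  have hres : resolvent Γ (α * 0) = 1 := by rw [mul_zero, resolvent_zero hΓ]
  rw [td0Abar_eq hΓ] at hθs ⊢
  rw [td0Bbar_eq hΓ] at hθs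
  refine assumption1_of_coordinates hZC.isMarkovChain_td0 hZC.ae_mem_td0States
    measurableSet_td0States (fun x _ => ae_mem_td0States x) stronglyMeasurable_td0A
    (stronglyMeasurable_td0b θs) (fun x _ => (norm_tdlA_le hα.1 (x, φ x.1)).trans
      (mul_le_mul_of_nonneg_right (norm_le_phiMax φ _)
        (mul_nonneg (by linarith [hα.1]) (phiMax_nonneg φ))))
    (fun x hx => norm_tdlb_le_of_mem hν hα.1 θs (x := (x, φ x.1)) hx (norm_le_phiMax φ _))
    hρ0 hρ1 (fun a b => ?_) (fun a => ?_)
  · obtain ⟨K, hK⟩ := exists_td0_geometric (ν := ν) hΓ hgeo (measurable_tdWeight b)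
      (fun y _ => abs_tdWeight_le hα.1 b y) a
    refine ⟨K, fun x hx k => ?_⟩
    have h := hK x hx k
    rw [transitionMean_tdWeight hΓ] at h
    simp only [td0A_eq, tdlA_apply]
    rw [tdlAbar_eq hΓ h00 h01, hres, Matrix.mul_one]
    exact h
  · obtain ⟨K, hK⟩ := exists_td0_geometric (ν := ν) hΓ hgeo (measurable_tdTarget θs)
      (fun y hy => abs_tdTarget_le hα.1 θs (abs_le_of_mem_support hν hy.1)) a
    refine ⟨K, fun x hx k => ?_⟩
    have h := hK x hx k
    have hz := mulVec_transitionMean_tdTarget hΓ hν h00 h01 hθs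
    rw [hres, Matrix.mul_one] at hz
    rw [hz, Pi.zero_apply, sub_zero] at h
    simpa only [td0b_eq, tdlb_apply] using h

theorem assumption1_tdl (hΓ : Γ ∈ Matrix.rowStochastic ℝ S) (hirr : Γ.IsIrreducible)
    (haper : IsAperiodic Γ) (hπ : IsStationaryDistribution Γ π)
    (hν : ∀ i, ∀ᵐ c ∂(ν i), |c| ≤ cmax) (hα : α ∈ Set.Ico (0 : ℝ) 1)
    (h0 : 0 ≤ α * l) (h1 : α * l < 1)
    (hZC : IsMarkovRewardProcess μ Γ ν Z C) {θs : EuclideanSpace ℝ (Fin d)}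
    (hθs : app (tdlAbar Γ π φ α l) θs + tdlBbar Γ π φ ν α l = 0) :
    Assumption1 μ (tdlChain φ α l Z C) (tdlKernel Γ ν φ α l) (tdlStates Γ ν φ α l)
      (tdlA φ α) (tdlb φ α θs) (tdlAbar Γ π φ α l) := by
  have := isMarkovKernel_stateKernel hΓ
  have := isMarkovKernel_td0Kernel (ν := ν) hΓ
  have := isMarkovKernel_tdlKernel (ν := ν) (φ := φ) (α := α) (l := l) hΓ
  obtain ⟨K, ρ, hK0, hρ0, hrρ, hρ1, hgeo⟩ := exists_geometric_ergodicity_gt hΓ hirr haper hπ h1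
  refine assumption1_of_coordinates hZC.isMarkovChain_tdl (hZC.ae_mem_tdlStates h0 h1)
    measurableSet_tdlStates (fun x hx => ae_mem_tdlStates h0 h1 hx) stronglyMeasurable_tdlA
    (stronglyMeasurable_tdlb θs) (fun x hx => (norm_tdlA_le hα.1 x).trans
      (mul_le_mul_of_nonneg_right hx.2
        (mul_nonneg (by linarith [hα.1]) (phiMax_nonneg φ))))
    (fun x hx => norm_tdlb_le_of_mem hν hα.1 θs hx.1 hx.2)
    hρ0 hρ1 (fun a b => ?_) (fun a => ?_)
  · obtain ⟨K, hK⟩ := exists_tdl_geometric (ν := ν) hΓ hπ hK0 h0 hrρ hρ1 hgeo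
      (measurable_tdWeight b) (fun y _ => abs_tdWeight_le hα.1 b y) a
    refine ⟨K, fun x hx k => ?_⟩
    have h := hK x hx k
    rw [transitionMean_tdWeight hΓ] at h
    simp only [tdlA_apply]
    rw [tdlAbar_eq hΓ h0 h1]
    exact h
  · obtain ⟨K, hK⟩ := exists_tdl_geometric (ν := ν) hΓ hπ hK0 h0 hrρ hρ1 hgeo
      (measurable_tdTarget θs)
      (fun y hy => abs_tdTarget_le hα.1 θs (abs_le_of_mem_support hν hy.1)) a
    refine ⟨K, fun x hx k => ?_⟩
    have h := hK x hx k
    rw [mulVec_transitionMean_tdTarget hΓ hν h0 h1 hθs, Pi.zero_apply, sub_zero] at h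
    simpa only [tdlb_apply] using h

end Assumptions

end TDLearning

/-! ### Assembly for TD(0) and TD(λ) -/

theorem mainTheorem6
    {S : Type*} [Fintype S] [DecidableEq S] [MeasurableSpace S] [MeasurableSingletonClass S]
    (Γ : Matrix S S ℝ) (hΓ : Γ ∈ Matrix.rowStochastic ℝ S)
    (hirr : Γ.IsIrreducible) (haper : IsAperiodic Γ)
    (π : S → ℝ) (hπ : IsStationaryDistribution Γ π)
    (ν : Kernel S ℝ) [IsMarkovKernel ν] (cmax : ℝ) (hν : ∀ i, ∀ᵐ c ∂(ν i), |c| ≤ cmax)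
    (α : ℝ) (hα : α ∈ Set.Ico (0 : ℝ) 1)
    {d : ℕ} (φ : S → EuclideanSpace ℝ (Fin d)) (hφ : (featureMatrix φ).rank = d)
    {Ω : Type*} [MeasurableSpace Ω] (μ : Measure Ω) [IsProbabilityMeasure μ]
    (Z : ℕ → Ω → S) (C : ℕ → Ω → ℝ) (hZC : IsMarkovRewardProcess μ Γ ν Z C)
    (ε : ℝ) (hε : ε ∈ Set.Ioo (0 : ℝ) 1) (θ₀ : EuclideanSpace ℝ (Fin d)) :
    -- TD(0)
    ((∀ i, ‖φ i‖ ≤ 1 / √(1 + α)) →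
      (∃! θs, app (td0Abar Γ π φ α) θs + td0Bbar π φ ν = 0) ∧
      ∀ θs, app (td0Abar Γ π φ α) θs + td0Bbar π φ ν = 0 →
        (∀ k ω, td0Error φ α ε θ₀ θs Z C (k + 1) ω = td0Error φ α ε θ₀ θs Z C k ω +
          ε • (app (td0A φ α (td0Chain Z C k ω)) (td0Error φ α ε θ₀ θs Z C k ω) +
            td0b φ α θs (td0Chain Z C k ω))) ∧
        Assumption1 μ (td0Chain Z C) (td0Kernel Γ ν) (td0States Γ ν)
          (td0A φ α) (td0b φ α θs) (td0Abar Γ π φ α) ∧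
        Assumption2 (td0States Γ ν) (td0A φ α) (td0b φ α θs) ∧
        bMax (td0States Γ ν) (td0b φ α θs) ≤ cmax * phiMax φ + 2 * phiMax φ ^ 2 * ‖θs‖ ∧
        Assumption3 (td0Abar Γ π φ α) ∧
        (∃! P, IsLyapunovSolution (td0Abar Γ π φ α) P) ∧
        FiniteTimeBound μ (td0Kernel Γ ν) (td0States Γ ν)
          (td0A φ α) (td0b φ α θs) (td0Abar Γ π φ α) ε (θ₀ - θs)
          (td0Error φ α ε θ₀ θs Z C)) ∧
    -- TD(λ)
    (∀ l ∈ Set.Icc (0 : ℝ) 1, (∀ i, ‖φ i‖ ≤ √((1 - α * l) / (1 + α))) →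
      (∃! θs, app (tdlAbar Γ π φ α l) θs + tdlBbar Γ π φ ν α l = 0) ∧
      ∀ θs, app (tdlAbar Γ π φ α l) θs + tdlBbar Γ π φ ν α l = 0 →
        (∀ k ω, tdlError φ α l ε θ₀ θs Z C (k + 1) ω = tdlError φ α l ε θ₀ θs Z C k ω +
          ε • (app (tdlA φ α (tdlChain φ α l Z C k ω)) (tdlError φ α l ε θ₀ θs Z C k ω) +
            tdlb φ α θs (tdlChain φ α l Z C k ω))) ∧
        Assumption1 μ (tdlChain φ α l Z C) (tdlKernel Γ ν φ α l) (tdlStates Γ ν φ α l)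
          (tdlA φ α) (tdlb φ α θs) (tdlAbar Γ π φ α l) ∧
        Assumption2 (tdlStates Γ ν φ α l) (tdlA φ α) (tdlb φ α θs) ∧
        bMax (tdlStates Γ ν φ α l) (tdlb φ α θs) ≤
          (cmax + (1 + α) * phiMax φ * ‖θs‖) * (phiMax φ / (1 - α * l)) ∧
        Assumption3 (tdlAbar Γ π φ α l) ∧
        (∃! P, IsLyapunovSolution (tdlAbar Γ π φ α l) P) ∧
        FiniteTimeBound μ (tdlKernel Γ ν φ α l) (tdlStates Γ ν φ α l)
          (tdlA φ α) (tdlb φ α θs) (tdlAbar Γ π φ α l) ε (θ₀ - θs)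
          (tdlError φ α l ε θ₀ θs Z C)) := by
  have hpos := hπ.pos hΓ hirr haper
  have hα0 := hα.1
  have hα1 := hα.2
  have hφ0 := phiMax_nonneg φ
  have hk0 := isMarkovKernel_stateKernel hΓ
  have hk1 := isMarkovKernel_td0Kernel (ν := ν) hΓ
  -- The sign follows from the bound itself: some state exists because π has total mass 1, and its
  -- reward law is a probability measure.
  have hcmax : 0 ≤ cmax := by
    obtain ⟨i⟩ : Nonempty S := by
      by_contra h
      rw [not_nonempty_iff] at h
      simpa using hπ.sum_eq_one
    obtain ⟨c, hc⟩ := (hν i).exists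
    exact (abs_nonneg c).trans hc
  refine ⟨fun hnorm => ?_, fun l hl hnorm => ?_⟩
  · have hneg : IsNegDef (td0Abar Γ π φ α) := by
      rw [td0Abar_eq hΓ]
      exact isNegDef_tdlAbar hΓ hπ hpos hα (by simp) hφ
    refine ⟨hneg.existsUnique _, fun θs hθs => ?_⟩
    have h1 := assumption1_td0 hΓ hirr haper hπ hν hα hZC hθs
    have hsq : phiMax φ * phiMax φ ≤ 1 / (1 + α) :=
      phiMax_sq_le (by positivity) fun i => by
        rw [Real.sqrt_div zero_le_one, Real.sqrt_one]
        exact hnorm i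
    have hAle : ∀ x ∈ td0States Γ ν, ‖td0A φ α x‖ ≤ 1 := fun x _ =>
      calc ‖td0A φ α x‖ ≤ ‖φ x.1‖ * ((1 + α) * phiMax φ) := norm_tdlA_le hα0 (x, φ x.1)
        _ ≤ phiMax φ * ((1 + α) * phiMax φ) := by gcongr; exact norm_le_phiMax φ _
        _ = (1 + α) * (phiMax φ * phiMax φ) := by ring
        _ ≤ (1 + α) * (1 / (1 + α)) := by gcongr
        _ = 1 := by field_simp
    have hble : ∀ x ∈ td0States Γ ν,
        ‖td0b φ α θs x‖ ≤ cmax * phiMax φ + 2 * phiMax φ ^ 2 * ‖θs‖ := fun x hx =>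
      calc ‖td0b φ α θs x‖ ≤ (cmax + (1 + α) * phiMax φ * ‖θs‖) * phiMax φ :=
            norm_tdlb_le_of_mem hν hα0 θs (x := (x, φ x.1)) hx (norm_le_phiMax φ _)
        -- The factor 2 of the TD(0) bound is 1 + α ≤ 2.
        _ ≤ (cmax + 2 * phiMax φ * ‖θs‖) * phiMax φ := by gcongr; linarith
        _ = _ := by ring
    have h2 := assumption2_of_bound hAle hble
    have hrec : ∀ k ω, td0Error φ α ε θ₀ θs Z C (k + 1) ω = td0Error φ α ε θ₀ θs Z C k ω +
        ε • (app (td0A φ α (td0Chain Z C k ω)) (td0Error φ α ε θ₀ θs Z C k ω) +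
          td0b φ α θs (td0Chain Z C k ω)) := fun k ω => tdUpdate_sub ε θs _ _ _ _ _
    exact ⟨hrec, h1, h2, bMax_le (by positivity) hble, hneg.assumption3, hneg.existsUnique_lyapunov,
      finiteTimeBound h1 h2 stronglyMeasurable_td0A (stronglyMeasurable_td0b θs) hε.1
        (fun ω => rfl) hrec⟩
  · have hr0 : 0 ≤ α * l := mul_nonneg hα0 hl.1
    have hr1 : α * l < 1 := (mul_le_of_le_one_right hα0 hl.2).trans_lt hα1
    have hs : 0 < 1 - α * l := by linarith
    have hk2 := isMarkovKernel_tdlKernel (ν := ν) (φ := φ) (α := α) (l := l) hΓ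
    have hneg : IsNegDef (tdlAbar Γ π φ α l) := isNegDef_tdlAbar hΓ hπ hpos hα hl hφ
    refine ⟨hneg.existsUnique _, fun θs hθs => ?_⟩
    have h1 := assumption1_tdl hΓ hirr haper hπ hν hα hr0 hr1 hZC hθs
    have hsq : phiMax φ * phiMax φ ≤ (1 - α * l) / (1 + α) := phiMax_sq_le (by positivity) hnorm
    have hAle : ∀ x ∈ tdlStates Γ ν φ α l, ‖tdlA φ α x‖ ≤ 1 := fun x hx =>
      calc ‖tdlA φ α x‖ ≤ ‖x.2‖ * ((1 + α) * phiMax φ) := norm_tdlA_le hα0 x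
        _ ≤ phiMax φ / (1 - α * l) * ((1 + α) * phiMax φ) := by gcongr; exact hx.2
        _ = (1 + α) / (1 - α * l) * (phiMax φ * phiMax φ) := by ring
        _ ≤ (1 + α) / (1 - α * l) * ((1 - α * l) / (1 + α)) := by gcongr
        _ = 1 := by field_simp
    have hble : ∀ x ∈ tdlStates Γ ν φ α l, ‖tdlb φ α θs x‖ ≤
        (cmax + (1 + α) * phiMax φ * ‖θs‖) * (phiMax φ / (1 - α * l)) := fun x hx =>
      norm_tdlb_le_of_mem hν hα0 θs hx.1 hx.2
    have h2 := assumption2_of_bound hAle hble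
    have hrec : ∀ k ω, tdlError φ α l ε θ₀ θs Z C (k + 1) ω = tdlError φ α l ε θ₀ θs Z C k ω +
        ε • (app (tdlA φ α (tdlChain φ α l Z C k ω)) (tdlError φ α l ε θ₀ θs Z C k ω) +
          tdlb φ α θs (tdlChain φ α l Z C k ω)) := fun k ω => tdUpdate_sub ε θs _ _ _ _ _
    exact ⟨hrec, h1, h2, bMax_le (by positivity) hble, hneg.assumption3, hneg.existsUnique_lyapunov,
      finiteTimeBound h1 h2 stronglyMeasurable_tdlA (stronglyMeasurable_tdlb θs) hε.1
        (fun ω => rfl) hrec⟩
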